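/- Let $A,G\in\mathbb R^{n\times n}$, $B,c,k,p\in\mathbb R^n$ and let $r,\tau\ge 0$. Assume that $A+Bk'$ and $A+pc'$ are Hurwitz (all eigenvalues have negative real part). Here $'$ is transposition, $|\cdot|$ is the Euclidean norm, and "measurable and (locally) bounded" refers to actual, not essential, bounds and suprema. For holding period $T_2>0$ and sampling period $T_1>0$ consider, for $t\ge 0$, the closed loop $$\dot x(t)=Ax(t)+Bu(t-\tau)+Gd(t),$$ $$\dot z(t)=Az(t)+Bu(t-r-\tau)+p\,(c'z(t)-w(t)),$$ $$\dot w(t)=c'Az(t)+c'Bu(t-r-\tau)\ \text{ for } t\in[\tau_i,\tau_{i+1}),\qquad w(\tau_{i+1})=c'x(\tau_{i+1}-r)+\xi(\tau_{i+1}),$$ $$\tau_0=0,\qquad \tau_{i+1}=\tau_i+T_1\exp(-b(\tau_i)),$$ $$u(t)=k'\exp(A(r+\tau))\,z(iT_2)+\int_{-r-\tau}^0 k'\exp(-As)B\,u(iT_2+s)\,ds\ \text{ for } t\in[iT_2,(i+1)T_2),\quad i=0,1,2,\dots,$$ with initial data $x=x_0$ on $[-r,0]$, $u=u_0$ on $[-r-\tau,0)$,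 $z(0)=z_0$, $w(0)=w_0$. The differential equations are understood in the Carathéodory sense (absolutely continuous solutions; $z$ is continuous across the sampling times, $w$ is absolutely continuous on compact subintervals of each $[\tau_i,\tau_{i+1})$). Then there exist $T_1^{\max},T_2^{\max}>0$ such that for all $T_1\in(0,T_1^{\max}]$ and $T_2\in(0,T_2^{\max}]$ there exist constants $\Theta_1,\dots,\Theta_7>0$ and $\sigma,\omega,\beta>0$ such that the following holds. For every continuous $x_0:[-r,0]\to\mathbb R^n$, every measurable bounded $u_0:[-r-\tau,0]\to\mathbb R$, all $z_0\in\mathbb R^n$, $w_0\in\mathbb R$, and all measurable locally bounded $\xi:[0,\infty)\to\mathbb R$, $b:[0,\infty)\to[0,\infty)$, $d:[0,\infty)\to\mathbb R^n$, the closed loop has a unique solution $(x,u,z,w)$, it exists for all times, and for all $t\ge 0$ $$|z(t)|+|w(t)|+\sup_{-r\le\theta\le 0}|x(t+\theta)|+\sup_{-r-\tau\le\theta<0}|u(t+\theta)|$$ $$\le e^{-\sigma t}M(\bar b)\Big(\Theta_1|z_0|+\Theta_2|w_0|+\Theta_3\sup_{-r\le\theta\le0}|x_0(\theta)|+\Theta_4\sup_{-r-\tau\le\theta<0}|u_0(\theta)|\Big)$$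 $$+M(\bar b)\,\Theta_5\sup_{0\le s\le t}\big(e^{-\sigma(t-s)}|\xi(s)|\big)+M(\bar b)\,\Theta_6\sup_{0\le s\le t}\big(e^{-\sigma(t-s)}|d(s)|\big),$$ where $\bar b=\sup_{0\le s\le jT_2+\tau}b(s)$, $j=\min\{j\in\mathbb Z_{\ge0}: jT_2\ge r+T_1\}$, $$M(\rho)=\left(\frac{\Theta_7\exp(\beta T_2)}{\sqrt{1-\exp(-\omega T_1\exp(-\rho))}}\right)^{g(j+\tau/T_2)},\qquad g(t)=\min\{m\in\mathbb Z_{\ge0}:t\le m\}.$$ (For $r+\tau=0$ the suprema of $|u(t+\theta)|$ and $|u_0(\theta)|$ over the empty set are $0$.) -/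

import Mathlib

open MeasureTheory

/-- A real square matrix is Hurwitz if all its complex eigenvalues have negative real part. -/
def IsHurwitzMatrix {n : ℕ} (A : Matrix (Fin n) (Fin n) ℝ) : Prop :=
  ∀ μ ∈ spectrum ℂ (A.map (fun a : ℝ => (a : ℂ))), μ.re < 0

/-- The linear action `v ↦ A v` of a matrix on `ℝⁿ` with its Euclidean norm. -/
noncomputable def matAct {n : ℕ} (A : Matrix (Fin n) (Fin n) ℝ) (v : EuclideanSpace ℝ (Fin n)) :
    EuclideanSpace ℝ (Fin n) :=
  Matrix.toEuclideanCLM (𝕜 := ℝ) A v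

/-- The rank-one matrix `u v'`. -/
def outerProd {n : ℕ} (u v : EuclideanSpace ℝ (Fin n)) : Matrix (Fin n) (Fin n) ℝ :=
  Matrix.vecMulVec u.ofLp v.ofLp

/-- `f` is (Lebesgue) measurable and locally bounded on the set `I`. The bound is a genuine
(not an essential) one; functions that differ on a null set are not identified. On a compact `I`
this is the class of measurable bounded functions on `I`. Values outside `I` play no role. -/
def IsLInftyLoc {E : Type*} [NormedAddCommGroup E] (I : Set ℝ) (f : ℝ → E) : Prop :=
  AEStronglyMeasurable f (volume.restrict I) ∧
    ∀ K : Set ℝ, K ⊆ I → IsCompact K → ∃ C : ℝ, ∀ t ∈ K, ‖f t‖ ≤ C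

/-- The actual supremum `sup_{s ∈ S} |f s|`. -/
noncomputable def supNormOn {E : Type*} [NormedAddCommGroup E] (S : Set ℝ) (f : ℝ → E) : ℝ :=
  sSup ((fun s => ‖f s‖) '' S)

/-- The exponentially discounted supremum `sup_{0 ≤ s ≤ t} exp (-σ (t - s)) |f s|`. -/
noncomputable def discountedSup {E : Type*} [NormedAddCommGroup E] (σ : ℝ) (f : ℝ → E) (t : ℝ) :
    ℝ :=
  sSup ((fun s => Real.exp (-σ * (t - s)) * ‖f s‖) '' Set.Icc 0 t)

/-- The history of `f` at time `t`: the function `θ ↦ f (t + θ)`. -/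
def historyAt {E : Type*} (f : ℝ → E) (t : ℝ) : ℝ → E := fun θ => f (t + θ)

/-- `y` is an absolutely continuous (Carathéodory) solution of `y' = f`, started at time `a`,
on the interval `J` (with left end point `a ∈ J`), written in integral form. -/
def SolvesODEFrom {E : Type*} [NormedAddCommGroup E] [NormedSpace ℝ E] (a : ℝ) (J : Set ℝ)
    (y f : ℝ → E) : Prop :=
  ∀ t ∈ J, IntervalIntegrable f volume a t ∧ y t = y a + ∫ s in a..t, f s

/-- The sampling times `τ₀ = 0`, `τᵢ₊₁ = τᵢ + T₁ exp (-b(τᵢ))`. -/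
noncomputable def samplingTime (T₁ : ℝ) (b : ℝ → ℝ) : ℕ → ℝ
  | 0 => 0
  | i + 1 => samplingTime T₁ b i + T₁ * Real.exp (-b (samplingTime T₁ b i))

/-- `(x, u, z, w)` is a solution on `[0, ∞)` of the closed loop formed by the plant
`x'(t) = A x(t) + B u(t-τ) + G d(t)`, the sampled-data observer with state `(z, w)` driven by the
samples `c' x(τᵢ - r) + ξ(τᵢ)`, and the zero-order-hold predictor feedback with holding period
`T₂`, with initial data `x₀, u₀, z₀, w₀` and inputs `ξ, b, d`. Only the values of `x` on
`[-r, ∞)`, of `u` on `[-r-τ, ∞)` and of `z, w` on `[0, ∞)` are relevant. -/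
structure IsClosedLoopSolution {n : ℕ} (A G : Matrix (Fin n) (Fin n) ℝ)
    (B c k p : EuclideanSpace ℝ (Fin n)) (r τ T₁ T₂ : ℝ)
    (x₀ : ℝ → EuclideanSpace ℝ (Fin n)) (u₀ : ℝ → ℝ)
    (z₀ : EuclideanSpace ℝ (Fin n)) (w₀ : ℝ)
    (ξ b : ℝ → ℝ) (d : ℝ → EuclideanSpace ℝ (Fin n))
    (x : ℝ → EuclideanSpace ℝ (Fin n)) (u : ℝ → ℝ)
    (z : ℝ → EuclideanSpace ℝ (Fin n)) (w : ℝ → ℝ) : Prop where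
  x_init : ∀ θ ∈ Set.Icc (-r) 0, x θ = x₀ θ
  u_init : ∀ θ ∈ Set.Ico (-r - τ) 0, u θ = u₀ θ
  z_init : z 0 = z₀
  w_init : w 0 = w₀
  x_ode : SolvesODEFrom 0 (Set.Ici 0) x
    (fun t => matAct A (x t) + u (t - τ) • B + matAct G (d t))
  z_ode : SolvesODEFrom 0 (Set.Ici 0) z
    (fun t => matAct A (z t) + u (t - r - τ) • B + (inner ℝ c (z t) - w t) • p)
  w_ode : ∀ i : ℕ, SolvesODEFrom (samplingTime T₁ b i)
    (Set.Ico (samplingTime T₁ b i) (samplingTime T₁ b (i + 1))) w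
    (fun t => inner ℝ c (matAct A (z t)) + inner ℝ c B * u (t - r - τ))
  w_sample : ∀ i : ℕ, w (samplingTime T₁ b (i + 1)) =
    inner ℝ c (x (samplingTime T₁ b (i + 1) - r)) + ξ (samplingTime T₁ b (i + 1))
  u_hold : ∀ i : ℕ, ∀ t ∈ Set.Ico ((i : ℝ) * T₂) (((i : ℝ) + 1) * T₂),
    u t = inner ℝ k (matAct (NormedSpace.exp ((r + τ) • A)) (z ((i : ℝ) * T₂))) +
      ∫ s in (-r - τ)..0,
        inner ℝ k (matAct (NormedSpace.exp ((-s) • A)) B) * u ((i : ℝ) * T₂ + s)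

/-- The integer `j = min {j ∈ ℤ⁺ : j T₂ ≥ r + T₁}`. -/
noncomputable def holdIndex (r T₁ T₂ : ℝ) : ℕ := sInf {j : ℕ | r + T₁ ≤ (j : ℝ) * T₂}

/-- The gain `M(ρ)`; here `⌈s⌉₊` is the least non-negative integer `m` with `s ≤ m`. -/
noncomputable def gainM (Θ₇ β ω r τ T₁ T₂ ρ : ℝ) : ℝ :=
  (Θ₇ * Real.exp (β * T₂) / Real.sqrt (1 - Real.exp (-ω * T₁ * Real.exp (-ρ)))) ^
    ⌈(holdIndex r T₁ T₂ : ℝ) + τ / T₂⌉₊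

/-! Write `F`, `φ`, `ψ` for the operators of `A`, `c'`, `k'`, and `δ = r + τ`. The observer state
`z` estimates the delayed state `x(t - r)`. Let `X` be the solution of the delayed plant equation on
`[0, ∞)` with `X(t) = x(t - r)` for `t ≥ r` (`exists_backward_extension`). The errors `e = z - X`
and `η = w - φ(X)` satisfy `e' = F e + (φ(e) - η) p - g`, where `g` is the delayed disturbance, and
between samples `η` is the reset value plus the integral of `φ(F e - g)`. Resets after time `r`
leave only the measurement noise; earlier ones are controlled by the noise and the initial data.
Every gap between samples is at most `T₁`, so the part of `η` driven by `e` is `O(T₁)` and a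
small-gain argument around the Hurwitz operator `F + p φ` gives decay of `e` and `η`
(`exists_sampledObserver_estimate`).

The predictor `Y(t) = exp(δF) z(t) + ∫ exp((t-s)F) B u(s) ds` over `[t-δ, t]` removes the delay: `Y'
= F Y + B u + v exp(δF) p` with `v = φ(z) - w = φ(e) - η` already known to decay. The hold law says
that `u` is `ψ(Y)` at the last holding time, so a second small-gain argument, around `F + B ψ` and
with `T₂` small, gives decay of `Y` (`exists_sampleHold_estimate`). Then `u`, `z`, `w` and `x` are
recovered in turn from `Y`, `v` and `e` (`exists_sampledPredictorLoop_estimate`).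

All bounds are proved on a finite horizon for data below an envelope `D exp(-σ s)`. With horizon `t`
and `D` equal to `exp(σ t)` times the discounted suprema this is the fading-memory estimate. The
constants do not depend on the sampling schedule, so the factor `M` of the statement, which is at
least one for suitable parameters, only weakens the bound (`one_le_gainM`).

Uniqueness is the same estimate applied to the difference of two solutions, which has zero data. For
existence take `(u, v)` as unknown: since `v' = φ(p) v` between samples, `v` is explicit on each
sampling interval and `u` is constant on each holding interval, so both are found by recursion over
these intervals (`exists_sampledHoldLoop`). -/

set_option linter.unusedSectionVars false

/-! ### Exponential decay of the semigroup of a Hurwitz matrix -/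

/-- In a complex Banach algebra, if the powers of `exp a` have spectral radius below one, then
`exp (t a)` decays exponentially. -/
theorem exists_norm_exp_smul_le_of_spectralRadius_lt_one {𝔸 : Type*} [NormedRing 𝔸]
    [NormedAlgebra ℂ 𝔸] [CompleteSpace 𝔸] (a : 𝔸)
    (h : spectralRadius ℂ (NormedSpace.exp a) < 1) :
    ∃ K > (0 : ℝ), ∃ α > (0 : ℝ), ∀ t : ℝ, 0 ≤ t →
      ‖NormedSpace.exp ((t : ℂ) • a)‖ ≤ K * Real.exp (-α * t) := by
  let _ : NormedAlgebra ℚ 𝔸 := NormedAlgebra.restrictScalars ℚ ℂ 𝔸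
  obtain ⟨q, hq, hq1⟩ := ENNReal.lt_iff_exists_nnreal_btwn.1 h
  have hq1' : q < 1 := by exact_mod_cast hq1
  have hqpos : 0 < q := by
    have : (0 : ENNReal) < q := lt_of_le_of_lt (zero_le) hq
    exact_mod_cast this
  -- Gelfand's formula: eventually `‖b ^ m‖ ≤ q ^ m`. The finitely many remaining powers only
  -- enlarge the constant `K₀`.
  have hev := (spectrum.pow_nnnorm_pow_one_div_tendsto_nhds_spectralRadius
    (NormedSpace.exp a)).eventually (gt_mem_nhds hq)
  obtain ⟨N, hN⟩ := Filter.eventually_atTop.1 hev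
  set b := NormedSpace.exp a with hb
  have hlarge : ∀ m, N + 1 ≤ m → ‖b ^ m‖ ≤ (q : ℝ) ^ m := by
    intro m hm
    have h1 := (hN m (by omega)).le
    have hm0 : (0 : ℝ) < m := by exact_mod_cast (by omega : 0 < m)
    have h2 : ((‖b ^ m‖₊ : ENNReal) ^ (1 / m : ℝ)) ^ (m : ℝ) ≤ (q : ENNReal) ^ (m : ℝ) :=
      ENNReal.rpow_le_rpow h1 hm0.le
    rw [← ENNReal.rpow_mul, one_div_mul_cancel hm0.ne', ENNReal.rpow_one,
      ENNReal.rpow_natCast] at h2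
    have h3 : ‖b ^ m‖₊ ≤ q ^ m := by exact_mod_cast h2
    exact_mod_cast h3
  obtain ⟨K₀, hK₀⟩ : ∃ K₀ : ℝ, ∀ m, ‖b ^ m‖ ≤ K₀ * (q : ℝ) ^ m := by
    refine ⟨1 + ∑ i ∈ Finset.range (N + 1), ‖b ^ i‖ / (q : ℝ) ^ i, fun m => ?_⟩
    have hqm : (0 : ℝ) < (q : ℝ) ^ m := pow_pos (by exact_mod_cast hqpos) m
    have hnn : ∀ i ∈ Finset.range (N + 1), 0 ≤ ‖b ^ i‖ / (q : ℝ) ^ i := fun i _ => by positivity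
    rcases le_or_gt (N + 1) m with hm | hm
    · calc ‖b ^ m‖ ≤ 1 * (q : ℝ) ^ m := by rw [one_mul]; exact hlarge m hm
        _ ≤ _ := by
          gcongr
          linarith [Finset.sum_nonneg hnn]
    · have := Finset.single_le_sum hnn (Finset.mem_range.2 hm)
      rw [← div_le_iff₀ hqm]
      linarith
  have hq0 : (0 : ℝ) < q := by exact_mod_cast hqpos
  have hq1r : (q : ℝ) < 1 := by exact_mod_cast hq1'
  obtain ⟨K₁, hK₁⟩ : ∃ K₁ : ℝ, ∀ f ∈ Set.Icc (0 : ℝ) 1,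
      ‖NormedSpace.exp ((f : ℂ) • a)‖ ≤ K₁ := by
    have hc : Continuous fun f : ℝ => NormedSpace.exp ((f : ℂ) • a) :=
      NormedSpace.exp_continuous.comp (by fun_prop)
    exact (isCompact_Icc.exists_bound_of_continuousOn hc.continuousOn)
  have hlog : Real.log q < 0 := Real.log_neg hq0 hq1r
  have hK₀0 : 0 ≤ K₀ := by simpa using (norm_nonneg _).trans (hK₀ 0)
  have hK₁0 : 0 ≤ K₁ := (norm_nonneg _).trans (hK₁ 0 (by simp))
  refine ⟨K₀ * K₁ * (q : ℝ)⁻¹ + 1, by positivity, -Real.log q, by linarith, fun t ht => ?_⟩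
  set m := ⌊t⌋₊
  have hm1 : (m : ℝ) ≤ t := Nat.floor_le ht
  have hm2 : t < m + 1 := Nat.lt_floor_add_one t
  -- Integer part and fractional part of `t`: the first gives a power of `exp a`, the second stays
  -- in a compact set. Rounding down costs the factor `q⁻¹`.
  have hsplit : NormedSpace.exp ((t : ℂ) • a) =
      b ^ m * NormedSpace.exp (((t - m : ℝ) : ℂ) • a) := by
    rw [hb, ← NormedSpace.exp_nsmul, ← NormedSpace.exp_add_of_commute]
    · congr 1
      rw [← Nat.cast_smul_eq_nsmul ℂ, ← add_smul]
      congr 1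
      push_cast
      ring
    · exact ((Commute.refl a).smul_left _).smul_right _
  have hqt : (q : ℝ) ^ m ≤ (q : ℝ)⁻¹ * Real.exp (-(-Real.log q) * t) := by
    rw [neg_neg, mul_comm (Real.log q), ← Real.rpow_natCast, Real.rpow_def_of_pos hq0]
    rw [← Real.exp_log (inv_pos.2 hq0), Real.log_inv, ← Real.exp_add]
    apply Real.exp_le_exp.2
    nlinarith
  have hexp := Real.exp_pos (-(-Real.log q) * t)
  calc ‖NormedSpace.exp ((t : ℂ) • a)‖
      ≤ ‖b ^ m‖ * ‖NormedSpace.exp (((t - m : ℝ) : ℂ) • a)‖ := by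
        rw [hsplit]; exact norm_mul_le _ _
    _ ≤ (K₀ * (q : ℝ) ^ m) * K₁ := by
        gcongr
        · exact hK₀ m
        · exact hK₁ _ ⟨by linarith, by linarith⟩
    _ ≤ (K₀ * ((q : ℝ)⁻¹ * Real.exp (-(-Real.log q) * t))) * K₁ := by gcongr
    _ ≤ (K₀ * K₁ * (q : ℝ)⁻¹ + 1) * Real.exp (-(-Real.log q) * t) := by nlinarith

/-- The spectrum of the exponential of an endomorphism of a finite-dimensional complex space. -/
theorem exists_mem_spectrum_exp_eq {V : Type*} [NormedAddCommGroup V] [NormedSpace ℂ V]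
    [FiniteDimensional ℂ V] (T : V →L[ℂ] V) {μ : ℂ}
    (hμ : μ ∈ spectrum ℂ (NormedSpace.exp T)) :
    ∃ l ∈ spectrum ℂ T, Complex.exp l = μ := by
  have : CompleteSpace V := FiniteDimensional.complete ℂ V
  let _ : NormedAlgebra ℚ (V →L[ℂ] V) := NormedAlgebra.restrictScalars ℚ ℂ _
  rw [ContinuousLinearMap.spectrum_eq, ← Module.End.hasEigenvalue_iff_mem_spectrum] at hμ
  simp_rw [ContinuousLinearMap.spectrum_eq, ← Module.End.hasEigenvalue_iff_mem_spectrum]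
  -- The eigenspace `W` of `exp T` is invariant under the commuting `T`, so it contains an
  -- eigenvector `v` of `T`, with eigenvalue `l` say. Summing the exponential series on `v` gives
  -- `exp l = μ`.
  set W := Module.End.eigenspace ((NormedSpace.exp T : V →L[ℂ] V) : V →ₗ[ℂ] V) μ with hW
  have hcomm : Commute (T : V →ₗ[ℂ] V) ((NormedSpace.exp T : V →L[ℂ] V) : V →ₗ[ℂ] V) := by
    have : Commute T (NormedSpace.exp T) := (Commute.refl T).exp_right
    have h2 := congrArg (fun S : V →L[ℂ] V => (S : V →ₗ[ℂ] V)) this.eq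
    exact h2
  have hmaps : ∀ v ∈ W, T v ∈ W := by
    intro v hv
    rw [hW, Module.End.mem_eigenspace_iff] at hv ⊢
    have := LinearMap.congr_fun hcomm.eq v
    simp only [Module.End.mul_apply] at this
    rw [← ContinuousLinearMap.coe_coe T, ← this, hv, map_smul]
  have hWne : Nontrivial W := Submodule.nontrivial_iff_ne_bot.2 hμ
  obtain ⟨l, hl⟩ := Module.End.exists_eigenvalue ((T : V →ₗ[ℂ] V).restrict hmaps)
  obtain ⟨v, hv⟩ := hl.exists_hasEigenvector
  have hTv : T (v : V) = l • (v : V) := congrArg Subtype.val hv.apply_eq_smul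
  have hv0 : (v : V) ≠ 0 := fun h => hv.2 (Subtype.ext h)
  have hev : NormedSpace.exp T (v : V) = μ • (v : V) :=
    Module.End.mem_eigenspace_iff.1 v.2
  have hpow : ∀ k : ℕ, (T ^ k) (v : V) = l ^ k • (v : V) := by
    intro k
    induction k with
    | zero => simp
    | succ k ih =>
      rw [pow_succ', mul_apply_eq_comp, ih, map_smul, hTv, smul_smul, pow_succ]
  have h1 : HasSum (fun k : ℕ => ((k.factorial : ℂ)⁻¹ • T ^ k) (v : V))
      (NormedSpace.exp T (v : V)) :=
    (NormedSpace.exp_series_hasSum_exp' (𝕂 := ℂ) T).mapL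
      (ContinuousLinearMap.apply ℂ V (v : V))
  have h2 : HasSum (fun k : ℕ => ((k.factorial : ℂ)⁻¹ • l ^ k) • (v : V))
      (NormedSpace.exp l • (v : V)) :=
    (NormedSpace.exp_series_hasSum_exp' (𝕂 := ℂ) l).smul_const (v : V)
  have h3 := h1.unique (by
    convert h2 using 2 with k
    rw [smul_apply, hpow, smul_smul, smul_eq_mul])
  refine ⟨l, Module.End.hasEigenvalue_of_hasEigenvector
    (Module.End.hasEigenvector_iff.2 ⟨Module.End.mem_eigenspace_iff.2 hTv, hv0⟩), ?_⟩
  rw [hev] at h3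
  rw [Complex.exp_eq_exp_ℂ]
  exact (smul_left_injective ℂ hv0 h3).symm

/-- Each spectral value of `exp T` is `exp l` with `l` in the spectrum of `T`, and `|exp l| = exp
(re l) < 1`. When the spectrum is nonempty, its radius is attained, so the strict inequality
survives. An empty spectrum has radius zero. -/
theorem spectralRadius_exp_lt_one {V : Type*} [NormedAddCommGroup V] [NormedSpace ℂ V]
    [FiniteDimensional ℂ V] (T : V →L[ℂ] V) (hT : ∀ l ∈ spectrum ℂ T, l.re < 0) :
    spectralRadius ℂ (NormedSpace.exp T) < 1 := by
  have : CompleteSpace V := FiniteDimensional.complete ℂ V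
  rcases (spectrum ℂ (NormedSpace.exp T)).eq_empty_or_nonempty with h | h
  · simp [spectralRadius, h]
  · have := spectrum.spectralRadius_lt_of_forall_lt_of_nonempty h (r := 1) ?_
    · simpa using this
    · intro μ hμ
      obtain ⟨l, hl, rfl⟩ := exists_mem_spectrum_exp_eq T hμ
      rw [← NNReal.coe_lt_coe, coe_nnnorm, Complex.norm_exp, NNReal.coe_one, Real.exp_lt_one_iff]
      exact hT l hl

/-- The exponential series converges in operator norm; the inverse of `toEuclideanCLM` is linear on
a finite-dimensional space, hence continuous, and carries the convergence over to matrices. -/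
theorem Matrix.hasSum_exp_symm {𝕜 : Type*} [RCLike 𝕜] {n : ℕ} (X : Matrix (Fin n) (Fin n) 𝕜) :
    HasSum (fun k : ℕ => (k.factorial : 𝕜)⁻¹ • X ^ k)
      ((Matrix.toEuclideanCLM (𝕜 := 𝕜) (n := Fin n)).symm
        (NormedSpace.exp (Matrix.toEuclideanCLM (𝕜 := 𝕜) X))) := by
  let f : (EuclideanSpace 𝕜 (Fin n) →L[𝕜] EuclideanSpace 𝕜 (Fin n)) →ₗ[𝕜]
      Matrix (Fin n) (Fin n) 𝕜 :=
    (Matrix.toEuclideanCLM (𝕜 := 𝕜) (n := Fin n)).symm.toAlgEquiv.toLinearMap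
  have h := (NormedSpace.exp_series_hasSum_exp' (𝕂 := 𝕜)
    (Matrix.toEuclideanCLM (𝕜 := 𝕜) X)).map f (LinearMap.continuous_of_finiteDimensional f)
  convert h using 1
  swap
  · rfl
  funext k
  have : (Matrix.toEuclideanCLM (𝕜 := 𝕜) X) ^ k = Matrix.toEuclideanCLM (𝕜 := 𝕜) (X ^ k) :=
    (map_pow _ _ _).symm
  simp only [Function.comp_apply, map_smul, this]
  congr 1
  exact ((Matrix.toEuclideanCLM (𝕜 := 𝕜) (n := Fin n)).symm_apply_apply _).symm

theorem Matrix.toEuclideanCLM_exp {𝕜 : Type*} [RCLike 𝕜] {n : ℕ} (X : Matrix (Fin n) (Fin n) 𝕜) :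
    Matrix.toEuclideanCLM (𝕜 := 𝕜) (NormedSpace.exp X) =
      NormedSpace.exp (Matrix.toEuclideanCLM (𝕜 := 𝕜) X) := by
  have h := (Matrix.hasSum_exp_symm X).tsum_eq
  rw [NormedSpace.exp_eq_tsum 𝕜 (𝔸 := Matrix (Fin n) (Fin n) 𝕜)]
  simp only [h, StarAlgEquiv.apply_symm_apply]

theorem Matrix.hasSum_exp {𝕜 : Type*} [RCLike 𝕜] {n : ℕ} (X : Matrix (Fin n) (Fin n) 𝕜) :
    HasSum (fun k : ℕ => (k.factorial : 𝕜)⁻¹ • X ^ k) (NormedSpace.exp X) := by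
  have h := Matrix.hasSum_exp_symm X
  rwa [← Matrix.toEuclideanCLM_exp, StarAlgEquiv.symm_apply_apply] at h

/-- The entrywise inclusion of real into complex matrices is a continuous ring homomorphism, so it
maps one exponential series to the other. -/
theorem Matrix.exp_map_ofReal {n : ℕ} (X : Matrix (Fin n) (Fin n) ℝ) :
    NormedSpace.exp (X.map (fun a : ℝ => (a : ℂ))) =
      (NormedSpace.exp X).map (fun a : ℝ => (a : ℂ)) := by
  have h := (Matrix.hasSum_exp X).map (Complex.ofRealHom.mapMatrix (m := Fin n))
    (Continuous.matrix_map continuous_id Complex.continuous_ofReal)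
  refine (Matrix.hasSum_exp (X.map (fun a : ℝ => (a : ℂ)))).unique ?_
  convert h using 1
  swap
  · rfl
  funext k
  have h1 : (Complex.ofRealHom.mapMatrix (m := Fin n)) (X ^ k) =
      (X.map (fun a : ℝ => (a : ℂ))) ^ k := map_pow _ _ _
  rw [← h1]
  ext i j
  simp

/-- The exponential of a Hurwitz matrix decays exponentially. -/
theorem IsHurwitzMatrix.exists_norm_exp_le {n : ℕ} {A : Matrix (Fin n) (Fin n) ℝ}
    (hA : IsHurwitzMatrix A) :
    ∃ K > (0 : ℝ), ∃ α > (0 : ℝ), ∀ t : ℝ, 0 ≤ t →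
      ‖NormedSpace.exp (t • Matrix.toEuclideanCLM (𝕜 := ℝ) A)‖ ≤ K * Real.exp (-α * t) := by
  set T := Matrix.toEuclideanCLM (𝕜 := ℂ) (A.map (fun a : ℝ => (a : ℂ))) with hT
  have hspec : ∀ l ∈ spectrum ℂ T, l.re < 0 := by
    intro l hl
    refine hA l ?_
    rw [hT] at hl
    have := AlgEquiv.spectrum_eq (Matrix.toEuclideanCLM (𝕜 := ℂ) (n := Fin n)).toAlgEquiv
      (A.map (fun a : ℝ => (a : ℂ)))
    exact this ▸ hl
  obtain ⟨K, hK, α, hα, h⟩ := exists_norm_exp_smul_le_of_spectralRadius_lt_one T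
    (spectralRadius_exp_lt_one T hspec)
  refine ⟨K, hK, α, hα, fun t ht => ?_⟩
  refine ContinuousLinearMap.opNorm_le_bound _ (by positivity) fun v => ?_
  -- Complexification of vectors is isometric and intertwines the two exponentials, so the complex
  -- bound restricts to the real operator.
  have hcast : ∀ v : EuclideanSpace ℝ (Fin n),
      ‖(WithLp.toLp 2 (fun i => ((v i : ℝ) : ℂ)) : EuclideanSpace ℂ (Fin n))‖ = ‖v‖ := by
    intro v
    simp [EuclideanSpace.norm_eq]
  have hexp : NormedSpace.exp ((t : ℂ) • T)
      (WithLp.toLp 2 (fun i => ((v i : ℝ) : ℂ)) : EuclideanSpace ℂ (Fin n)) =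
      WithLp.toLp 2 (fun i => (((NormedSpace.exp
        (t • Matrix.toEuclideanCLM (𝕜 := ℝ) A)) v i : ℝ) : ℂ)) := by
    have h1 : (t : ℂ) • T = Matrix.toEuclideanCLM (𝕜 := ℂ)
        ((t • A).map (fun a : ℝ => (a : ℂ))) := by
      rw [hT, ← map_smul]
      congr 1
      ext i j
      simp
    have h2 : t • Matrix.toEuclideanCLM (𝕜 := ℝ) A = Matrix.toEuclideanCLM (𝕜 := ℝ) (t • A) := by
      rw [map_smul]
    rw [h1, h2, ← Matrix.toEuclideanCLM_exp, ← Matrix.toEuclideanCLM_exp, Matrix.exp_map_ofReal]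
    ext i
    simp [Matrix.mulVec, dotProduct]
  rw [← hcast, ← hexp, ← hcast v]
  exact (ContinuousLinearMap.le_opNorm _ _).trans (by gcongr; exact h t ht)

/-! ### Product rule and variation of constants for Carathéodory solutions -/

/-- Product rule, in integral form, for a continuously differentiable family of operators applied
to the primitive of an integrable function. -/
theorem integral_clm_apply_primitive {V : Type*} [NormedAddCommGroup V] [NormedSpace ℝ V]
    [CompleteSpace V] {E E' : ℝ → V →L[ℝ] V} (hE : ∀ t, HasDerivAt E (E' t) t)
    (hE' : Continuous E') {a b : ℝ} {H h : ℝ → V} (hh : IntervalIntegrable h volume a b)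
    (hH : ∀ t ∈ Set.Icc a b, H t = H a + ∫ s in a..t, h s) :
    ∀ t ∈ Set.Icc a b, IntervalIntegrable (fun s => E' s (H s) + E s (h s)) volume a t ∧
      E t (H t) = E a (H a) + ∫ s in a..t, (E' s (H s) + E s (h s)) := by
  intro t₀ ht₀
  have hab : a ≤ b := ht₀.1.trans ht₀.2
  have hEc : Continuous E := continuous_iff_continuousAt.2 fun t => (hE t).continuousAt
  have hsub : ∀ {x y : ℝ}, x ∈ Set.Icc a b → y ∈ Set.Icc a b → Set.uIcc x y ⊆ Set.uIcc a b := by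
    intro x y hx hy
    rw [Set.uIcc_of_le hab]
    exact Set.uIcc_subset_Icc hx hy
  have ha : a ∈ Set.Icc a b := Set.left_mem_Icc.2 hab
  have hhi : ∀ {x y : ℝ}, x ∈ Set.Icc a b → y ∈ Set.Icc a b → IntervalIntegrable h volume x y :=
    fun hx hy => hh.mono_set (hsub hx hy)
  have hHc : ContinuousOn H (Set.Icc a b) := by
    have h1 : ContinuousOn (fun t => H a + ∫ s in a..t, h s) (Set.uIcc a b) :=
      continuousOn_const.add (intervalIntegral.continuousOn_primitive_interval
        ((intervalIntegrable_iff_integrableOn_Icc_of_le hab).1 hh |>.mono_set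
          (by rw [Set.uIcc_of_le hab])))
    rw [Set.uIcc_of_le hab] at h1
    exact h1.congr hH
  have hi1 : ∀ {x y : ℝ}, x ∈ Set.Icc a b → y ∈ Set.Icc a b →
      IntervalIntegrable (fun s => E' s (H s)) volume x y := by
    intro x y hx hy
    refine ContinuousOn.intervalIntegrable ?_
    refine hE'.continuousOn.clm_apply (hHc.mono ?_)
    exact Set.uIcc_subset_Icc hx hy
  have hi2' : ∀ {G : ℝ → V →L[ℝ] V}, Continuous G → ∀ {x y : ℝ}, x ∈ Set.Icc a b →
      y ∈ Set.Icc a b → IntervalIntegrable (fun s => G s (h s)) volume x y := by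
    intro G hG x y hx hy
    have h0 := hhi hx hy
    have hb : ∃ C, ∀ s ∈ Set.uIcc x y, ‖G s‖ ≤ C :=
      isCompact_uIcc.exists_bound_of_continuousOn hG.continuousOn
    obtain ⟨C, hC⟩ := hb
    rw [intervalIntegrable_iff] at h0 ⊢
    refine Integrable.mono' (h0.norm.const_mul C) ?_ ?_
    · exact (ContinuousLinearMap.id ℝ (V →L[ℝ] V)).aestronglyMeasurable_comp₂
        hG.aestronglyMeasurable h0.aestronglyMeasurable
    · refine (ae_restrict_iff' measurableSet_uIoc).2 (Filter.Eventually.of_forall fun s hs => ?_)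
      exact ((G s).le_opNorm _).trans
        (by gcongr; exact hC s (Set.uIoc_subset_uIcc hs))
  have hi2 : ∀ {x y : ℝ}, x ∈ Set.Icc a b → y ∈ Set.Icc a b →
      IntervalIntegrable (fun s => E s (h s)) volume x y := fun hx hy => hi2' hEc hx hy
  have hi : ∀ {x y : ℝ}, x ∈ Set.Icc a b → y ∈ Set.Icc a b →
      IntervalIntegrable (fun s => E' s (H s) + E s (h s)) volume x y :=
    fun hx hy => (hi1 hx hy).add (hi2 hx hy)
  refine ⟨hi ha ht₀, ?_⟩
  set Q : ℝ → V := fun t => E t (H t) - ∫ s in a..t, (E' s (H s) + E s (h s)) with hQ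
  obtain ⟨M, hM⟩ : ∃ M, ∀ s ∈ Set.Icc a b, ‖E' s‖ ≤ M :=
    isCompact_Icc.exists_bound_of_continuousOn hE'.continuousOn
  have hM0 : 0 ≤ M := (norm_nonneg _).trans (hM a ha)
  -- As `h` is only integrable, `H` need not be differentiable everywhere. The defect `Q` is
  -- nevertheless better: its increment is at most `t - x` times a multiple of `∫ ‖h‖` over `[x,
  -- t]`, which tends to zero. Hence `Q` has right derivative zero at every point and is constant.
  have hQdiff : ∀ x ∈ Set.Icc a b, ∀ t ∈ Set.Icc x b,
      ‖Q t - Q x‖ ≤ 2 * M * (∫ s in x..t, ‖h s‖) * (t - x) := by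
    intro x hx t ht
    have ht' : t ∈ Set.Icc a b := ⟨hx.1.trans ht.1, ht.2⟩
    have hHdiff : ∀ v ∈ Set.Icc x t, H t - H v = ∫ s in v..t, h s := by
      intro v hv
      have hv' : v ∈ Set.Icc a b := ⟨hx.1.trans hv.1, hv.2.trans ht.2⟩
      rw [hH t ht', hH v hv', add_sub_add_left_eq_sub,
        intervalIntegral.integral_interval_sub_left (hhi ha ht') (hhi ha hv')]
    have h1 : (E t - E x) (H t) = ∫ v in x..t, E' v (H t) := by
      rw [← intervalIntegral.integral_eq_sub_of_hasDerivAt (f := E) (f' := E')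
        (fun s _ => hE s) (hE'.intervalIntegrable _ _)]
      exact ContinuousLinearMap.intervalIntegral_apply (hE'.intervalIntegrable _ _) _
    have h2 : E x (H t - H x) = ∫ v in x..t, E x (h v) := by
      rw [hHdiff x ⟨le_rfl, ht.1⟩]
      exact ((E x).intervalIntegral_comp_comm (hhi hx ht')).symm
    have hi3 : IntervalIntegrable (fun v => E' v (H t)) volume x t :=
      (hE'.clm_apply continuous_const).intervalIntegrable _ _
    have hi4 : IntervalIntegrable (fun v => E x (h v)) volume x t :=
      hi2' continuous_const hx ht'
    have h3 : Q t - Q x = ∫ v in x..t, (E' v (H t - H v) + (E x - E v) (h v)) := by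
      have e1 : Q t - Q x = (E t - E x) (H t) + E x (H t - H x) -
          ∫ s in x..t, (E' s (H s) + E s (h s)) := by
        rw [← intervalIntegral.integral_interval_sub_left (hi ha ht') (hi ha hx)]
        simp only [hQ, sub_apply, map_sub]
        abel
      rw [e1, h1, h2, ← intervalIntegral.integral_add hi3 hi4,
        ← intervalIntegral.integral_sub (hi3.add hi4) (hi hx ht')]
      congr 1
      funext v
      simp only [sub_apply, map_sub]
      abel
    rw [h3]
    have hbound : ∀ v ∈ Set.uIoc x t, ‖E' v (H t - H v) + (E x - E v) (h v)‖ ≤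
        M * (∫ s in x..t, ‖h s‖) + M * (t - x) * ‖h v‖ := by
      intro v hv
      rw [Set.uIoc_of_le ht.1] at hv
      have hv' : v ∈ Set.Icc a b := ⟨hx.1.trans hv.1.le, hv.2.trans ht.2⟩
      refine (norm_add_le _ _).trans (add_le_add ?_ ?_)
      · refine ((E' v).le_opNorm _).trans ?_
        gcongr
        · exact hM v hv'
        · rw [hHdiff v ⟨hv.1.le, hv.2⟩]
          refine (intervalIntegral.norm_integral_le_integral_norm hv.2).trans ?_
          refine intervalIntegral.integral_mono_interval hv.1.le hv.2 le_rfl ?_ (hhi hx ht').norm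
          exact Filter.Eventually.of_forall fun s => norm_nonneg _
      · refine ((E x - E v).le_opNorm _).trans ?_
        gcongr
        have := Convex.norm_image_sub_le_of_norm_hasDerivWithin_le (f := E) (f' := E') (C := M)
          (s := Set.Icc a b) (fun s _ => (hE s).hasDerivWithinAt) hM (convex_Icc a b) hv' hx
        refine this.trans ?_
        gcongr
        rw [Real.norm_eq_abs, abs_le]
        constructor <;> linarith [hv.1, hv.2]
    have hnh := (hhi hx ht').norm
    calc ‖∫ v in x..t, (E' v (H t - H v) + (E x - E v) (h v))‖
        ≤ ∫ v in x..t, (M * (∫ s in x..t, ‖h s‖) + M * (t - x) * ‖h v‖) := by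
          refine intervalIntegral.norm_integral_le_of_norm_le ht.1 ?_
            (intervalIntegrable_const.add (hnh.const_mul _))
          refine Filter.Eventually.of_forall fun v hv => hbound v ?_
          rwa [Set.uIoc_of_le ht.1]
      _ = 2 * M * (∫ s in x..t, ‖h s‖) * (t - x) := by
          rw [intervalIntegral.integral_add intervalIntegrable_const (hnh.const_mul _),
            intervalIntegral.integral_const, intervalIntegral.integral_const_mul, smul_eq_mul]
          ring
  have hQc : ContinuousOn Q (Set.Icc a b) := by
    refine (hEc.continuousOn.clm_apply hHc).sub ?_
    have h1 := intervalIntegral.continuousOn_primitive_interval (μ := volume)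
      (f := fun s => E' s (H s) + E s (h s)) (a := a) (b := b)
        ((intervalIntegrable_iff_integrableOn_Icc_of_le hab).1 (hi ha (Set.right_mem_Icc.2 hab))
          |>.mono_set (by rw [Set.uIcc_of_le hab]))
    rwa [Set.uIcc_of_le hab] at h1
  have hderiv : ∀ x ∈ Set.Ico a b, HasDerivWithinAt Q 0 (Set.Ici x) x := by
    intro x hx
    have hx' : x ∈ Set.Icc a b := ⟨hx.1, hx.2.le⟩
    have hlim : Filter.Tendsto (fun t => 2 * M * ∫ s in x..t, ‖h s‖)
        (nhdsWithin x (Set.Icc x b)) (nhds 0) := by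
      have h1 := intervalIntegral.continuousOn_primitive_interval (μ := volume)
        (f := fun s => ‖h s‖) (a := x) (b := b)
        ((intervalIntegrable_iff_integrableOn_Icc_of_le hx.2.le).1
          (hhi hx' (Set.right_mem_Icc.2 hab)).norm |>.mono_set (by rw [Set.uIcc_of_le hx.2.le]))
      rw [Set.uIcc_of_le hx.2.le] at h1
      have h2 := (h1 x (Set.left_mem_Icc.2 hx.2.le)).tendsto.const_mul (2 * M)
      simpa using h2
    have hnh : nhdsWithin x (Set.Icc x b) = nhdsWithin x (Set.Ici x) :=
      nhdsWithin_Icc_eq_nhdsGE hx.2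
    rw [hnh] at hlim
    rw [hasDerivWithinAt_iff_isLittleO]
    simp only [smul_zero, sub_zero]
    rw [Asymptotics.isLittleO_iff]
    intro c hc
    have h1 := hlim.eventually (gt_mem_nhds hc)
    have h2 : ∀ᶠ t in nhdsWithin x (Set.Ici x), t ∈ Set.Icc x b := by
      rw [← hnh]; exact self_mem_nhdsWithin
    filter_upwards [h1, h2] with t ht1 ht2
    refine (hQdiff x hx' t ht2).trans ?_
    rw [Real.norm_of_nonneg (by linarith [ht2.1])]
    exact mul_le_mul_of_nonneg_right ht1.le (by linarith [ht2.1])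
  have := constant_of_has_deriv_right_zero hQc hderiv t₀ ht₀
  simp only [hQ, intervalIntegral.integral_same, sub_zero] at this
  rw [← this]
  abel

theorem NormedSpace.exp_add_smul_real {𝔸 : Type*} [NormedRing 𝔸] [NormedAlgebra ℝ 𝔸]
    [CompleteSpace 𝔸] (a : 𝔸) (s t : ℝ) :
    NormedSpace.exp (s • a) * NormedSpace.exp (t • a) = NormedSpace.exp ((s + t) • a) := by
  let _ : NormedAlgebra ℚ 𝔸 := NormedAlgebra.restrictScalars ℚ ℝ 𝔸
  rw [add_smul, NormedSpace.exp_add_of_commute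
    (((Commute.refl a).smul_left s).smul_right t)]

theorem NormedSpace.continuous_exp_smul_real {𝔸 : Type*} [NormedRing 𝔸] [NormedAlgebra ℝ 𝔸]
    [CompleteSpace 𝔸] (a : 𝔸) : Continuous fun t : ℝ => NormedSpace.exp (t • a) := by
  let _ : NormedAlgebra ℚ 𝔸 := NormedAlgebra.restrictScalars ℚ ℝ 𝔸
  exact NormedSpace.exp_continuous.comp (by fun_prop)

section
variable {V : Type*} [NormedAddCommGroup V] [NormedSpace ℝ V] [CompleteSpace V]

theorem exp_smul_apply_apply (F : V →L[ℝ] V) (s t : ℝ) (v : V) :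
    NormedSpace.exp (s • F) (NormedSpace.exp (t • F) v) = NormedSpace.exp ((s + t) • F) v := by
  rw [← NormedSpace.exp_add_smul_real F s t]
  rfl

theorem exp_smul_apply_comm (F : V →L[ℝ] V) (s : ℝ) (v : V) :
    NormedSpace.exp (s • F) (F v) = F (NormedSpace.exp (s • F) v) := by
  have : Commute F (NormedSpace.exp (s • F)) := ((Commute.refl F).smul_right s).exp_right
  rw [← mul_apply_eq_comp, ← mul_apply_eq_comp, this.eq]

theorem IntervalIntegrable.clm_apply_continuous {G : ℝ → V →L[ℝ] V} (hG : Continuous G) {x y : ℝ}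
    {h : ℝ → V} (h0 : IntervalIntegrable h volume x y) :
    IntervalIntegrable (fun s => G s (h s)) volume x y := by
  obtain ⟨C, hC⟩ : ∃ C, ∀ s ∈ Set.uIcc x y, ‖G s‖ ≤ C :=
    isCompact_uIcc.exists_bound_of_continuousOn hG.continuousOn
  rw [intervalIntegrable_iff] at h0 ⊢
  refine Integrable.mono' (h0.norm.const_mul C) ?_ ?_
  · exact (ContinuousLinearMap.id ℝ (V →L[ℝ] V)).aestronglyMeasurable_comp₂
      hG.aestronglyMeasurable h0.aestronglyMeasurable
  · refine (ae_restrict_iff' measurableSet_uIoc).2 (Filter.Eventually.of_forall fun s hs => ?_)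
    exact ((G s).le_opNorm _).trans (by gcongr; exact hC s (Set.uIoc_subset_uIcc hs))

/-- The variation of constants formula for `y' = F y + g`, `y(a) = y₀`. -/
noncomputable def variationOfConstants (F : V →L[ℝ] V) (a : ℝ) (y₀ : V) (g : ℝ → V) (t : ℝ) : V :=
  NormedSpace.exp ((t - a) • F) (y₀ + ∫ s in a..t, NormedSpace.exp ((a - s) • F) (g s))

theorem variationOfConstants_self (F : V →L[ℝ] V) (a : ℝ) (y₀ : V) (g : ℝ → V) :
    variationOfConstants F a y₀ g a = y₀ := by
  let _ : NormedAlgebra ℚ (V →L[ℝ] V) := NormedAlgebra.restrictScalars ℚ ℝ _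
  simp [variationOfConstants, NormedSpace.exp_zero]

theorem hasDerivAt_exp_sub_smul (F : V →L[ℝ] V) (a t : ℝ) :
    HasDerivAt (fun t : ℝ => NormedSpace.exp ((t - a) • F))
      (F * NormedSpace.exp ((t - a) • F)) t := by
  have h := (hasDerivAt_exp_smul_const' F (t - a)).scomp t ((hasDerivAt_id t).sub_const a)
  rw [one_smul] at h
  exact h

theorem hasDerivAt_exp_sub_smul' (F : V →L[ℝ] V) (a t : ℝ) :
    HasDerivAt (fun t : ℝ => NormedSpace.exp ((a - t) • F))
      (-(NormedSpace.exp ((a - t) • F) * F)) t := by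
  have h := (hasDerivAt_exp_smul_const F (a - t)).scomp t ((hasDerivAt_id t).const_sub a)
  rw [neg_one_smul] at h
  exact h

theorem solvesODEFrom_variationOfConstants (F : V →L[ℝ] V) {a b : ℝ} (y₀ : V) {g : ℝ → V}
    (hg : IntervalIntegrable g volume a b) :
    SolvesODEFrom a (Set.Icc a b) (variationOfConstants F a y₀ g)
      (fun t => F (variationOfConstants F a y₀ g t) + g t) := by
  intro t ht
  have hc : Continuous fun s : ℝ => NormedSpace.exp ((a - s) • F) :=
    (NormedSpace.continuous_exp_smul_real F).comp (by fun_prop : Continuous fun s : ℝ => a - s)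
  have hc' : Continuous fun s : ℝ => NormedSpace.exp ((s - a) • F) :=
    (NormedSpace.continuous_exp_smul_real F).comp (by fun_prop : Continuous fun s : ℝ => s - a)
  have h := integral_clm_apply_primitive (E := fun s => NormedSpace.exp ((s - a) • F))
    (E' := fun s => F * NormedSpace.exp ((s - a) • F)) (fun s => hasDerivAt_exp_sub_smul F a s)
    (continuous_const.mul hc')
    (H := fun s => y₀ + ∫ v in a..s, NormedSpace.exp ((a - v) • F) (g v))
    (hg.clm_apply_continuous hc) (fun s _ => by simp) t ht
  have hz : NormedSpace.exp ((0 : ℝ) • F) = 1 := by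
    let _ : NormedAlgebra ℚ (V →L[ℝ] V) := NormedAlgebra.restrictScalars ℚ ℝ _
    simp [NormedSpace.exp_zero]
  have hfun : (fun s => (F * NormedSpace.exp ((s - a) • F))
      (y₀ + ∫ v in a..s, NormedSpace.exp ((a - v) • F) (g v)) +
      NormedSpace.exp ((s - a) • F) (NormedSpace.exp ((a - s) • F) (g s))) =
      fun t => F (variationOfConstants F a y₀ g t) + g t := by
    funext s
    rw [exp_smul_apply_apply]
    simp [variationOfConstants]
  rw [hfun] at h
  refine ⟨h.1, ?_⟩
  rw [variationOfConstants_self]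
  have h2 := h.2
  simp only [sub_self, hz, intervalIntegral.integral_same, add_zero] at h2
  exact h2

/-- By the product rule `exp((a - t)F) y(t)` is a primitive of `exp((a - s)F) g(s)`, because the
terms with `F y` cancel. In particular the linear equation has at most one solution. -/
theorem SolvesODEFrom.eq_variationOfConstants {F : V →L[ℝ] V} {a b : ℝ} {y g : ℝ → V}
    (hy : SolvesODEFrom a (Set.Icc a b) y (fun t => F (y t) + g t)) :
    ∀ t ∈ Set.Icc a b, y t = variationOfConstants F a (y a) g t := by
  intro t ht
  have hc : Continuous fun s : ℝ => NormedSpace.exp ((a - s) • F) :=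
    (NormedSpace.continuous_exp_smul_real F).comp (by fun_prop : Continuous fun s : ℝ => a - s)
  have hb : b ∈ Set.Icc a b := ⟨ht.1.trans ht.2, le_rfl⟩
  have h := (integral_clm_apply_primitive (E := fun s => NormedSpace.exp ((a - s) • F))
    (E' := fun s => -(NormedSpace.exp ((a - s) • F) * F))
    (fun s => hasDerivAt_exp_sub_smul' F a s) (hc.mul continuous_const).neg
    (hy b hb).1 (fun s hs => (hy s hs).2) t ht).2
  have hz : NormedSpace.exp ((0 : ℝ) • F) = 1 := by
    let _ : NormedAlgebra ℚ (V →L[ℝ] V) := NormedAlgebra.restrictScalars ℚ ℝ _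
    simp [NormedSpace.exp_zero]
  have hfun : (fun s => (-(NormedSpace.exp ((a - s) • F) * F)) (y s) +
      NormedSpace.exp ((a - s) • F) (F (y s) + g s)) =
      fun s => NormedSpace.exp ((a - s) • F) (g s) := by
    funext s
    simp
  rw [hfun] at h
  simp only [sub_self, hz] at h
  rw [one_apply_eq_self] at h
  rw [variationOfConstants, ← h, exp_smul_apply_apply]
  simp

theorem SolvesODEFrom.continuousOn {a b : ℝ} {y f : ℝ → V}
    (hy : SolvesODEFrom a (Set.Icc a b) y f) : ContinuousOn y (Set.Icc a b) := by
  rcases lt_or_ge b a with hab | hab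
  · simp [Set.Icc_eq_empty_of_lt hab]
  have hb : b ∈ Set.Icc a b := ⟨hab, le_rfl⟩
  have h1 : ContinuousOn (fun t => y a + ∫ s in a..t, f s) (Set.uIcc a b) :=
    continuousOn_const.add (intervalIntegral.continuousOn_primitive_interval
      ((intervalIntegrable_iff_integrableOn_Icc_of_le hab).1 (hy b hb).1 |>.mono_set
        (by rw [Set.uIcc_of_le hab])))
  rw [Set.uIcc_of_le hab] at h1
  exact h1.congr fun t ht => (hy t ht).2

theorem SolvesODEFrom.mono {a : ℝ} {J J' : Set ℝ} {y f : ℝ → V} (hy : SolvesODEFrom a J y f)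
    (h : J' ⊆ J) : SolvesODEFrom a J' y f := fun t ht => hy t (h ht)

theorem SolvesODEFrom.congr {a b : ℝ} {y f f' : ℝ → V}
    (hy : SolvesODEFrom a (Set.Icc a b) y f) (h : ∀ t ∈ Set.Ioo a b, f t = f' t) :
    SolvesODEFrom a (Set.Icc a b) y f' := by
  intro t ht
  have hae : ∀ᵐ s, s ∈ Set.uIoc a t → f s = f' s := by
    have : ∀ᵐ s : ℝ, s ≠ t := by simp [ae_iff]
    filter_upwards [this] with s hs hs'
    rw [Set.uIoc_of_le ht.1] at hs'
    exact h s ⟨hs'.1, (lt_of_le_of_ne hs'.2 hs).trans_le ht.2⟩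
  refine ⟨(hy t ht).1.congr_ae ?_, ?_⟩
  · exact (ae_restrict_iff' measurableSet_uIoc).2 hae
  · rw [(hy t ht).2, intervalIntegral.integral_congr_ae hae]

theorem SolvesODEFrom.restart {a b c : ℝ} {y f : ℝ → V}
    (hy : SolvesODEFrom a (Set.Icc a b) y f) (hc : c ∈ Set.Icc a b) :
    SolvesODEFrom c (Set.Icc c b) y f := by
  intro t ht
  have ht' : t ∈ Set.Icc a b := ⟨hc.1.trans ht.1, ht.2⟩
  refine ⟨(hy c hc).1.symm.trans (hy t ht').1, ?_⟩
  rw [(hy t ht').2, (hy c hc).2, add_assoc,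
    intervalIntegral.integral_add_adjacent_intervals (hy c hc).1
      ((hy c hc).1.symm.trans (hy t ht').1)]

/-! ### Exponentially weighted estimates and the small-gain argument -/

theorem integral_exp_convolution {α σ a t : ℝ} (h : σ < α) :
    ∫ s in a..t, Real.exp (-α * (t - s)) * Real.exp (-σ * s) =
      (Real.exp (-σ * t) - Real.exp (-α * (t - a)) * Real.exp (-σ * a)) / (α - σ) := by
  have hne : α - σ ≠ 0 := by linarith
  have hd : ∀ s ∈ Set.uIcc a t, HasDerivAt
      (fun s => Real.exp (-α * (t - s)) * Real.exp (-σ * s) / (α - σ))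
      (Real.exp (-α * (t - s)) * Real.exp (-σ * s)) s := by
    intro s _
    have h1 : HasDerivAt (fun s => -α * (t - s)) α s := by
      simpa using ((hasDerivAt_id s).const_sub t).const_mul (-α)
    have h2 : HasDerivAt (fun s => -σ * s) (-σ) s := by
      simpa using (hasDerivAt_id s).const_mul (-σ)
    refine ((h1.exp.mul h2.exp).div_const (α - σ)).congr_deriv ?_
    field_simp
    ring
  rw [intervalIntegral.integral_eq_sub_of_hasDerivAt hd
    (Continuous.intervalIntegrable (by fun_prop) _ _)]
  simp only [sub_self, mul_zero, Real.exp_zero, one_mul]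
  ring

/-- Input-to-state estimate for a linear system with an exponentially bounded input. -/
theorem SolvesODEFrom.norm_le_of_exp_le {F : V →L[ℝ] V} {K α σ γ : ℝ} (hασ : σ < α)
    (hγ : 0 ≤ γ)
    (hF : ∀ t : ℝ, 0 ≤ t → ‖NormedSpace.exp (t • F)‖ ≤ K * Real.exp (-α * t)) {a b : ℝ}
    {y g : ℝ → V} (hg : IntervalIntegrable g volume a b)
    (hy : SolvesODEFrom a (Set.Icc a b) y (fun t => F (y t) + g t))
    (hgb : ∀ t ∈ Set.Icc a b, ‖g t‖ ≤ γ * Real.exp (-σ * t)) :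
    ∀ t ∈ Set.Icc a b, ‖y t‖ ≤ K * Real.exp (-α * (t - a)) * ‖y a‖ +
      K * γ / (α - σ) * Real.exp (-σ * t) := by
  intro t ht
  have hK : 0 ≤ K := by
    have := (norm_nonneg _).trans (hF 0 le_rfl)
    simpa using this
  have hc : Continuous fun s : ℝ => NormedSpace.exp ((a - s) • F) :=
    (NormedSpace.continuous_exp_smul_real F).comp (by fun_prop : Continuous fun s : ℝ => a - s)
  have hgt : IntervalIntegrable g volume a t := hg.mono_set (by
    rw [Set.uIcc_of_le ht.1, Set.uIcc_of_le (ht.1.trans ht.2)]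
    exact Set.Icc_subset_Icc le_rfl ht.2)
  rw [hy.eq_variationOfConstants t ht, variationOfConstants, map_add]
  refine (norm_add_le _ _).trans (add_le_add ?_ ?_)
  · refine (ContinuousLinearMap.le_opNorm _ _).trans ?_
    gcongr
    exact hF _ (by linarith [ht.1])
  · rw [← ContinuousLinearMap.intervalIntegral_comp_comm _ (hgt.clm_apply_continuous hc)]
    have hb : ∀ s ∈ Set.Ioc a t, ‖NormedSpace.exp ((t - a) • F)
        (NormedSpace.exp ((a - s) • F) (g s))‖ ≤
        K * γ * (Real.exp (-α * (t - s)) * Real.exp (-σ * s)) := by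
      intro s hs
      rw [exp_smul_apply_apply, show t - a + (a - s) = t - s by ring]
      refine (ContinuousLinearMap.le_opNorm _ _).trans ?_
      calc _ ≤ (K * Real.exp (-α * (t - s))) * (γ * Real.exp (-σ * s)) := by
            gcongr
            · exact hF _ (by linarith [hs.2])
            · exact hgb s ⟨hs.1.le, hs.2.trans ht.2⟩
        _ = _ := by ring
    refine (intervalIntegral.norm_integral_le_of_norm_le ht.1
      (Filter.Eventually.of_forall hb)
      (Continuous.intervalIntegrable (by fun_prop) _ _)).trans ?_
    rw [intervalIntegral.integral_const_mul, integral_exp_convolution hασ, div_mul_eq_mul_div,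
      mul_div_assoc]
    have hαs : 0 < α - σ := by linarith
    gcongr
    have := mul_pos (Real.exp_pos (-α * (t - a))) (Real.exp_pos (-σ * a))
    linarith

/-- Small-gain estimate: the input of an exponentially stable linear system is bounded by a small
multiple of the weighted supremum of the state. -/
theorem SolvesODEFrom.norm_le_of_small_gain {F : V →L[ℝ] V} {K α σ γ ε : ℝ}
    (hασ : σ < α) (hγ : 0 ≤ γ) (hε : 0 ≤ ε) (hKε : K * ε / (α - σ) ≤ 1 / 2)
    (hF : ∀ t : ℝ, 0 ≤ t → ‖NormedSpace.exp (t • F)‖ ≤ K * Real.exp (-α * t)) {T : ℝ}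
    {y g : ℝ → V} (hg : IntervalIntegrable g volume 0 T)
    (hy : SolvesODEFrom 0 (Set.Icc 0 T) y (fun t => F (y t) + g t))
    (hgb : ∀ S : ℝ, 0 ≤ S → (∀ t ∈ Set.Icc 0 T, ‖y t‖ ≤ S * Real.exp (-σ * t)) →
      ∀ t ∈ Set.Icc 0 T, ‖g t‖ ≤ (ε * S + γ) * Real.exp (-σ * t)) :
    ∀ t ∈ Set.Icc 0 T, ‖y t‖ ≤ 2 * (K * ‖y 0‖ + K * γ / (α - σ)) * Real.exp (-σ * t) := by
  intro t₁ ht₁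
  have hK : 0 ≤ K := by
    have := (norm_nonneg _).trans (hF 0 le_rfl)
    simpa using this
  have hαs : 0 < α - σ := by linarith
  have hcont : ContinuousOn (fun t => Real.exp (σ * t) * ‖y t‖) (Set.Icc 0 T) :=
    (Continuous.continuousOn (by fun_prop)).mul hy.continuousOn.norm
  -- The horizon is finite, so the weighted supremum `S` of `‖y‖` is attained and finite; only
  -- therefore can it be absorbed.
  obtain ⟨m, hm, hmax⟩ := isCompact_Icc.exists_isMaxOn ⟨t₁, ht₁⟩ hcont
  set S := Real.exp (σ * m) * ‖y m‖ with hS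
  have hcancel : ∀ t, Real.exp (-σ * t) * Real.exp (σ * t) = 1 := fun t => by
    rw [← Real.exp_add]; simp
  have hSb : ∀ t ∈ Set.Icc 0 T, ‖y t‖ ≤ S * Real.exp (-σ * t) := by
    intro t ht
    have h1 : Real.exp (σ * t) * ‖y t‖ ≤ S := hmax ht
    calc ‖y t‖ = (Real.exp (-σ * t) * Real.exp (σ * t)) * ‖y t‖ := by rw [hcancel, one_mul]
      _ = Real.exp (-σ * t) * (Real.exp (σ * t) * ‖y t‖) := by ring
      _ ≤ Real.exp (-σ * t) * S := by gcongr
      _ = _ := mul_comm _ _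
  have hS0 : 0 ≤ S := by positivity
  have hm2 := SolvesODEFrom.norm_le_of_exp_le hασ (by positivity) hF hg hy (hgb S hS0 hSb) m hm
  have hexp : Real.exp (-α * (m - 0)) ≤ Real.exp (-σ * m) := by
    apply Real.exp_le_exp.2
    nlinarith [hm.1]
  have hSle : S ≤ K * ‖y 0‖ + K * (ε * S + γ) / (α - σ) := by
    calc S ≤ Real.exp (σ * m) * (K * Real.exp (-σ * m) * ‖y 0‖ +
          K * (ε * S + γ) / (α - σ) * Real.exp (-σ * m)) := by
          rw [hS]
          refine mul_le_mul_of_nonneg_left (hm2.trans ?_) (Real.exp_pos _).le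
          gcongr
      _ = (Real.exp (-σ * m) * Real.exp (σ * m)) *
          (K * ‖y 0‖ + K * (ε * S + γ) / (α - σ)) := by ring
      _ = _ := by rw [hcancel, one_mul]
  -- By `hKε` the term in `S` on the right of `hSle` is at most `S / 2`.
  have hS2 : S ≤ 2 * (K * ‖y 0‖ + K * γ / (α - σ)) := by
    have h1 : K * (ε * S + γ) / (α - σ) = K * ε / (α - σ) * S + K * γ / (α - σ) := by ring
    have h2 : K * ε / (α - σ) * S ≤ 1 / 2 * S := by gcongr
    linarith
  refine (hSb t₁ ht₁).trans ?_
  gcongr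

end

theorem exp_neg_mul_le_of_sub_le_one {σ s t : ℝ} (hσ : 0 ≤ σ) (h : t - s ≤ 1) :
    Real.exp (-σ * s) ≤ Real.exp σ * Real.exp (-σ * t) := by
  rw [← Real.exp_add]
  apply Real.exp_le_exp.2
  nlinarith

/-! ### Stability under sampled measurements and under sample-and-hold feedback -/

section
variable {V : Type*} [NormedAddCommGroup V] [NormedSpace ℝ V] [CompleteSpace V]

/-- Exponential input-to-state stability of the error of a sampled-data observer with inter-sample
output predictor, uniformly in the sampling schedule. -/
theorem exists_sampledObserver_estimate (F : V →L[ℝ] V) (φ : V →L[ℝ] ℝ) (p : V) {K α σ : ℝ}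
    (hK : 0 < K) (hσ : 0 < σ) (hασ : σ < α)
    (hF : ∀ t : ℝ, 0 ≤ t →
      ‖NormedSpace.exp (t • (F + φ.smulRight p))‖ ≤ K * Real.exp (-α * t)) :
    ∃ Tmax > (0 : ℝ), ∃ C > (0 : ℝ), ∀ T₁ : ℝ, 0 < T₁ → T₁ ≤ Tmax → ∀ (T D : ℝ), 0 ≤ D →
      ∀ (e g : ℝ → V) (η : ℝ → ℝ), IntervalIntegrable g volume 0 T →
      SolvesODEFrom 0 (Set.Icc 0 T) e (fun t => F (e t) + (φ (e t) - η t) • p - g t) →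
      (∀ t ∈ Set.Icc 0 T, ‖g t‖ ≤ D * Real.exp (-σ * t)) →
      (∀ t ∈ Set.Icc 0 T, ∃ s ∈ Set.Icc 0 t, t - s ≤ T₁ ∧ ∃ ξ : ℝ, |ξ| ≤ D * Real.exp (-σ * s) ∧
        η t = ξ + ∫ v in s..t, φ (F (e v) - g v)) →
      ∀ t ∈ Set.Icc 0 T, ‖e t‖ ≤ C * (‖e 0‖ + D) * Real.exp (-σ * t) ∧
        |η t| ≤ C * (‖e 0‖ + D) * Real.exp (-σ * t) := by
  have hαs : 0 < α - σ := by linarith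
  set Λ := Real.exp σ with hΛ
  have hΛ0 : 0 < Λ := Real.exp_pos σ
  set κ := ‖p‖ * Λ * ‖φ‖ * ‖F‖ with hκ
  have hκ0 : 0 ≤ κ := by positivity
  set γ₀ := ‖p‖ * (Λ + Λ * ‖φ‖) + 1 with hγ₀
  have hγ₀0 : 0 < γ₀ := by positivity
  set C₁ := 2 * (K + K * γ₀ / (α - σ)) with hC₁
  have hC₁0 : 0 < C₁ := by positivity
  -- In the bound of the input, `κ` is the coefficient of `T₁ * S` and `γ₀` that of `D`. The second
  -- threshold makes the loop gain `K * (T₁ * κ) / (α - σ)` at most `1 / 2`; the summand `1` is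
  -- there because `κ` may vanish. The threshold `1` bounds by `Λ` the cost of moving the weight
  -- across a sampling interval.
  refine ⟨min 1 ((α - σ) / (2 * K * (κ + 1))), by positivity,
    C₁ + (Λ + Λ * (‖φ‖ * ‖F‖ * C₁ + ‖φ‖)), by positivity, ?_⟩
  intro T₁ hT₁ hT₁max T D hD e g η hg hy hgb hη
  have hT₁1 : T₁ ≤ 1 := hT₁max.trans (min_le_left _ _)
  have hT₁2 : T₁ ≤ (α - σ) / (2 * K * (κ + 1)) := hT₁max.trans (min_le_right _ _)
  have hηb : ∀ S : ℝ, 0 ≤ S → (∀ t ∈ Set.Icc 0 T, ‖e t‖ ≤ S * Real.exp (-σ * t)) →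
      ∀ t ∈ Set.Icc 0 T, |η t| ≤
        (Λ * D + T₁ * (Λ * (‖φ‖ * ‖F‖ * S + ‖φ‖ * D))) * Real.exp (-σ * t) := by
    intro S hS hSb t ht
    -- Here `S` enters only through an integral over an interval of length at most `T₁`; this is the
    -- source of the small gain.
    obtain ⟨s, hs, hst, ξ, hξ, hηt⟩ := hη t ht
    have hint : ‖∫ v in s..t, φ (F (e v) - g v)‖ ≤
        (Λ * (‖φ‖ * ‖F‖ * S + ‖φ‖ * D)) * Real.exp (-σ * t) * |t - s| := by
      refine intervalIntegral.norm_integral_le_of_norm_le_const fun v hv => ?_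
      rw [Set.uIoc_of_le hs.2] at hv
      have hv' : v ∈ Set.Icc 0 T := ⟨hs.1.trans hv.1.le, hv.2.trans ht.2⟩
      have hvΛ : Real.exp (-σ * v) ≤ Λ * Real.exp (-σ * t) :=
        exp_neg_mul_le_of_sub_le_one hσ.le (by linarith [hv.1])
      calc ‖φ (F (e v) - g v)‖ ≤ ‖φ‖ * (‖F‖ * ‖e v‖ + ‖g v‖) := by
            refine (φ.le_opNorm _).trans ?_
            gcongr
            exact (norm_sub_le _ _).trans (by gcongr; exact F.le_opNorm _)
        _ ≤ ‖φ‖ * (‖F‖ * (S * Real.exp (-σ * v)) + D * Real.exp (-σ * v)) := by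
            gcongr
            · exact hSb v hv'
            · exact hgb v hv'
        _ = (‖φ‖ * ‖F‖ * S + ‖φ‖ * D) * Real.exp (-σ * v) := by ring
        _ ≤ (‖φ‖ * ‖F‖ * S + ‖φ‖ * D) * (Λ * Real.exp (-σ * t)) := by gcongr
        _ = _ := by ring
    have hsΛ : Real.exp (-σ * s) ≤ Λ * Real.exp (-σ * t) :=
      exp_neg_mul_le_of_sub_le_one hσ.le (by linarith)
    rw [hηt]
    calc |ξ + ∫ v in s..t, φ (F (e v) - g v)| ≤ |ξ| + ‖∫ v in s..t, φ (F (e v) - g v)‖ :=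
          abs_add_le _ _
      _ ≤ D * (Λ * Real.exp (-σ * t)) +
          (Λ * (‖φ‖ * ‖F‖ * S + ‖φ‖ * D)) * Real.exp (-σ * t) * T₁ := by
          refine add_le_add (hξ.trans (by gcongr)) (hint.trans ?_)
          gcongr
          rw [abs_of_nonneg (by linarith [hs.2])]
          exact hst
      _ = _ := by ring
  -- The injection `φ(e) p` joins the stable operator, and `η` and `g` are treated as inputs.
  have hyF : SolvesODEFrom 0 (Set.Icc 0 T) e
      (fun t => (F + φ.smulRight p) (e t) + (-(η t • p) - g t)) := by
    refine hy.congr fun t _ => ?_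
    simp only [add_apply, ContinuousLinearMap.smulRight_apply, sub_smul]
    abel
  have main : ∀ t ∈ Set.Icc 0 T, ‖e t‖ ≤ C₁ * (‖e 0‖ + D) * Real.exp (-σ * t) := by
    rcases lt_or_ge T 0 with hT | hT
    · simp [Set.Icc_eq_empty_of_lt hT]
    have hm : IntervalIntegrable (fun t => -(η t • p) - g t) volume 0 T := by
      have h1 := (hyF T ⟨hT, le_rfl⟩).1
      have h2 : IntervalIntegrable (fun t => (F + φ.smulRight p) (e t)) volume 0 T := by
        refine ContinuousOn.intervalIntegrable ?_
        rw [Set.uIcc_of_le hT]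
        exact continuousOn_const.clm_apply hy.continuousOn
      refine (h1.sub h2).congr (fun t _ => ?_)
      simp
    have hKε : K * (T₁ * κ) / (α - σ) ≤ 1 / 2 := by
      rw [div_le_iff₀ hαs]
      rw [le_div_iff₀ (by positivity)] at hT₁2
      have : 0 ≤ T₁ * K := by positivity
      nlinarith
    intro t ht
    have h := SolvesODEFrom.norm_le_of_small_gain hασ (γ := γ₀ * D) (ε := T₁ * κ)
      (by positivity) (by positivity) hKε hF hm hyF ?_ t ht
    · refine h.trans (mul_le_mul_of_nonneg_right ?_ (Real.exp_pos _).le)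
      rw [hC₁]
      have h1 : 0 ≤ K * D + K * γ₀ / (α - σ) * ‖e 0‖ := by positivity
      have h2 : K * (γ₀ * D) / (α - σ) = K * γ₀ / (α - σ) * D := by ring
      rw [h2]
      nlinarith
    · intro S hS hSb t ht
      have h1 := hηb S hS hSb t ht
      have h2 : ‖-(η t • p) - g t‖ ≤ |η t| * ‖p‖ + ‖g t‖ := by
        refine (norm_sub_le _ _).trans ?_
        rw [norm_neg, norm_smul, Real.norm_eq_abs]
      refine h2.trans ?_
      calc |η t| * ‖p‖ + ‖g t‖ ≤
          (Λ * D + T₁ * (Λ * (‖φ‖ * ‖F‖ * S + ‖φ‖ * D))) * Real.exp (-σ * t) * ‖p‖ +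
            D * Real.exp (-σ * t) := by
            gcongr
            exact hgb t ht
        _ = (T₁ * κ * S + (‖p‖ * (Λ + T₁ * (Λ * ‖φ‖)) + 1) * D) * Real.exp (-σ * t) := by
            rw [hκ]; ring
        _ ≤ (T₁ * κ * S + (‖p‖ * (Λ + 1 * (Λ * ‖φ‖)) + 1) * D) * Real.exp (-σ * t) := by gcongr
        _ = _ := by rw [hγ₀]; ring
  intro t ht
  have hexp := Real.exp_pos (-σ * t)
  refine ⟨(main t ht).trans ?_, (hηb _ (by positivity) main t ht).trans ?_⟩
  · gcongr
    have : 0 ≤ Λ + Λ * (‖φ‖ * ‖F‖ * C₁ + ‖φ‖) := by positivity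
    linarith
  · gcongr
    calc Λ * D + T₁ * (Λ * (‖φ‖ * ‖F‖ * (C₁ * (‖e 0‖ + D)) + ‖φ‖ * D))
        ≤ Λ * (‖e 0‖ + D) + 1 * (Λ * (‖φ‖ * ‖F‖ * (C₁ * (‖e 0‖ + D)) + ‖φ‖ * (‖e 0‖ + D))) := by
          have : D ≤ ‖e 0‖ + D := by linarith [norm_nonneg (e 0)]
          gcongr
      _ = (Λ + Λ * (‖φ‖ * ‖F‖ * C₁ + ‖φ‖)) * (‖e 0‖ + D) := by ring
      _ ≤ _ := mul_le_mul_of_nonneg_right (by linarith) (by positivity)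

/-- Exponential input-to-state stability of a linear system under sample-and-hold feedback. -/
theorem exists_sampleHold_estimate (F : V →L[ℝ] V) (ψ : V →L[ℝ] ℝ) (B : V) {K α σ : ℝ}
    (hK : 0 < K) (hσ : 0 < σ) (hασ : σ < α)
    (hF : ∀ t : ℝ, 0 ≤ t →
      ‖NormedSpace.exp (t • (F + ψ.smulRight B))‖ ≤ K * Real.exp (-α * t)) :
    ∃ Tmax > (0 : ℝ), Tmax ≤ 1 ∧ ∃ C > (0 : ℝ), ∀ T₂ : ℝ, 0 < T₂ → T₂ ≤ Tmax →
      ∀ (T D : ℝ), 0 ≤ D → ∀ (Y q : ℝ → V) (μ : ℝ → ℝ),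
      SolvesODEFrom 0 (Set.Icc 0 T) Y (fun t => F (Y t) + μ t • B + q t) →
      (∀ t ∈ Set.Icc 0 T, ‖q t‖ ≤ D * Real.exp (-σ * t)) →
      (∀ t ∈ Set.Icc 0 T, ∃ s ∈ Set.Icc 0 t, t - s ≤ T₂ ∧ μ t = ψ (Y s)) →
      ∀ t ∈ Set.Icc 0 T, ‖Y t‖ ≤ C * (‖Y 0‖ + D) * Real.exp (-σ * t) := by
  have hαs : 0 < α - σ := by linarith
  set Λ := Real.exp σ with hΛ
  have hΛ0 : 0 < Λ := Real.exp_pos σ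
  set κ := ‖ψ‖ * ‖B‖ * (Λ * (‖F‖ + ‖ψ‖ * Λ * ‖B‖)) with hκ
  have hκ0 : 0 ≤ κ := by positivity
  set γ₀ := ‖ψ‖ * ‖B‖ * Λ + 1 with hγ₀
  have hγ₀0 : 0 < γ₀ := by positivity
  set C₁ := 2 * (K + K * γ₀ / (α - σ)) with hC₁
  have hC₁0 : 0 < C₁ := by positivity
  refine ⟨min 1 ((α - σ) / (2 * K * (κ + 1))), by positivity, min_le_left _ _, C₁, hC₁0, ?_⟩
  intro T₂ hT₂ hT₂max T D hD Y q μ hy hqb hμ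
  have hT₂1 : T₂ ≤ 1 := hT₂max.trans (min_le_left _ _)
  have hT₂2 : T₂ ≤ (α - σ) / (2 * K * (κ + 1)) := hT₂max.trans (min_le_right _ _)
  -- Ideal feedback plus the holding error `ψ(Y s) - ψ(Y t)`, which is regarded as an input.
  have hyF : SolvesODEFrom 0 (Set.Icc 0 T) Y
      (fun t => (F + ψ.smulRight B) (Y t) + ((μ t - ψ (Y t)) • B + q t)) := by
    refine hy.congr fun t _ => ?_
    simp only [add_apply, ContinuousLinearMap.smulRight_apply, sub_smul]
    abel
  rcases lt_or_ge T 0 with hT | hT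
  · simp [Set.Icc_eq_empty_of_lt hT]
  have hm : IntervalIntegrable (fun t => (μ t - ψ (Y t)) • B + q t) volume 0 T := by
    have h1 := (hyF T ⟨hT, le_rfl⟩).1
    have h2 : IntervalIntegrable (fun t => (F + ψ.smulRight B) (Y t)) volume 0 T := by
      refine ContinuousOn.intervalIntegrable ?_
      rw [Set.uIcc_of_le hT]
      exact continuousOn_const.clm_apply hy.continuousOn
    refine (h1.sub h2).congr (fun t _ => ?_)
    simp
  have hKε : K * (T₂ * κ) / (α - σ) ≤ 1 / 2 := by
    rw [div_le_iff₀ hαs]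
    rw [le_div_iff₀ (by positivity)] at hT₂2
    have : 0 ≤ T₂ * K := by positivity
    nlinarith
  intro t ht
  have h := SolvesODEFrom.norm_le_of_small_gain hασ (γ := γ₀ * D) (ε := T₂ * κ)
    (by positivity) (by positivity) hKε hF hm hyF ?_ t ht
  · refine h.trans (mul_le_mul_of_nonneg_right ?_ (Real.exp_pos _).le)
    rw [hC₁]
    have h1 : 0 ≤ K * D + K * γ₀ / (α - σ) * ‖Y 0‖ := by positivity
    have h2 : K * (γ₀ * D) / (α - σ) = K * γ₀ / (α - σ) * D := by ring
    rw [h2]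
    nlinarith
  · intro S hS hSb t ht
    obtain ⟨s, hs, hst, hμt⟩ := hμ t ht
    have hs' : s ∈ Set.Icc 0 T := ⟨hs.1, hs.2.trans ht.2⟩
    -- The increment of `Y` is at most the elapsed time, hence `T₂`, times a bound for its
    -- derivative. The derivative at `v` contains a value of `Y` held from an earlier time `v₀`,
    -- hence a second factor `Λ`.
    have hdiff : ‖Y t - Y s‖ ≤
        ((‖F‖ * S + ‖ψ‖ * (S * Λ) * ‖B‖ + D) * Λ) * Real.exp (-σ * t) * |t - s| := by
      rw [((hy.restart hs') t ⟨hs.2, ht.2⟩).2, add_sub_cancel_left]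
      refine intervalIntegral.norm_integral_le_of_norm_le_const fun v hv => ?_
      rw [Set.uIoc_of_le hs.2] at hv
      have hv' : v ∈ Set.Icc 0 T := ⟨hs.1.trans hv.1.le, hv.2.trans ht.2⟩
      have hvΛ : Real.exp (-σ * v) ≤ Λ * Real.exp (-σ * t) :=
        exp_neg_mul_le_of_sub_le_one hσ.le (by linarith [hv.1])
      obtain ⟨v₀, hv₀, hvv, hμv⟩ := hμ v hv'
      have hv₀Λ : Real.exp (-σ * v₀) ≤ Λ * Real.exp (-σ * v) :=
        exp_neg_mul_le_of_sub_le_one hσ.le (by linarith)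
      have hμb : |μ v| ≤ ‖ψ‖ * (S * (Λ * Real.exp (-σ * v))) := by
        rw [hμv]
        refine (ψ.le_opNorm _).trans ?_
        gcongr
        exact (hSb v₀ ⟨hv₀.1, hv₀.2.trans hv'.2⟩).trans (by gcongr)
      calc ‖F (Y v) + μ v • B + q v‖ ≤ ‖F‖ * ‖Y v‖ + |μ v| * ‖B‖ + ‖q v‖ := by
            refine norm_add₃_le.trans ?_
            rw [norm_smul, Real.norm_eq_abs]
            gcongr
            exact F.le_opNorm _
        _ ≤ ‖F‖ * (S * Real.exp (-σ * v)) + (‖ψ‖ * (S * (Λ * Real.exp (-σ * v)))) * ‖B‖ +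
            D * Real.exp (-σ * v) := by
            gcongr
            · exact hSb v hv'
            · exact hqb v hv'
        _ = (‖F‖ * S + ‖ψ‖ * (S * Λ) * ‖B‖ + D) * Real.exp (-σ * v) := by ring
        _ ≤ (‖F‖ * S + ‖ψ‖ * (S * Λ) * ‖B‖ + D) * (Λ * Real.exp (-σ * t)) := by gcongr
        _ = _ := by ring
    have hts : |t - s| ≤ T₂ := by
      rw [abs_of_nonneg (by linarith [hs.2])]
      exact hst
    have h2 : ‖(μ t - ψ (Y t)) • B + q t‖ ≤ ‖ψ‖ * ‖Y t - Y s‖ * ‖B‖ + ‖q t‖ := by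
      refine (norm_add_le _ _).trans ?_
      rw [norm_smul, hμt, ← map_sub, norm_sub_rev (Y t)]
      gcongr
      exact ψ.le_opNorm _
    refine h2.trans ?_
    calc ‖ψ‖ * ‖Y t - Y s‖ * ‖B‖ + ‖q t‖ ≤
        ‖ψ‖ * (((‖F‖ * S + ‖ψ‖ * (S * Λ) * ‖B‖ + D) * Λ) * Real.exp (-σ * t) * T₂) * ‖B‖ +
          D * Real.exp (-σ * t) := by
          gcongr
          · exact hdiff.trans (by gcongr)
          · exact hqb t ht
      _ = (T₂ * κ * S + (‖ψ‖ * ‖B‖ * (Λ * T₂) + 1) * D) * Real.exp (-σ * t) := by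
          rw [hκ]; ring
      _ ≤ (T₂ * κ * S + (‖ψ‖ * ‖B‖ * (Λ * 1) + 1) * D) * Real.exp (-σ * t) := by gcongr
      _ = _ := by rw [hγ₀]; ring

end

/-! ### The sampling schedule -/

section sampling
variable {T₁ : ℝ} {b : ℝ → ℝ}

theorem samplingTime_lt_succ (hT₁ : 0 < T₁) (i : ℕ) :
    samplingTime T₁ b i < samplingTime T₁ b (i + 1) := by
  have := mul_pos hT₁ (Real.exp_pos (-b (samplingTime T₁ b i)))
  simp only [samplingTime]
  linarith

theorem strictMono_samplingTime (hT₁ : 0 < T₁) : StrictMono (samplingTime T₁ b) :=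
  strictMono_nat_of_lt_succ (samplingTime_lt_succ hT₁)

theorem samplingTime_nonneg (hT₁ : 0 < T₁) (i : ℕ) : 0 ≤ samplingTime T₁ b i :=
  (strictMono_samplingTime hT₁).monotone (Nat.zero_le i)

/-- The sign of `b` makes `T₁` an upper bound for all gaps; this is the only quantitative fact about
the schedule that enters the stability estimate. -/
theorem samplingTime_succ_sub_le (hT₁ : 0 < T₁) (hb : ∀ t, 0 ≤ t → 0 ≤ b t) (i : ℕ) :
    samplingTime T₁ b (i + 1) - samplingTime T₁ b i ≤ T₁ := by
  simp only [samplingTime, add_sub_cancel_left]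
  have : Real.exp (-b (samplingTime T₁ b i)) ≤ 1 :=
    Real.exp_le_one_iff.2 (by linarith [hb _ (samplingTime_nonneg (b := b) hT₁ i)])
  nlinarith

/-- Sampling times do not accumulate: if all stayed below `t`, a bound `C` of `b` on `[0, t]` would
keep the gaps above `T₁ exp(-C)`. The bound is needed at the individual sampling times, so an
essential bound would not do. -/
theorem exists_lt_samplingTime (hT₁ : 0 < T₁) (hb : IsLInftyLoc (Set.Ici 0) b) (t : ℝ) :
    ∃ i, t < samplingTime T₁ b i := by
  by_contra! h
  obtain ⟨C, hC⟩ := hb.2 (Set.Icc 0 t) Set.Icc_subset_Ici_self isCompact_Icc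
  have hstep : ∀ i : ℕ, i * (T₁ * Real.exp (-C)) ≤ samplingTime T₁ b i := by
    intro i
    induction i with
    | zero => simp [samplingTime]
    | succ i ih =>
      have h1 : b (samplingTime T₁ b i) ≤ C :=
        (le_abs_self _).trans (hC _ ⟨samplingTime_nonneg hT₁ i, h i⟩)
      have h2 : T₁ * Real.exp (-C) ≤ T₁ * Real.exp (-b (samplingTime T₁ b i)) := by gcongr
      simp only [samplingTime]
      push_cast
      linarith
  have hpos : 0 < T₁ * Real.exp (-C) := by positivity
  obtain ⟨i, hi⟩ := exists_nat_gt (t / (T₁ * Real.exp (-C)))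
  rw [div_lt_iff₀ hpos] at hi
  linarith [hstep i, h i]

theorem exists_samplingTime_mem_Ico (hT₁ : 0 < T₁) (hb : IsLInftyLoc (Set.Ici 0) b) {t : ℝ}
    (ht : 0 ≤ t) :
    ∃ i, t ∈ Set.Ico (samplingTime T₁ b i) (samplingTime T₁ b (i + 1)) := by
  classical
  have h := exists_lt_samplingTime hT₁ hb t
  have h0 : Nat.find h ≠ 0 := by
    intro h0
    have := Nat.find_spec h
    rw [h0] at this
    simp only [samplingTime] at this
    linarith
  obtain ⟨i, hi⟩ := Nat.exists_eq_succ_of_ne_zero h0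
  refine ⟨i, ?_, ?_⟩
  · exact not_lt.1 (Nat.find_min h (by omega))
  · have := Nat.find_spec h
    rwa [hi] at this

end sampling

/-! ### Integrability of the inputs and short-time bounds -/

theorem IsLInftyLoc.intervalIntegrable {E : Type*} [NormedAddCommGroup E] {I : Set ℝ} {f : ℝ → E}
    (hf : IsLInftyLoc I f) {a b : ℝ} (hab : a ≤ b) (hI : Set.Icc a b ⊆ I) :
    IntervalIntegrable f volume a b := by
  obtain ⟨C, hC⟩ := hf.2 _ hI isCompact_Icc
  rw [intervalIntegrable_iff_integrableOn_Icc_of_le hab]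
  refine IntegrableOn.of_bound (by simp) (hf.1.mono_set hI) C ?_
  exact (ae_restrict_iff' measurableSet_Icc).2 (Filter.Eventually.of_forall hC)

theorem IntervalIntegrable.congr_Ioo {E : Type*} [NormedAddCommGroup E] {f g : ℝ → E} {a b : ℝ}
    (hab : a ≤ b) (hf : IntervalIntegrable f volume a b) (h : ∀ t ∈ Set.Ioo a b, f t = g t) :
    IntervalIntegrable g volume a b := by
  refine hf.congr_ae ((ae_restrict_iff' measurableSet_uIoc).2 ?_)
  have : ∀ᵐ s : ℝ, s ≠ b := by simp [ae_iff]
  filter_upwards [this] with s hs hs'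
  rw [Set.uIoc_of_le hab] at hs'
  exact h s ⟨hs'.1, lt_of_le_of_ne hs'.2 hs⟩

theorem intervalIntegral.integral_congr_Ioo' {E : Type*} [NormedAddCommGroup E] [NormedSpace ℝ E]
    {f g : ℝ → E} {a b : ℝ} (hab : a ≤ b) (h : ∀ t ∈ Set.Ioo a b, f t = g t) :
    ∫ s in a..b, f s = ∫ s in a..b, g s := by
  refine intervalIntegral.integral_congr_ae ?_
  have : ∀ᵐ s : ℝ, s ≠ b := by simp [ae_iff]
  filter_upwards [this] with s hs hs'
  rw [Set.uIoc_of_le hab] at hs'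
  exact h s ⟨hs'.1, lt_of_le_of_ne hs'.2 hs⟩

/-- A signal that is given by an integrable history and is then held constant on successive
intervals is interval integrable. -/
theorem intervalIntegrable_of_hold {u u₀ : ℝ → ℝ} {δ T₂ : ℝ} {a : ℕ → ℝ} (hδ : 0 ≤ δ)
    (hT₂ : 0 < T₂) (hu₀ : IntervalIntegrable u₀ volume (-δ) 0)
    (hinit : ∀ θ ∈ Set.Ico (-δ) 0, u θ = u₀ θ)
    (hhold : ∀ i : ℕ, ∀ t ∈ Set.Ico (i * T₂) ((i + 1) * T₂), u t = a i) {s t : ℝ}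
    (hs : -δ ≤ s) (ht : -δ ≤ t) : IntervalIntegrable u volume s t := by
  have key : ∀ i : ℕ, IntervalIntegrable u volume (-δ) (i * T₂) := by
    intro i
    induction i with
    | zero =>
      simp only [Nat.cast_zero, zero_mul]
      exact hu₀.congr_Ioo (by linarith) fun t ht => (hinit t ⟨ht.1.le, ht.2⟩).symm
    | succ i ih =>
      refine ih.trans ?_
      push_cast
      have hc : IntervalIntegrable (fun _ : ℝ => a i) volume (i * T₂) ((i + 1) * T₂) :=
        intervalIntegrable_const
      exact hc.congr_Ioo (by nlinarith) fun t ht => (hhold i t ⟨ht.1.le, ht.2⟩).symm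
  obtain ⟨i, hi⟩ := exists_nat_gt (max s t / T₂)
  rw [div_lt_iff₀ hT₂] at hi
  have h1 := key i
  refine h1.mono_set ?_
  rw [Set.uIcc_of_le (hs.trans ((le_max_left s t).trans hi.le))]
  exact Set.uIcc_subset_Icc ⟨hs, (le_max_left s t).trans hi.le⟩ ⟨ht, (le_max_right s t).trans hi.le⟩

section
variable {V : Type*} [NormedAddCommGroup V] [NormedSpace ℝ V] [CompleteSpace V]

theorem IntervalIntegrable.smul_vector {u : ℝ → ℝ} {a b : ℝ}
    (hu : IntervalIntegrable u volume a b) (B : V) :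
    IntervalIntegrable (fun s => u s • B) volume a b :=
  ⟨Integrable.smul_const hu.1 B, Integrable.smul_const hu.2 B⟩

theorem exists_norm_exp_smul_le (F : V →L[ℝ] V) (R : ℝ) :
    ∃ M > (0 : ℝ), ∀ s : ℝ, |s| ≤ R → ‖NormedSpace.exp (s • F)‖ ≤ M := by
  obtain ⟨M, hM⟩ := (isCompact_Icc (a := -R) (b := R)).exists_bound_of_continuousOn
    (NormedSpace.continuous_exp_smul_real F).continuousOn
  refine ⟨|M| + 1, by positivity, fun s hs => ?_⟩
  have := hM s (abs_le.1 hs)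
  linarith [le_abs_self M]

/-- Elementary bound for a linear equation on a short interval. -/
theorem SolvesODEFrom.norm_le_of_short {F : V →L[ℝ] V} {M R γ : ℝ} (hM : 0 ≤ M) (hγ : 0 ≤ γ)
    (hF : ∀ s : ℝ, |s| ≤ R → ‖NormedSpace.exp (s • F)‖ ≤ M) {a b : ℝ} (hab : a ≤ b)
    (hR : b - a ≤ R) {y g : ℝ → V}
    (hy : SolvesODEFrom a (Set.Icc a b) y (fun t => F (y t) + g t))
    (hg : ∀ t ∈ Set.Ioo a b, ‖g t‖ ≤ γ) : ‖y b‖ ≤ M * (‖y a‖ + R * M * γ) := by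
  rw [hy.eq_variationOfConstants b ⟨hab, le_rfl⟩, variationOfConstants]
  refine (ContinuousLinearMap.le_opNorm _ _).trans ?_
  have h1 : ‖∫ s in a..b, NormedSpace.exp ((a - s) • F) (g s)‖ ≤ M * γ * |b - a| := by
    refine intervalIntegral.norm_integral_le_of_norm_le_const_ae ?_
    have : ∀ᵐ s : ℝ, s ≠ b := by simp [ae_iff]
    filter_upwards [this] with s hs hs'
    rw [Set.uIoc_of_le hab] at hs'
    have hs'' : s ∈ Set.Ioo a b := ⟨hs'.1, lt_of_le_of_ne hs'.2 hs⟩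
    refine (ContinuousLinearMap.le_opNorm _ _).trans ?_
    gcongr
    · refine hF _ ?_
      rw [abs_le]
      constructor <;> linarith [hs''.1, hs''.2]
    · exact hg s hs''
  have h2 : |b - a| ≤ R := by rwa [abs_of_nonneg (by linarith)]
  have h3 : M * γ * |b - a| ≤ R * M * γ := by
    calc M * γ * |b - a| ≤ M * γ * R := by gcongr
      _ = _ := by ring
  refine mul_le_mul (hF _ h2) ?_ (norm_nonneg _) hM
  exact (norm_add_le _ _).trans (add_le_add le_rfl (h1.trans h3))

/-! ### The predictor and the delayed plant -/

/-- The prediction of the state at time `t + δ` from the state `z t` of an observer and from the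
past values of the input. -/
noncomputable def inputPredictor (F : V →L[ℝ] V) (B : V) (δ : ℝ) (z : ℝ → V) (u : ℝ → ℝ) (t : ℝ) :
    V :=
  NormedSpace.exp (δ • F) (z t) +
    NormedSpace.exp (t • F) (∫ s in (t - δ)..t, NormedSpace.exp ((-s) • F) (u s • B))

/-- Differentiating the moving integral produces `u(t) B` at the upper end and `-exp(δF) u(t - δ) B`
at the lower end. The latter cancels the delayed input in the equation of `z`, so that the
prediction sees the input without delay. -/
theorem solvesODEFrom_inputPredictor {F : V →L[ℝ] V} {B p : V} {δ T : ℝ} (hδ : 0 ≤ δ)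
    {z : ℝ → V} {u v : ℝ → ℝ}
    (hu : ∀ a b : ℝ, -δ ≤ a → -δ ≤ b → IntervalIntegrable u volume a b)
    (hz : SolvesODEFrom 0 (Set.Icc 0 T) z (fun t => F (z t) + u (t - δ) • B + v t • p)) :
    SolvesODEFrom 0 (Set.Icc 0 T) (inputPredictor F B δ z u)
      (fun t => F (inputPredictor F B δ z u t) + u t • B + v t • NormedSpace.exp (δ • F) p) := by
  set f : ℝ → V := fun s => NormedSpace.exp ((-s) • F) (u s • B) with hf
  have hc : Continuous fun s : ℝ => NormedSpace.exp ((-s) • F) :=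
    (NormedSpace.continuous_exp_smul_real F).comp continuous_neg
  have hfi : ∀ a b : ℝ, -δ ≤ a → -δ ≤ b → IntervalIntegrable f volume a b := fun a b ha hb =>
    IntervalIntegrable.clm_apply_continuous hc (IntervalIntegrable.smul_vector (hu a b ha hb) B)
  have hfs : ∀ t, 0 ≤ t → IntervalIntegrable (fun s => f (s - δ)) volume 0 t := by
    intro t ht
    have := (hfi (0 - δ) (t - δ) (by linarith) (by linarith)).comp_sub_right δ
    simpa using this
  have hc' : Continuous fun s : ℝ => NormedSpace.exp (s • F) :=
    NormedSpace.continuous_exp_smul_real F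
  intro t ht
  have h := integral_clm_apply_primitive (E := fun s => NormedSpace.exp (s • F))
    (E' := fun s => F * NormedSpace.exp (s • F)) (fun s => hasDerivAt_exp_smul_const' F s)
    (continuous_const.mul hc') (a := 0) (b := T)
    (H := fun s => ∫ v in (s - δ)..s, f v) (h := fun s => f s - f (s - δ))
    ((hfi 0 T (by linarith) (by linarith [ht.1, ht.2])).sub (hfs T (ht.1.trans ht.2)))
    (by
      intro s hs
      rw [intervalIntegral.integral_sub (hfi 0 s (by linarith) (by linarith [hs.1])) (hfs s hs.1),
        intervalIntegral.integral_comp_sub_right (fun s => f s) δ]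
      have e1 : (∫ v in (0 - δ)..(0:ℝ), f v) + ∫ v in (0:ℝ)..s, f v =
          ∫ v in (0 - δ)..s, f v :=
        intervalIntegral.integral_add_adjacent_intervals (hfi _ _ (by linarith) (by linarith))
          (hfi _ _ (by linarith) (by linarith [hs.1]))
      have e2 : (∫ v in (0 - δ)..(s - δ), f v) + ∫ v in (s - δ)..s, f v =
          ∫ v in (0 - δ)..s, f v :=
        intervalIntegral.integral_add_adjacent_intervals
          (hfi _ _ (by linarith) (by linarith [hs.1]))
          (hfi _ _ (by linarith [hs.1]) (by linarith [hs.1]))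
      rw [← add_sub_assoc, e1, ← e2, add_sub_cancel_left]) t ht
  obtain ⟨hz1, hz2⟩ := hz t ht
  have hz1' : IntervalIntegrable (fun s => NormedSpace.exp (δ • F)
      (F (z s) + u (s - δ) • B + v s • p)) volume 0 t :=
    IntervalIntegrable.clm_apply_continuous continuous_const hz1
  have hsum : (fun s => NormedSpace.exp (δ • F) (F (z s) + u (s - δ) • B + v s • p) +
      ((F * NormedSpace.exp (s • F)) (∫ v in (s - δ)..s, f v) +
        NormedSpace.exp (s • F) (f s - f (s - δ)))) =
      fun t => F (inputPredictor F B δ z u t) + u t • B +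
        v t • NormedSpace.exp (δ • F) p := by
    funext s
    have hz0 : NormedSpace.exp ((0 : ℝ) • F) = 1 := by
      let _ : NormedAlgebra ℚ (V →L[ℝ] V) := NormedAlgebra.restrictScalars ℚ ℝ _
      simp [NormedSpace.exp_zero]
    have e1 : NormedSpace.exp (s • F) (f s) = u s • B := by
      rw [hf, exp_smul_apply_apply, add_neg_cancel, hz0, one_apply_eq_self]
    have e2 : NormedSpace.exp (s • F) (f (s - δ)) = NormedSpace.exp (δ • F) (u (s - δ) • B) := by
      rw [hf, exp_smul_apply_apply]
      congr 3
      ring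
    rw [map_sub, e1, e2]
    simp only [map_add, map_smul, inputPredictor, mul_apply_eq_comp, exp_smul_apply_comm, hf]
    abel
  have hi := hz1'.add h.1
  rw [hsum] at hi
  refine ⟨hi, ?_⟩
  rw [← hsum, intervalIntegral.integral_add hz1' h.1,
    ContinuousLinearMap.intervalIntegral_comp_comm _ hz1]
  have e3 : inputPredictor F B δ z u t = NormedSpace.exp (δ • F) (z t) +
    NormedSpace.exp (t • F) (∫ s in (t - δ)..t, f s) := rfl
  have e4 : inputPredictor F B δ z u 0 = NormedSpace.exp (δ • F) (z 0) +
    NormedSpace.exp ((0 : ℝ) • F) (∫ s in (0 - δ)..0, f s) := rfl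
  rw [e3, e4, h.2, hz2, map_add]
  abel

theorem norm_integral_exp_input_le {F : V →L[ℝ] V} {B : V} {M δ γ : ℝ} (hM : 0 ≤ M) (hδ : 0 ≤ δ)
    (hF : ∀ s : ℝ, |s| ≤ δ → ‖NormedSpace.exp (s • F)‖ ≤ M) {u : ℝ → ℝ} {t : ℝ}
    (hu : ∀ a b : ℝ, -δ ≤ a → -δ ≤ b → IntervalIntegrable u volume a b) (ht : 0 ≤ t)
    (hγ : ∀ s ∈ Set.Ioo (t - δ) t, |u s| ≤ γ) :
    ‖NormedSpace.exp (t • F) (∫ s in (t - δ)..t, NormedSpace.exp ((-s) • F) (u s • B))‖ ≤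
      δ * (M * (γ * ‖B‖)) := by
  have hc : Continuous fun s : ℝ => NormedSpace.exp ((-s) • F) :=
    (NormedSpace.continuous_exp_smul_real F).comp continuous_neg
  rw [← ContinuousLinearMap.intervalIntegral_comp_comm _
    (IntervalIntegrable.clm_apply_continuous hc
      (IntervalIntegrable.smul_vector (hu (t - δ) t (by linarith) (by linarith)) B))]
  have := intervalIntegral.norm_integral_le_of_norm_le_const_ae (a := t - δ) (b := t)
    (f := fun s => NormedSpace.exp (t • F) (NormedSpace.exp ((-s) • F) (u s • B)))
    (C := M * (γ * ‖B‖)) ?_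
  · rw [sub_sub_cancel, abs_of_nonneg hδ] at this
    linarith
  · have : ∀ᵐ s : ℝ, s ≠ t := by simp [ae_iff]
    filter_upwards [this] with s hs hs'
    rw [Set.uIoc_of_le (by linarith)] at hs'
    have hs'' : s ∈ Set.Ioo (t - δ) t := ⟨hs'.1, lt_of_le_of_ne hs'.2 hs⟩
    rw [exp_smul_apply_apply]
    refine (ContinuousLinearMap.le_opNorm _ _).trans ?_
    rw [norm_smul, Real.norm_eq_abs]
    gcongr
    · refine hF _ ?_
      rw [abs_le]
      constructor <;> linarith [hs''.1, hs''.2]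
    · exact hγ s hs''

/-- A solution of a linear equation can be continued backwards along a prescribed input. -/
theorem exists_backward_extension {F : V →L[ℝ] V} {r M γ : ℝ} (hr : 0 ≤ r) (hM : 0 ≤ M)
    (hγ : 0 ≤ γ) (hF : ∀ s : ℝ, |s| ≤ r → ‖NormedSpace.exp (s • F)‖ ≤ M) {x f : ℝ → V}
    (hf : ∀ T, 0 ≤ T → IntervalIntegrable f volume 0 T)
    (hx : ∀ T, SolvesODEFrom 0 (Set.Icc 0 T) x (fun t => F (x t) + f (t + r)))
    (hfγ : ∀ t ∈ Set.Ioo 0 r, ‖f t‖ ≤ γ) :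
    ∃ X : ℝ → V, (∀ T, SolvesODEFrom 0 (Set.Icc 0 T) X (fun t => F (X t) + f t)) ∧
      (∀ t, r ≤ t → X t = x (t - r)) ∧
      ∀ t ∈ Set.Icc 0 r, ‖X t‖ ≤ M * ((M * ‖x 0‖ + r * M * γ) + r * M * γ) := by
  -- The initial value from which the input `f` steers the state to `x 0` at time `r`, by variation
  -- of constants. From then on `X` and the shifted `x` solve the same equation with the same value
  -- at `r`.
  set X₀ := NormedSpace.exp ((-r) • F) (x 0) -
    ∫ s in (0 : ℝ)..r, NormedSpace.exp ((0 - s) • F) (f s) with hX₀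
  have hX₀b : ‖X₀‖ ≤ M * ‖x 0‖ + r * M * γ := by
    refine (norm_sub_le _ _).trans (add_le_add ?_ ?_)
    · refine (ContinuousLinearMap.le_opNorm _ _).trans ?_
      gcongr
      exact hF _ (by rw [abs_neg, abs_of_nonneg hr])
    · have := intervalIntegral.norm_integral_le_of_norm_le_const_ae (a := 0) (b := r)
        (f := fun s => NormedSpace.exp ((0 - s) • F) (f s)) (C := M * γ) ?_
      · rw [sub_zero, abs_of_nonneg hr] at this
        linarith
      · have : ∀ᵐ s : ℝ, s ≠ r := by simp [ae_iff]
        filter_upwards [this] with s hs hs'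
        rw [Set.uIoc_of_le hr] at hs'
        have hs'' : s ∈ Set.Ioo 0 r := ⟨hs'.1, lt_of_le_of_ne hs'.2 hs⟩
        refine (ContinuousLinearMap.le_opNorm _ _).trans ?_
        gcongr
        · refine hF _ ?_
          rw [abs_le]
          constructor <;> linarith [hs''.1, hs''.2]
        · exact hfγ s hs''
  have hX : ∀ T, SolvesODEFrom 0 (Set.Icc 0 T) (variationOfConstants F 0 X₀ f)
      (fun t => F (variationOfConstants F 0 X₀ f t) + f t) := by
    intro T
    rcases lt_or_ge T 0 with hT | hT
    · intro t ht
      linarith [ht.1, ht.2]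
    · exact solvesODEFrom_variationOfConstants F X₀ (hf T hT)
  have hz0 : NormedSpace.exp ((0 : ℝ) • F) = 1 := by
    let _ : NormedAlgebra ℚ (V →L[ℝ] V) := NormedAlgebra.restrictScalars ℚ ℝ _
    simp [NormedSpace.exp_zero]
  have hXr : variationOfConstants F 0 X₀ f r = x 0 := by
    rw [variationOfConstants, hX₀, sub_add_cancel, exp_smul_apply_apply]
    simp
  refine ⟨variationOfConstants F 0 X₀ f, hX, fun t ht => ?_, fun t ht => ?_⟩
  · have h1 := ((hX t).restart ⟨hr, ht⟩).eq_variationOfConstants t ⟨ht, le_rfl⟩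
    have h2 : SolvesODEFrom r (Set.Icc r t) (fun s => x (s - r))
        (fun s => F (x (s - r)) + f s) := by
      intro s hs
      obtain ⟨h3, h4⟩ := hx (s - r) (s - r) ⟨by linarith [hs.1], le_rfl⟩
      refine ⟨?_, ?_⟩
      · have := h3.comp_sub_right r
        simpa using this
      · have h5 := intervalIntegral.integral_comp_sub_right (a := r) (b := s)
          (fun t => F (x t) + f (t + r)) r
        simp only [sub_add_cancel, sub_self] at h5
        rw [h5]
        simpa using h4
    have h3 := h2.eq_variationOfConstants t ⟨ht, le_rfl⟩
    rw [h1, hXr, h3, sub_self]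
  · have h1 := SolvesODEFrom.norm_le_of_short hM hγ hF ht.1 (by linarith [ht.2]) (hX t)
      (fun s hs => hfγ s ⟨hs.1, hs.2.trans_le ht.2⟩)
    rw [variationOfConstants_self] at h1
    exact h1.trans (by gcongr)

end

/-! ### From matrices to operators -/

theorem toEuclideanCLM_add_outerProd {n : ℕ} (A : Matrix (Fin n) (Fin n) ℝ)
    (p c : EuclideanSpace ℝ (Fin n)) :
    Matrix.toEuclideanCLM (𝕜 := ℝ) (A + outerProd p c) =
      Matrix.toEuclideanCLM (𝕜 := ℝ) A + (innerSL ℝ c).smulRight p := by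
  rw [map_add]
  congr 1
  ext v i
  simp only [outerProd, Matrix.ofLp_toEuclideanCLM, Matrix.vecMulVec_mulVec,
    ContinuousLinearMap.smulRight_apply, innerSL_apply_apply, PiLp.smul_apply, smul_eq_mul]
  simp [EuclideanSpace.inner_eq_star_dotProduct, dotProduct_comm, mul_comm]

theorem matAct_exp_smul {n : ℕ} (A : Matrix (Fin n) (Fin n) ℝ) (s : ℝ)
    (v : EuclideanSpace ℝ (Fin n)) :
    matAct (NormedSpace.exp (s • A)) v =
      NormedSpace.exp (s • Matrix.toEuclideanCLM (𝕜 := ℝ) A) v := by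
  rw [matAct, Matrix.toEuclideanCLM_exp, map_smul]

/-- Identifies the hold law with state feedback from the predictor: substitute `t + s` for `s` and
use `exp(tF) exp(-(t + s)F) = exp(-sF)`. -/
theorem inner_inputPredictor {n : ℕ} (A : Matrix (Fin n) (Fin n) ℝ)
    (B k : EuclideanSpace ℝ (Fin n)) {r τ : ℝ} (hr : 0 ≤ r) (hτ : 0 ≤ τ)
    (z : ℝ → EuclideanSpace ℝ (Fin n)) {u : ℝ → ℝ}
    (hu : ∀ a b : ℝ, -(r + τ) ≤ a → -(r + τ) ≤ b → IntervalIntegrable u volume a b) {t : ℝ}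
    (ht : 0 ≤ t) :
    inner ℝ k (matAct (NormedSpace.exp ((r + τ) • A)) (z t)) +
      ∫ s in (-r - τ)..0, inner ℝ k (matAct (NormedSpace.exp ((-s) • A)) B) * u (t + s) =
    innerSL ℝ k (inputPredictor (Matrix.toEuclideanCLM (𝕜 := ℝ) A) B (r + τ) z u t) := by
  set F := Matrix.toEuclideanCLM (𝕜 := ℝ) A with hF
  have hc : Continuous fun s : ℝ => NormedSpace.exp ((-s) • F) :=
    (NormedSpace.continuous_exp_smul_real F).comp continuous_neg
  have hi : IntervalIntegrable (fun s => NormedSpace.exp ((-s) • F) (u s • B)) volume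
      (t - (r + τ)) t := IntervalIntegrable.clm_apply_continuous hc
    (IntervalIntegrable.smul_vector (hu _ _ (by linarith) (by linarith)) B)
  have hi2 : IntervalIntegrable (fun s => NormedSpace.exp (t • F)
      (NormedSpace.exp ((-s) • F) (u s • B))) volume (t - (r + τ)) t :=
    IntervalIntegrable.clm_apply_continuous continuous_const hi
  rw [inputPredictor, map_add, matAct_exp_smul, ← hF, innerSL_apply_apply,
    ← ContinuousLinearMap.intervalIntegral_comp_comm _ hi,
    ← ContinuousLinearMap.intervalIntegral_comp_comm _ hi2]
  congr 1
  have h := intervalIntegral.integral_comp_add_left (a := -r - τ) (b := 0)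
    (fun s => innerSL ℝ k (NormedSpace.exp (t • F) (NormedSpace.exp ((-s) • F) (u s • B)))) t
  rw [show t + (-r - τ) = t - (r + τ) by ring, add_zero] at h
  rw [← h]
  congr 1
  funext s
  rw [matAct_exp_smul, ← hF, exp_smul_apply_apply, map_smul, map_smul,
    show t + -(t + s) = -s by ring, smul_eq_mul, mul_comm, innerSL_apply_apply]

/-- The input of any solution is its bounded history followed by constants on the holding intervals,
whatever `z` is. -/
theorem IsClosedLoopSolution.intervalIntegrable_u {n : ℕ} {A G : Matrix (Fin n) (Fin n) ℝ}
    {B c k p : EuclideanSpace ℝ (Fin n)} {r τ T₁ T₂ : ℝ} (hr : 0 ≤ r) (hτ : 0 ≤ τ)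
    (hT₂ : 0 < T₂) {x₀ : ℝ → EuclideanSpace ℝ (Fin n)} {u₀ : ℝ → ℝ}
    {z₀ : EuclideanSpace ℝ (Fin n)} {w₀ : ℝ} {ξ b : ℝ → ℝ} {d x : ℝ → EuclideanSpace ℝ (Fin n)}
    {u : ℝ → ℝ} {z : ℝ → EuclideanSpace ℝ (Fin n)} {w : ℝ → ℝ}
    (h : IsClosedLoopSolution A G B c k p r τ T₁ T₂ x₀ u₀ z₀ w₀ ξ b d x u z w)
    (hu₀ : IsLInftyLoc (Set.Icc (-r - τ) 0) u₀) (s t : ℝ) (hs : -(r + τ) ≤ s)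
    (ht : -(r + τ) ≤ t) : IntervalIntegrable u volume s t := by
  have e : -r - τ = -(r + τ) := by ring
  have hinit := h.u_init
  rw [e] at hu₀ hinit
  exact intervalIntegrable_of_hold (by linarith) hT₂
    (hu₀.intervalIntegrable (by linarith) le_rfl) hinit h.u_hold hs ht

/-! ### The closed-loop estimate -/

set_option maxHeartbeats 1000000 in
/-- Exponential estimate for the closed loop in operator form, uniform in the sampling schedule. -/
theorem exists_sampledPredictorLoop_estimate {V : Type*} [NormedAddCommGroup V] [NormedSpace ℝ V]
    [CompleteSpace V] (F G' : V →L[ℝ] V) (φ ψ : V →L[ℝ] ℝ) (B p : V) {r τ δ : ℝ} (hr : 0 ≤ r)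
    (hτ : 0 ≤ τ) (hδdef : δ = r + τ) {K₁ α₁ K₂ α₂ : ℝ} (hK₁ : 0 < K₁) (hα₁ : 0 < α₁)
    (hK₂ : 0 < K₂) (hα₂ : 0 < α₂)
    (hF₁ : ∀ t : ℝ, 0 ≤ t →
      ‖NormedSpace.exp (t • (F + ψ.smulRight B))‖ ≤ K₁ * Real.exp (-α₁ * t))
    (hF₂ : ∀ t : ℝ, 0 ≤ t →
      ‖NormedSpace.exp (t • (F + φ.smulRight p))‖ ≤ K₂ * Real.exp (-α₂ * t)) :
    ∃ T₁max > (0 : ℝ), ∃ T₂max > (0 : ℝ), ∃ σ > (0 : ℝ), ∃ C > (0 : ℝ),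
      ∀ T₁ : ℝ, 0 < T₁ → T₁ ≤ T₁max → ∀ T₂ : ℝ, 0 < T₂ → T₂ ≤ T₂max →
      ∀ (ξ b : ℝ → ℝ) (d x : ℝ → V) (u : ℝ → ℝ) (z : ℝ → V) (w : ℝ → ℝ),
        (∀ s t : ℝ, -δ ≤ s → -δ ≤ t → IntervalIntegrable u volume s t) →
        IsLInftyLoc (Set.Ici 0) b → (∀ t : ℝ, 0 ≤ t → 0 ≤ b t) →
        IsLInftyLoc (Set.Ici 0) d →
        (∀ T, SolvesODEFrom 0 (Set.Icc 0 T) x (fun t => F (x t) + (u (t - τ) • B + G' (d t)))) →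
        (∀ T, SolvesODEFrom 0 (Set.Icc 0 T) z
          (fun t => F (z t) + u (t - δ) • B + (φ (z t) - w t) • p)) →
        (∀ i : ℕ, SolvesODEFrom (samplingTime T₁ b i)
          (Set.Ico (samplingTime T₁ b i) (samplingTime T₁ b (i + 1))) w
          (fun t => φ (F (z t)) + φ B * u (t - δ))) →
        (∀ i : ℕ, w (samplingTime T₁ b (i + 1)) =
          φ (x (samplingTime T₁ b (i + 1) - r)) + ξ (samplingTime T₁ b (i + 1))) →
        (∀ i : ℕ, ∀ t ∈ Set.Ico ((i : ℝ) * T₂) (((i : ℝ) + 1) * T₂),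
          u t = ψ (inputPredictor F B δ z u (i * T₂))) →
        ∀ T I D : ℝ, 0 ≤ I → 0 ≤ D → ‖z 0‖ ≤ I → |w 0| ≤ I →
        (∀ θ ∈ Set.Icc (-r) 0, ‖x θ‖ ≤ I) → (∀ θ ∈ Set.Ico (-δ) 0, |u θ| ≤ I) →
        (∀ t ∈ Set.Icc 0 T, |ξ t| ≤ D * Real.exp (-σ * t)) →
        (∀ t ∈ Set.Icc 0 T, ‖d t‖ ≤ D * Real.exp (-σ * t)) →
        ∀ t ∈ Set.Icc 0 T,
          ‖z t‖ ≤ C * (I + D) * Real.exp (-σ * t) ∧ |w t| ≤ C * (I + D) * Real.exp (-σ * t) ∧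
          ‖x t‖ ≤ C * (I + D) * Real.exp (-σ * t) ∧ |u t| ≤ C * (I + D) * Real.exp (-σ * t) := by
  have hδ : 0 ≤ δ := by rw [hδdef]; positivity
  obtain ⟨σ, hσ, hσ₁, hσ₂⟩ : ∃ σ > (0 : ℝ), σ < α₁ ∧ σ < α₂ :=
    ⟨min α₁ α₂ / 2, by positivity, by linarith [min_le_left α₁ α₂, lt_min hα₁ hα₂],
      by linarith [min_le_right α₁ α₂, lt_min hα₁ hα₂]⟩
  obtain ⟨T₁max, hT₁max, CA, hCA, obs⟩ := exists_sampledObserver_estimate F φ p hK₂ hσ hσ₂ hF₂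
  obtain ⟨T₂max, hT₂max, hT₂max1, CB, hCB, hold⟩ :=
    exists_sampleHold_estimate F ψ B hK₁ hσ hσ₁ hF₁
  obtain ⟨M, hM, hMF⟩ := exists_norm_exp_smul_le F δ
  have hMr : ∀ s : ℝ, |s| ≤ r → ‖NormedSpace.exp (s • F)‖ ≤ M := fun s hs =>
    hMF s (hs.trans (by linarith))
  -- The cost of moving the weight `exp(-σ t)` back by a time of at most `δ`.
  obtain ⟨Λ, hΛ⟩ : ∃ y : ℝ, y = Real.exp (σ * δ) := ⟨_, rfl⟩
  have hΛ1 : 1 ≤ Λ := by rw [hΛ]; exact Real.one_le_exp (by positivity)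
  have hΛ0 : 0 < Λ := by rw [hΛ]; exact Real.exp_pos _
  have hdelay : ∀ s t : ℝ, t - s ≤ δ → Real.exp (-σ * s) ≤ Λ * Real.exp (-σ * t) := by
    intro s t h
    rw [hΛ, ← Real.exp_add]
    apply Real.exp_le_exp.2
    nlinarith
  -- In units of `I + D`: `c₁` bounds `X` on `[0, r]`, `cD` the disturbance and the reset values of
  -- the observer error, `c₂` the errors `e` and `η`, `cv` the injection `φ(z) - w`, and `c₃`, `c₄`,
  -- `c₅`, `c₆`, `c₇` bound `Y`, `u`, `z`, `w`, `x`. Each is computed from the preceding ones.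
  obtain ⟨c₁, hc₁⟩ : ∃ y : ℝ, y = M * ((M + r * M * ‖B‖) + r * M * ‖B‖) := ⟨_, rfl⟩
  have hc₁0 : 0 ≤ c₁ := by rw [hc₁]; positivity
  obtain ⟨cD, hcD⟩ : ∃ y : ℝ, y = ‖G'‖ * Λ + 1 + Λ * (1 + ‖φ‖ * (1 + c₁)) := ⟨_, rfl⟩
  have hcD0 : 0 ≤ cD := by rw [hcD]; positivity
  obtain ⟨c₂, hc₂⟩ : ∃ y : ℝ, y = CA * (1 + c₁ + cD) := ⟨_, rfl⟩
  have hc₂0 : 0 ≤ c₂ := by rw [hc₂]; positivity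
  obtain ⟨cv, hcv⟩ : ∃ y : ℝ, y = (‖φ‖ + 1) * c₂ := ⟨_, rfl⟩
  have hcv0 : 0 ≤ cv := by rw [hcv]; positivity
  obtain ⟨c₃, hc₃⟩ : ∃ y : ℝ, y = CB * ((M + δ * (M * (1 * ‖B‖))) + cv * (M * ‖p‖)) := ⟨_, rfl⟩
  have hc₃0 : 0 ≤ c₃ := by rw [hc₃]; positivity
  obtain ⟨c₄, hc₄⟩ : ∃ y : ℝ, y = ‖ψ‖ * c₃ * Real.exp σ + 1 := ⟨_, rfl⟩
  have hc₄0 : 0 ≤ c₄ := by rw [hc₄]; positivity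
  obtain ⟨c₅, hc₅⟩ : ∃ y : ℝ, y = M * (c₃ + δ * (M * (c₄ * Λ * ‖B‖))) := ⟨_, rfl⟩
  have hc₅0 : 0 ≤ c₅ := by rw [hc₅]; positivity
  obtain ⟨c₆, hc₆⟩ : ∃ y : ℝ, y = ‖φ‖ * c₅ + cv := ⟨_, rfl⟩
  have hc₆0 : 0 ≤ c₆ := by rw [hc₆]; positivity
  obtain ⟨c₇, hc₇⟩ : ∃ y : ℝ, y = M * ((c₅ + c₂ + Λ) + r * M * (c₄ * Λ * ‖B‖ + ‖G'‖ * Λ)) := ⟨_, rfl⟩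
  have hc₇0 : 0 ≤ c₇ := by rw [hc₇]; positivity
  refine ⟨T₁max, hT₁max, T₂max, hT₂max, σ, hσ, c₄ + c₅ + c₆ + c₇ + 1, by positivity, ?_⟩
  intro T₁ hT₁ hT₁' T₂ hT₂ hT₂' ξ b d x u z w hu hb hb0 hd hxode hzodeT hwode hws huh T I D hI hD
    hz₀ hw₀ hx₀ hu₀I hξ hdD
  obtain ⟨N, hN⟩ : ∃ y : ℝ, y = I + D := ⟨_, rfl⟩
  rw [← hN]
  have hN0 : 0 ≤ N := by rw [hN]; positivity
  have hIN : I ≤ N := by linarith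
  have hDN : D ≤ N := by linarith
  have hx0 : ∀ θ ∈ Set.Icc (-r) 0, ‖x θ‖ ≤ N := fun θ hθ => (hx₀ θ hθ).trans hIN
  have hx00 : ‖x 0‖ ≤ N := hx0 0 ⟨by linarith, le_rfl⟩
  have hu0 : ∀ θ ∈ Set.Ico (-δ) 0, |u θ| ≤ N := fun θ hθ => (hu₀I θ hθ).trans hIN
  have hexp0 : ∀ t, t ≤ 0 → 1 ≤ Real.exp (-σ * t) := fun t ht =>
    Real.one_le_exp (by nlinarith)
  -- the disturbance, extended by zero, and the delayed plant input
  obtain ⟨dt, hdt⟩ : ∃ y : ℝ → V, y = fun s => if 0 ≤ s then d s else 0 := ⟨_, rfl⟩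
  obtain ⟨f, hf⟩ : ∃ y : ℝ → V, y = fun s => u (s - δ) • B + G' (dt (s - r)) := ⟨_, rfl⟩
  have hdti : ∀ T, 0 ≤ T → IntervalIntegrable (fun s => dt (s - r)) volume 0 T := by
    intro T hT
    have h1 : IntervalIntegrable dt volume (-r) 0 := by
      have hc : IntervalIntegrable (fun _ : ℝ => (0 : V)) volume (-r) 0 :=
        intervalIntegrable_const
      exact hc.congr_Ioo (by linarith) fun t ht => by simp [hdt, not_le.2 ht.2]
    have h2 : IntervalIntegrable dt volume 0 T :=
      (hd.intervalIntegrable hT Set.Icc_subset_Ici_self).congr_Ioo hT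
        fun t ht => by simp [hdt, ht.1.le]
    have h3 : IntervalIntegrable dt volume (0 - r) (T - r) := by
      refine (h1.trans h2).mono_set ?_
      rw [Set.uIcc_of_le (by linarith), Set.uIcc_of_le (by linarith)]
      exact Set.Icc_subset_Icc (by linarith) (by linarith)
    simpa using h3.comp_sub_right r
  have hGi : ∀ T, 0 ≤ T → IntervalIntegrable (fun s => G' (dt (s - r))) volume 0 T :=
    fun T hT => IntervalIntegrable.clm_apply_continuous continuous_const (hdti T hT)
  have hfi : ∀ T, 0 ≤ T → IntervalIntegrable f volume 0 T := by
    intro T hT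
    have h1 := (hu (0 - δ) (T - δ) (by linarith) (by linarith)).comp_sub_right δ
    have h2 : IntervalIntegrable (fun s => u (s - δ)) volume 0 T := by simpa using h1
    rw [hf]
    exact (IntervalIntegrable.smul_vector h2 B).add (hGi T hT)
  have hxf : ∀ T, SolvesODEFrom 0 (Set.Icc 0 T) x (fun t => F (x t) + f (t + r)) := by
    intro T
    refine (hxode T).congr fun t ht => ?_
    simp only [hf, hdt, add_sub_cancel_right, ht.1.le, if_true]
    rw [show t + r - δ = t - τ by rw [hδdef]; ring]
  have hfγ : ∀ t ∈ Set.Ioo 0 r, ‖f t‖ ≤ N * ‖B‖ := by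
    intro t ht
    have h1 : ¬ (0 ≤ t - r) := by linarith [ht.2]
    simp only [hf, hdt, h1, if_false, map_zero, add_zero, norm_smul, Real.norm_eq_abs]
    gcongr
    exact hu0 _ ⟨by linarith [ht.1], by linarith [ht.2]⟩
  -- On `[0, r)` the shifted state `x(t - r)` is initial history and obeys no equation; `X` replaces
  -- it there by a genuine solution.
  obtain ⟨X, hX, hXx, hXb⟩ := exists_backward_extension hr hM.le
    (by positivity : 0 ≤ N * ‖B‖) hMr hfi hxf hfγ
  have hXb' : ∀ t ∈ Set.Icc 0 r, ‖X t‖ ≤ c₁ * N := by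
    intro t ht
    refine (hXb t ht).trans ?_
    calc M * ((M * ‖x 0‖ + r * M * (N * ‖B‖)) + r * M * (N * ‖B‖))
        ≤ M * ((M * N + r * M * (N * ‖B‖)) + r * M * (N * ‖B‖)) := by gcongr
      _ = c₁ * N := by rw [hc₁]; ring
  have hX0 : ‖X 0‖ ≤ c₁ * N := hXb' 0 ⟨le_rfl, hr⟩
  have hz0 : ‖z 0‖ ≤ N := hz₀.trans hIN
  have hzode := hzodeT T
  -- observer error
  obtain ⟨e, he⟩ : ∃ y : ℝ → V, y = fun t => z t - X t := ⟨_, rfl⟩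
  obtain ⟨η, hη⟩ : ∃ y : ℝ → ℝ, y = fun t => w t - φ (X t) := ⟨_, rfl⟩
  obtain ⟨g, hg⟩ : ∃ y : ℝ → V, y = fun t => G' (dt (t - r)) := ⟨_, rfl⟩
  rcases lt_or_ge T 0 with hT | hT
  · simp [Set.Icc_eq_empty_of_lt hT]
  have heode : SolvesODEFrom 0 (Set.Icc 0 T) e
      (fun t => F (e t) + (φ (e t) - η t) • p - g t) := by
    intro t ht
    obtain ⟨h1, h2⟩ := hzode t ht
    obtain ⟨h3, h4⟩ := hX T t ht
    have hfun : (fun t => F (e t) + (φ (e t) - η t) • p - g t) = fun t =>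
        (F (z t) + u (t - δ) • B + (φ (z t) - w t) • p) - (F (X t) + f t) := by
      funext s
      have : φ (e s) - η s = φ (z s) - w s := by simp only [he, hη, map_sub]; ring
      rw [this]
      simp only [he, hg, hf, map_sub]
      abel
    rw [hfun]
    refine ⟨h1.sub h3, ?_⟩
    rw [intervalIntegral.integral_sub h1 h3]
    simp only [he]
    rw [h2, h4]
    abel
  have hgb : ∀ t ∈ Set.Icc 0 T, ‖g t‖ ≤ cD * N * Real.exp (-σ * t) := by
    intro t ht
    have h1 : ‖dt (t - r)‖ ≤ N * (Λ * Real.exp (-σ * t)) := by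
      simp only [hdt]
      split_ifs with h
      · refine (hdD _ ⟨h, by linarith [ht.2]⟩).trans ?_
        gcongr
        exact hdelay _ _ (by linarith)
      · rw [norm_zero]; positivity
    calc ‖g t‖ ≤ ‖G'‖ * ‖dt (t - r)‖ := by rw [hg]; exact G'.le_opNorm _
      _ ≤ ‖G'‖ * (N * (Λ * Real.exp (-σ * t))) := by gcongr
      _ = (‖G'‖ * Λ) * N * Real.exp (-σ * t) := by ring
      _ ≤ cD * N * Real.exp (-σ * t) := by
          gcongr
          rw [hcD]
          have : 0 ≤ Λ * (1 + ‖φ‖ * (1 + c₁)) := by positivity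
          linarith
  have hηs : ∀ t ∈ Set.Icc 0 T, ∃ s ∈ Set.Icc 0 t, t - s ≤ T₁ ∧ ∃ ξ' : ℝ,
      |ξ'| ≤ cD * N * Real.exp (-σ * s) ∧ η t = ξ' + ∫ v in s..t, φ (F (e v) - g v) := by
    intro t ht
    obtain ⟨i, hi⟩ := exists_samplingTime_mem_Ico hT₁ hb ht.1
    have hs0 : 0 ≤ samplingTime T₁ b i := samplingTime_nonneg hT₁ i
    have hsT : samplingTime T₁ b i ∈ Set.Icc 0 T := ⟨hs0, hi.1.trans ht.2⟩
    have hst : t - samplingTime T₁ b i ≤ T₁ := by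
      linarith [samplingTime_succ_sub_le (b := b) hT₁ hb0 i, hi.2]
    have hs00 : i = 0 → samplingTime T₁ b i = 0 := by
      rintro rfl
      rfl
    have hw : i ≠ 0 → w (samplingTime T₁ b i) =
        φ (x (samplingTime T₁ b i - r)) + ξ (samplingTime T₁ b i) := by
      intro h
      obtain ⟨l, rfl⟩ := Nat.exists_eq_succ_of_ne_zero h
      exact hws l
    have hwi := hwode i t hi
    have hi1 := hi.1
    generalize samplingTime T₁ b i = s at *
    -- The value `η s` just after the reset serves as the noise; for `i = 0` it is the initial
    -- error.
    refine ⟨s, ⟨hs0, hi1⟩, hst, η s, ?_, ?_⟩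
    · by_cases hi0 : i = 0
      · rw [hs00 hi0, mul_zero, Real.exp_zero, mul_one]
        simp only [hη]
        calc |w 0 - φ (X 0)| ≤ |w 0| + |φ (X 0)| := abs_sub _ _
          _ ≤ N + ‖φ‖ * (c₁ * N) := by
              refine add_le_add (hw₀.trans hIN) ((φ.le_opNorm _).trans ?_)
              gcongr
          _ = (1 + ‖φ‖ * c₁) * N := by ring
          _ ≤ cD * N := by
              gcongr
              rw [hcD]
              have h1 : 0 ≤ ‖G'‖ * Λ := by positivity
              have h2 : 0 ≤ ‖φ‖ * c₁ := by positivity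
              nlinarith [norm_nonneg φ]
      · have hηs : η s = ξ s + φ (x (s - r) - X s) := by
          simp only [hη, hw hi0, map_sub]; ring
        -- A sample taken before time `r` reads the history instead of `X s`. The mismatch is
        -- bounded by the initial data and can be given the exponential weight, since `Λ exp(-σ s) ≥
        -- 1` for `s < r`.
        have h1 : ‖x (s - r) - X s‖ ≤ (1 + c₁) * N * (Λ * Real.exp (-σ * s)) := by
          rcases le_or_gt r s with hrs | hrs
          · rw [hXx s hrs, sub_self, norm_zero]
            positivity
          · have h2 : (1 : ℝ) ≤ Λ * Real.exp (-σ * s) := by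
              have := hdelay 0 s (by linarith)
              simpa using this
            calc ‖x (s - r) - X s‖ ≤ ‖x (s - r)‖ + ‖X s‖ := norm_sub_le _ _
              _ ≤ N + c₁ * N := add_le_add (hx0 _ ⟨by linarith, by linarith⟩)
                  (hXb' s ⟨hs0, hrs.le⟩)
              _ = (1 + c₁) * N * 1 := by ring
              _ ≤ _ := by gcongr
        rw [hηs]
        calc |ξ s + φ (x (s - r) - X s)| ≤ |ξ s| + |φ (x (s - r) - X s)| := abs_add_le _ _
          _ ≤ N * Real.exp (-σ * s) + ‖φ‖ * ((1 + c₁) * N * (Λ * Real.exp (-σ * s))) := by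
              refine add_le_add ((hξ s hsT).trans (by gcongr)) ((φ.le_opNorm _).trans ?_)
              gcongr
          _ = (1 + Λ * (‖φ‖ * (1 + c₁))) * N * Real.exp (-σ * s) := by ring
          _ ≤ cD * N * Real.exp (-σ * s) := by
              gcongr
              rw [hcD]
              have h3 : 0 ≤ ‖G'‖ * Λ := by positivity
              nlinarith
    · obtain ⟨h1, h2⟩ := hwi
      obtain ⟨h3, h4⟩ := ((hX T).restart hsT) t ⟨hi1, ht.2⟩
      have h5 : IntervalIntegrable (fun t => φ (F (X t) + f t)) volume s t :=
        ⟨φ.integrable_comp h3.1, φ.integrable_comp h3.2⟩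
      simp only [hη]
      rw [h2, h4, map_add, ← φ.intervalIntegral_comp_comm h3]
      -- The inter-sample dynamics of `w` copies the known input, which therefore cancels against
      -- that of `φ(X)`.
      have hfun : (fun v => φ (F (e v) - g v)) = fun v =>
          (φ (F (z v)) + φ B * u (v - δ)) - φ (F (X v) + f v) := by
        funext v
        simp only [he, hg, hf, map_sub, map_add, map_smul, smul_eq_mul]
        ring
      rw [hfun, intervalIntegral.integral_sub h1 h5]
      ring
  have hobs := obs T₁ hT₁ hT₁' T (cD * N) (by positivity) e g η (hg ▸ hGi T hT) heode hgb hηs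
  have he0 : CA * (‖e 0‖ + cD * N) ≤ c₂ * N := by
    have : ‖e 0‖ ≤ N + c₁ * N := by
      rw [he]
      exact (norm_sub_le _ _).trans (add_le_add hz0 hX0)
    calc CA * (‖e 0‖ + cD * N) ≤ CA * ((N + c₁ * N) + cD * N) := by gcongr
      _ = c₂ * N := by rw [hc₂]; ring
  have heb : ∀ t ∈ Set.Icc 0 T, ‖e t‖ ≤ c₂ * N * Real.exp (-σ * t) := fun t ht =>
    (hobs t ht).1.trans (by gcongr)
  have hηb : ∀ t ∈ Set.Icc 0 T, |η t| ≤ c₂ * N * Real.exp (-σ * t) := fun t ht =>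
    (hobs t ht).2.trans (by gcongr)
  have hvb : ∀ t ∈ Set.Icc 0 T, |φ (z t) - w t| ≤ cv * N * Real.exp (-σ * t) := by
    intro t ht
    have h1 : φ (z t) - w t = φ (e t) - η t := by simp only [he, hη, map_sub]; ring
    rw [h1]
    calc |φ (e t) - η t| ≤ |φ (e t)| + |η t| := abs_sub _ _
      _ ≤ ‖φ‖ * (c₂ * N * Real.exp (-σ * t)) + c₂ * N * Real.exp (-σ * t) := by
          refine add_le_add ((φ.le_opNorm _).trans ?_) (hηb t ht)
          gcongr
          exact heb t ht
      _ = _ := by rw [hcv]; ring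
  -- predicted state
  obtain ⟨Y, hY⟩ : ∃ y : ℝ → V, y = inputPredictor F B δ z u := ⟨_, rfl⟩
  have hYode := solvesODEFrom_inputPredictor (v := fun t => φ (z t) - w t) hδ hu hzode
  rw [← hY] at hYode
  have hMδ : ‖NormedSpace.exp (δ • F)‖ ≤ M := hMF δ (by rw [abs_of_nonneg hδ])
  have hq : ∀ t ∈ Set.Icc 0 T, ‖(φ (z t) - w t) • NormedSpace.exp (δ • F) p‖ ≤
      cv * (M * ‖p‖) * N * Real.exp (-σ * t) := by
    intro t ht
    rw [norm_smul, Real.norm_eq_abs]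
    calc |φ (z t) - w t| * ‖NormedSpace.exp (δ • F) p‖
        ≤ (cv * N * Real.exp (-σ * t)) * (M * ‖p‖) := by
          gcongr
          · exact hvb t ht
          · exact (ContinuousLinearMap.le_opNorm _ _).trans (by gcongr)
      _ = _ := by ring
  have hholdidx : ∀ t : ℝ, 0 ≤ t → ∃ s ∈ Set.Icc 0 t, t - s ≤ T₂ ∧ u t = ψ (Y s) := by
    intro t ht
    have hfl := Nat.floor_le (div_nonneg ht hT₂.le)
    have hlt := Nat.lt_floor_add_one (t / T₂)
    rw [le_div_iff₀ hT₂] at hfl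
    rw [div_lt_iff₀ hT₂] at hlt
    have h0 : 0 ≤ (⌊t / T₂⌋₊ : ℝ) * T₂ := by positivity
    refine ⟨⌊t / T₂⌋₊ * T₂, ⟨h0, hfl⟩, by linarith, ?_⟩
    rw [huh _ t ⟨hfl, hlt⟩, hY]
  have hY0 : ‖Y 0‖ ≤ (M + δ * (M * (1 * ‖B‖))) * N := by
    have h1 := norm_integral_exp_input_le (B := B) hM.le hδ hMF hu le_rfl (γ := N) (fun s hs =>
      hu0 s ⟨by linarith [hs.1], hs.2⟩)
    calc ‖Y 0‖ ≤ M * N + δ * (M * (N * ‖B‖)) := by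
          rw [hY]
          refine (norm_add_le _ _).trans (add_le_add ?_ h1)
          exact (ContinuousLinearMap.le_opNorm _ _).trans (by gcongr)
      _ = _ := by ring
  have hYb : ∀ t ∈ Set.Icc 0 T, ‖Y t‖ ≤ c₃ * N * Real.exp (-σ * t) := by
    intro t ht
    refine (hold T₂ hT₂ hT₂' T (cv * (M * ‖p‖) * N) (by positivity) Y _ u hYode hq
      (fun t ht => hholdidx t ht.1) t ht).trans
      (mul_le_mul_of_nonneg_right ?_ (Real.exp_pos _).le)
    calc CB * (‖Y 0‖ + cv * (M * ‖p‖) * N)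
        ≤ CB * ((M + δ * (M * (1 * ‖B‖))) * N + cv * (M * ‖p‖) * N) := by gcongr
      _ = c₃ * N := by rw [hc₃]; ring
  have hub : ∀ t ∈ Set.Ico (-δ) 0 ∪ Set.Icc 0 T, |u t| ≤ c₄ * N * Real.exp (-σ * t) := by
    rintro t (ht | ht)
    · calc |u t| ≤ 1 * N * 1 := by rw [one_mul, mul_one]; exact hu0 t ht
        _ ≤ c₄ * N * Real.exp (-σ * t) := by
            gcongr
            · rw [hc₄]
              have : 0 ≤ ‖ψ‖ * c₃ * Real.exp σ := by positivity
              linarith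
            · exact hexp0 t ht.2.le
    · obtain ⟨s, hs, hst, hus⟩ := hholdidx t ht.1
      rw [hus]
      have h1 := hYb s ⟨hs.1, hs.2.trans ht.2⟩
      have h2 : Real.exp (-σ * s) ≤ Real.exp σ * Real.exp (-σ * t) :=
        exp_neg_mul_le_of_sub_le_one hσ.le (by linarith)
      calc |ψ (Y s)| ≤ ‖ψ‖ * (c₃ * N * (Real.exp σ * Real.exp (-σ * t))) := by
            refine (ψ.le_opNorm _).trans ?_
            gcongr
            exact h1.trans (by gcongr)
        _ = (‖ψ‖ * c₃ * Real.exp σ) * N * Real.exp (-σ * t) := by ring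
        _ ≤ c₄ * N * Real.exp (-σ * t) := by
            gcongr
            linarith
  have hud : ∀ t ∈ Set.Icc 0 T, ∀ s ∈ Set.Icc (t - δ) t,
      |u s| ≤ c₄ * Λ * N * Real.exp (-σ * t) := by
    intro t ht s hs
    have h1 : s ∈ Set.Ico (-δ) 0 ∪ Set.Icc 0 T := by
      rcases lt_or_ge s 0 with h | h
      · exact Or.inl ⟨by linarith [hs.1, ht.1], h⟩
      · exact Or.inr ⟨h, hs.2.trans ht.2⟩
    calc |u s| ≤ c₄ * N * Real.exp (-σ * s) := hub s h1
      _ ≤ c₄ * N * (Λ * Real.exp (-σ * t)) := by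
          gcongr
          exact hdelay s t (by linarith [hs.1])
      _ = _ := by ring
  have hzb : ∀ t ∈ Set.Icc 0 T, ‖z t‖ ≤ c₅ * N * Real.exp (-σ * t) := by
    intro t ht
    have h1 := norm_integral_exp_input_le (B := B) hM.le hδ hMF hu ht.1
      (γ := c₄ * Λ * N * Real.exp (-σ * t))
      (fun s hs => hud t ht s ⟨hs.1.le, hs.2.le⟩)
    -- The predictor is inverted: `z` is determined by `Y` and the past input, both already bounded.
    have h2 : z t = NormedSpace.exp ((-δ) • F) (Y t - NormedSpace.exp (t • F)
        (∫ s in (t - δ)..t, NormedSpace.exp ((-s) • F) (u s • B))) := by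
      rw [hY, inputPredictor, add_sub_cancel_right, exp_smul_apply_apply, neg_add_cancel]
      let _ : NormedAlgebra ℚ (V →L[ℝ] V) :=
        NormedAlgebra.restrictScalars ℚ ℝ _
      simp [NormedSpace.exp_zero]
    rw [h2]
    calc _ ≤ M * (c₃ * N * Real.exp (-σ * t) +
          δ * (M * (c₄ * Λ * N * Real.exp (-σ * t) * ‖B‖))) := by
          refine (ContinuousLinearMap.le_opNorm _ _).trans ?_
          gcongr
          · exact hMF _ (by rw [abs_neg, abs_of_nonneg hδ])
          · exact (norm_sub_le _ _).trans (add_le_add (hYb t ht) h1)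
      _ = _ := by rw [hc₅]; ring
  have hwb : ∀ t ∈ Set.Icc 0 T, |w t| ≤ c₆ * N * Real.exp (-σ * t) := by
    intro t ht
    calc |w t| = |φ (z t) - (φ (z t) - w t)| := by rw [sub_sub_cancel]
      _ ≤ |φ (z t)| + |φ (z t) - w t| := abs_sub _ _
      _ ≤ ‖φ‖ * (c₅ * N * Real.exp (-σ * t)) + cv * N * Real.exp (-σ * t) := by
          refine add_le_add ((φ.le_opNorm _).trans ?_) (hvb t ht)
          gcongr
          exact hzb t ht
      _ = _ := by rw [hc₆]; ring
  have hxb : ∀ t ∈ Set.Icc 0 T, ‖x t‖ ≤ c₇ * N * Real.exp (-σ * t) := by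
    intro t ht
    -- For `t ≥ r` the observer controls `x(t - r) = X(t) = z(t) - e(t)`, and the plant equation
    -- carries the bound forward over a time `r`. For `t < r` one starts from `x 0`.
    have hs0 : max (t - r) 0 ∈ Set.Icc 0 t := ⟨le_max_right _ _, max_le (by linarith) ht.1⟩
    have hstart : ‖x (max (t - r) 0)‖ ≤ (c₅ + c₂ + Λ) * N * Real.exp (-σ * t) := by
      rcases le_or_gt r t with hrt | hrt
      · rw [max_eq_left (by linarith), ← hXx t hrt]
        have h1 : X t = z t - e t := by simp only [he]; abel
        rw [h1]
        calc ‖z t - e t‖ ≤ c₅ * N * Real.exp (-σ * t) + c₂ * N * Real.exp (-σ * t) :=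
              (norm_sub_le _ _).trans (add_le_add (hzb t ht) (heb t ht))
          _ = (c₅ + c₂ + 0) * N * Real.exp (-σ * t) := by ring
          _ ≤ _ := by gcongr
      · rw [max_eq_right (by linarith)]
        have h2 : (1 : ℝ) ≤ Λ * Real.exp (-σ * t) := by
          have := hdelay 0 t (by linarith)
          simpa using this
        calc ‖x 0‖ ≤ N * 1 := by rw [mul_one]; exact hx00
          _ ≤ N * (Λ * Real.exp (-σ * t)) := by gcongr
          _ = Λ * N * Real.exp (-σ * t) := by ring
          _ ≤ _ := by
              gcongr
              linarith
    have h1 := SolvesODEFrom.norm_le_of_short (R := r)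
      (γ := (c₄ * Λ * ‖B‖ + ‖G'‖ * Λ) * N * Real.exp (-σ * t)) hM.le (by positivity) hMr hs0.2
      (by linarith [le_max_left (t - r) 0]) ((hxf t).restart hs0) ?_
    · refine h1.trans ?_
      calc M * (‖x (max (t - r) 0)‖ +
            r * M * ((c₄ * Λ * ‖B‖ + ‖G'‖ * Λ) * N * Real.exp (-σ * t)))
          ≤ M * ((c₅ + c₂ + Λ) * N * Real.exp (-σ * t) +
            r * M * ((c₄ * Λ * ‖B‖ + ‖G'‖ * Λ) * N * Real.exp (-σ * t))) := by gcongr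
        _ = _ := by rw [hc₇]; ring
    · intro s hs
      have hs1 : 0 ≤ s := hs0.1.trans hs.1.le
      have hs2 : t - r ≤ s := (le_max_left _ _).trans hs.1.le
      have h2 : ‖dt (s + r - r)‖ ≤ N * (Λ * Real.exp (-σ * t)) := by
        simp only [hdt, add_sub_cancel_right, hs1, if_true]
        refine (hdD s ⟨hs1, hs.2.le.trans ht.2⟩).trans ?_
        gcongr
        exact hdelay _ _ (by linarith)
      calc ‖f (s + r)‖ ≤ |u (s + r - δ)| * ‖B‖ + ‖G'‖ * ‖dt (s + r - r)‖ := by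
            rw [hf]
            refine (norm_add_le _ _).trans (add_le_add ?_ (G'.le_opNorm _))
            rw [norm_smul, Real.norm_eq_abs]
        _ ≤ (c₄ * Λ * N * Real.exp (-σ * t)) * ‖B‖ +
            ‖G'‖ * (N * (Λ * Real.exp (-σ * t))) := by
            gcongr
            exact hud t ht _ ⟨by linarith, by linarith [hs.2]⟩
        _ = _ := by ring
  have hfinal : ∀ c' t : ℝ, c' ≤ c₄ + c₅ + c₆ + c₇ + 1 →
      c' * N * Real.exp (-σ * t) ≤ (c₄ + c₅ + c₆ + c₇ + 1) * N * Real.exp (-σ * t) := by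
    intro c' t h
    gcongr
  intro t ht
  exact ⟨(hzb t ht).trans (hfinal _ _ (by linarith)), (hwb t ht).trans (hfinal _ _ (by linarith)),
    (hxb t ht).trans (hfinal _ _ (by linarith)), (hub t (Or.inr ht)).trans
      (hfinal _ _ (by linarith))⟩

/-- Exponential estimate for the solutions of the closed loop, uniform in the sampling schedule. -/
theorem exists_closedLoop_estimate {n : ℕ} (A G : Matrix (Fin n) (Fin n) ℝ)
    (B c k p : EuclideanSpace ℝ (Fin n)) (r τ : ℝ) (hr : 0 ≤ r) (hτ : 0 ≤ τ)
    (hk : IsHurwitzMatrix (A + outerProd B k)) (hp : IsHurwitzMatrix (A + outerProd p c)) :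
    ∃ T₁max > (0 : ℝ), ∃ T₂max > (0 : ℝ), ∃ σ > (0 : ℝ), ∃ C > (0 : ℝ),
      ∀ T₁ : ℝ, 0 < T₁ → T₁ ≤ T₁max → ∀ T₂ : ℝ, 0 < T₂ → T₂ ≤ T₂max →
      ∀ (x₀ : ℝ → EuclideanSpace ℝ (Fin n)) (u₀ : ℝ → ℝ)
        (z₀ : EuclideanSpace ℝ (Fin n)) (w₀ : ℝ)
        (ξ b : ℝ → ℝ) (d : ℝ → EuclideanSpace ℝ (Fin n))
        (x : ℝ → EuclideanSpace ℝ (Fin n)) (u : ℝ → ℝ)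
        (z : ℝ → EuclideanSpace ℝ (Fin n)) (w : ℝ → ℝ),
        IsLInftyLoc (Set.Icc (-r - τ) 0) u₀ →
        IsLInftyLoc (Set.Ici 0) b → (∀ t : ℝ, 0 ≤ t → 0 ≤ b t) →
        IsLInftyLoc (Set.Ici 0) d →
        IsClosedLoopSolution A G B c k p r τ T₁ T₂ x₀ u₀ z₀ w₀ ξ b d x u z w →
        ∀ T I D : ℝ, 0 ≤ I → 0 ≤ D → ‖z₀‖ ≤ I → |w₀| ≤ I →
        (∀ θ ∈ Set.Icc (-r) 0, ‖x₀ θ‖ ≤ I) → (∀ θ ∈ Set.Ico (-r - τ) 0, |u₀ θ| ≤ I) →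
        (∀ t ∈ Set.Icc 0 T, |ξ t| ≤ D * Real.exp (-σ * t)) →
        (∀ t ∈ Set.Icc 0 T, ‖d t‖ ≤ D * Real.exp (-σ * t)) →
        ∀ t ∈ Set.Icc 0 T,
          ‖z t‖ ≤ C * (I + D) * Real.exp (-σ * t) ∧ |w t| ≤ C * (I + D) * Real.exp (-σ * t) ∧
          ‖x t‖ ≤ C * (I + D) * Real.exp (-σ * t) ∧ |u t| ≤ C * (I + D) * Real.exp (-σ * t) := by
  obtain ⟨K₁, hK₁, α₁, hα₁, hF₁⟩ := hk.exists_norm_exp_le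
  obtain ⟨K₂, hK₂, α₂, hα₂, hF₂⟩ := hp.exists_norm_exp_le
  rw [toEuclideanCLM_add_outerProd] at hF₁ hF₂
  obtain ⟨T₁max, hT₁max, T₂max, hT₂max, σ, hσ, C, hC, h⟩ := exists_sampledPredictorLoop_estimate
    (Matrix.toEuclideanCLM (𝕜 := ℝ) A) (Matrix.toEuclideanCLM (𝕜 := ℝ) G) (innerSL ℝ c)
    (innerSL ℝ k) B p hr hτ rfl hK₁ hα₁ hK₂ hα₂ hF₁ hF₂
  refine ⟨T₁max, hT₁max, T₂max, hT₂max, σ, hσ, C, hC, ?_⟩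
  intro T₁ hT₁ hT₁' T₂ hT₂ hT₂' x₀ u₀ z₀ w₀ ξ b d x u z w hu₀ hb hb0 hd hsol T I D hI hD
    hz₀ hw₀ hx₀ hu₀I hξ hdD
  have hu := hsol.intervalIntegrable_u hr hτ hT₂ hu₀
  have hx0 : ∀ θ ∈ Set.Icc (-r) 0, ‖x θ‖ ≤ I := fun θ hθ => by
    rw [hsol.x_init θ hθ]; exact hx₀ θ hθ
  have hu0 : ∀ θ ∈ Set.Ico (-(r + τ)) 0, |u θ| ≤ I := fun θ hθ => by
    have hθ' : θ ∈ Set.Ico (-r - τ) 0 := ⟨by linarith [hθ.1], hθ.2⟩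
    rw [hsol.u_init θ hθ']; exact hu₀I θ hθ'
  refine h T₁ hT₁ hT₁' T₂ hT₂ hT₂' ξ b d x u z w hu hb hb0 hd (fun T => ?_) (fun T => ?_)
    (fun i => ?_) hsol.w_sample (fun i t ht => ?_) T I D hI hD (by rwa [hsol.z_init])
    (by rwa [hsol.w_init]) hx0 hu0 hξ hdD
  · refine SolvesODEFrom.congr (hsol.x_ode.mono Set.Icc_subset_Ici_self) fun t _ => ?_
    rw [add_assoc]
    rfl
  · refine SolvesODEFrom.congr (hsol.z_ode.mono Set.Icc_subset_Ici_self) fun t _ => ?_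
    rw [← sub_sub]
    rfl
  · have := hsol.w_ode i
    simp only [sub_sub] at this
    exact this
  · rw [hsol.u_hold i t ht]
    exact inner_inputPredictor A B k hr hτ z hu (by positivity)

/-! ### Differences of solutions -/

theorem SolvesODEFrom.sub {V : Type*} [NormedAddCommGroup V] [NormedSpace ℝ V] {a : ℝ}
    {J : Set ℝ} {y y' f f' : ℝ → V} (h : SolvesODEFrom a J y f) (h' : SolvesODEFrom a J y' f') :
    SolvesODEFrom a J (fun t => y t - y' t) (fun t => f t - f' t) := by
  intro t ht
  refine ⟨(h t ht).1.sub (h' t ht).1, ?_⟩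
  rw [intervalIntegral.integral_sub (h t ht).1 (h' t ht).1]
  simp only
  rw [(h t ht).2, (h' t ht).2]
  abel

theorem matAct_sub {n : ℕ} (A : Matrix (Fin n) (Fin n) ℝ) (v w : EuclideanSpace ℝ (Fin n)) :
    matAct A (v - w) = matAct A v - matAct A w := map_sub _ _ _

theorem matAct_zero {n : ℕ} (A : Matrix (Fin n) (Fin n) ℝ) : matAct A 0 = 0 := map_zero _

/-- The difference of two solutions with the same data solves the homogeneous closed loop. -/
theorem IsClosedLoopSolution.sub {n : ℕ} {A G : Matrix (Fin n) (Fin n) ℝ}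
    {B c k p : EuclideanSpace ℝ (Fin n)} {r τ T₁ T₂ : ℝ} (hr : 0 ≤ r) (hτ : 0 ≤ τ)
    (hT₂ : 0 < T₂) {x₀ : ℝ → EuclideanSpace ℝ (Fin n)} {u₀ : ℝ → ℝ}
    {z₀ : EuclideanSpace ℝ (Fin n)} {w₀ : ℝ} {ξ b : ℝ → ℝ} {d x x' : ℝ → EuclideanSpace ℝ (Fin n)}
    {u u' : ℝ → ℝ} {z z' : ℝ → EuclideanSpace ℝ (Fin n)} {w w' : ℝ → ℝ}
    (h' : IsClosedLoopSolution A G B c k p r τ T₁ T₂ x₀ u₀ z₀ w₀ ξ b d x' u' z' w')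
    (h : IsClosedLoopSolution A G B c k p r τ T₁ T₂ x₀ u₀ z₀ w₀ ξ b d x u z w)
    (hu₀ : IsLInftyLoc (Set.Icc (-r - τ) 0) u₀) :
    IsClosedLoopSolution A G B c k p r τ T₁ T₂ (fun _ => 0) (fun _ => 0) 0 0 (fun _ => 0) b
      (fun _ => 0) (fun t => x' t - x t) (fun t => u' t - u t) (fun t => z' t - z t)
      (fun t => w' t - w t) where
  x_init θ hθ := by rw [h'.x_init θ hθ, h.x_init θ hθ, sub_self]
  u_init θ hθ := by rw [h'.u_init θ hθ, h.u_init θ hθ, sub_self]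
  z_init := by rw [h'.z_init, h.z_init, sub_self]
  w_init := by rw [h'.w_init, h.w_init, sub_self]
  x_ode := by
    have := h'.x_ode.sub h.x_ode
    convert this using 2 with t
    rw [matAct_sub, matAct_zero, sub_smul]
    abel
  z_ode := by
    have := h'.z_ode.sub h.z_ode
    convert this using 2 with t
    rw [matAct_sub, sub_smul, inner_sub_right, sub_sub_sub_comm, sub_smul]
    abel
  w_ode i := by
    have := (h'.w_ode i).sub (h.w_ode i)
    convert this using 2 with t
    rw [matAct_sub, inner_sub_right]
    ring
  w_sample i := by
    rw [h'.w_sample, h.w_sample, inner_sub_right]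
    ring
  u_hold i t ht := by
    have hi : ∀ {v : ℝ → ℝ}, (∀ s t : ℝ, -(r + τ) ≤ s → -(r + τ) ≤ t →
        IntervalIntegrable v volume s t) → IntervalIntegrable (fun s =>
        inner ℝ k (matAct (NormedSpace.exp ((-s) • A)) B) * v (i * T₂ + s)) volume (-r - τ) 0 := by
      intro v hv
      have h0 : (0 : ℝ) ≤ i * T₂ := by positivity
      have h1 := (hv (i * T₂ + (-r - τ)) (i * T₂ + 0) (by linarith)
        (by linarith)).comp_add_left (i * T₂)
      simp only [add_sub_cancel_left] at h1
      refine h1.continuousOn_mul (Continuous.continuousOn ?_)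
      simp only [matAct_exp_smul]
      have hc : Continuous fun s : ℝ =>
          NormedSpace.exp ((-s) • Matrix.toEuclideanCLM (𝕜 := ℝ) A) :=
        (NormedSpace.continuous_exp_smul_real (Matrix.toEuclideanCLM (𝕜 := ℝ) A)).comp
          continuous_neg
      exact continuous_const.inner (hc.clm_apply continuous_const)
    rw [h'.u_hold i t ht, h.u_hold i t ht, matAct_sub, inner_sub_right]
    simp only [mul_sub]
    rw [intervalIntegral.integral_sub (hi (h'.intervalIntegrable_u hr hτ hT₂ hu₀))
      (hi (h.intervalIntegrable_u hr hτ hT₂ hu₀))]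
    ring

/-! ### Existence of solutions -/

/-- A causal map, whose value at `t` is determined by the values of its argument at the times of
strictly smaller rank, has a fixed point. -/
theorem exists_fixedPoint_of_causal {α : Type*} [Inhabited α] (N : ℝ → ℕ)
    (Φ : (ℝ → α) → ℝ → α)
    (h : ∀ f g t, (∀ s, N s < N t → f s = g s) → Φ f t = Φ g t) : ∃ f, ∀ t, f t = Φ f t := by
  classical
  -- Well-founded recursion on the rank. The value `default` stands in at times whose rank is not
  -- smaller; by `h` it has no influence.
  let f : ℝ → α := (measure N).wf.fix
    (fun t rec => Φ (fun s => if hs : N s < N t then rec s hs else default) t)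
  refine ⟨f, fun t => ?_⟩
  have h1 : f t = Φ (fun s => if _ : N s < N t then f s else default) t :=
    (measure N).wf.fix_eq _ t
  rw [h1]
  refine h _ _ t fun s hs => ?_
  simp [hs]

section
variable {V : Type*} [NormedAddCommGroup V] [NormedSpace ℝ V] [CompleteSpace V]

/-- The end points are null sets. That the input at time `t` itself does not matter keeps the loop
strictly causal even with zero delays. -/
theorem variationOfConstants_congr {F : V →L[ℝ] V} {a t : ℝ} {y₀ : V} {g g' : ℝ → V} (hat : a ≤ t)
    (h : ∀ s ∈ Set.Ioo a t, g s = g' s) :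
    variationOfConstants F a y₀ g t = variationOfConstants F a y₀ g' t := by
  rw [variationOfConstants, variationOfConstants]
  congr 2
  exact intervalIntegral.integral_congr_Ioo' hat fun s hs => by rw [h s hs]

/-- Existence of solutions of the closed loop, for an arbitrary causal hold law `H`. -/
theorem exists_sampledHoldLoop (F G' : V →L[ℝ] V) (φ : V →L[ℝ] ℝ) (B p : V) {r τ δ T₁ T₂ : ℝ}
    (hr : 0 ≤ r) (hτ : 0 ≤ τ) (hδ : δ = r + τ) (hT₁ : 0 < T₁) (hT₂ : 0 < T₂)
    (H : ℕ → V → (ℝ → ℝ) → ℝ)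
    (hH : ∀ (i : ℕ) ζ u u', (∀ s < (i : ℝ) * T₂, u s = u' s) → H i ζ u = H i ζ u')
    (x₀ : ℝ → V) (u₀ : ℝ → ℝ) (z₀ : V) (w₀ : ℝ) (ξ b : ℝ → ℝ) (d : ℝ → V)
    (hu₀ : IntervalIntegrable u₀ volume (-δ) 0) (hb : IsLInftyLoc (Set.Ici 0) b)
    (hd : ∀ T, 0 ≤ T → IntervalIntegrable d volume 0 T) :
    ∃ (x : ℝ → V) (u : ℝ → ℝ) (z : ℝ → V) (w : ℝ → ℝ),
      (∀ θ ∈ Set.Icc (-r) 0, x θ = x₀ θ) ∧ (∀ θ ∈ Set.Ico (-δ) 0, u θ = u₀ θ) ∧ z 0 = z₀ ∧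
      w 0 = w₀ ∧
      SolvesODEFrom 0 (Set.Ici 0) x (fun t => F (x t) + (u (t - τ) • B + G' (d t))) ∧
      SolvesODEFrom 0 (Set.Ici 0) z
        (fun t => F (z t) + (u (t - δ) • B + (φ (z t) - w t) • p)) ∧
      (∀ i : ℕ, SolvesODEFrom (samplingTime T₁ b i)
        (Set.Ico (samplingTime T₁ b i) (samplingTime T₁ b (i + 1))) w
        (fun t => φ (F (z t)) + φ B * u (t - δ))) ∧
      (∀ i : ℕ, w (samplingTime T₁ b (i + 1)) =
        φ (x (samplingTime T₁ b (i + 1) - r)) + ξ (samplingTime T₁ b (i + 1))) ∧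
      (∀ i : ℕ, ∀ t ∈ Set.Ico ((i : ℝ) * T₂) (((i : ℝ) + 1) * T₂), u t = H i (z (i * T₂)) u) := by
  have hδ0 : 0 ≤ δ := by rw [hδ]; positivity
  have hex : ∀ t, ∃ i, 0 ≤ t → t ∈ Set.Ico (samplingTime T₁ b i) (samplingTime T₁ b (i + 1)) := by
    intro t
    rcases lt_or_ge t 0 with h | h
    · exact ⟨0, fun h' => absurd h' (not_le.2 h)⟩
    · obtain ⟨i, hi⟩ := exists_samplingTime_mem_Ico hT₁ hb h
      exact ⟨i, fun _ => hi⟩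
  choose idx hidx using hex
  have hmono := strictMono_samplingTime (b := b) hT₁
  have hnn := samplingTime_nonneg (b := b) hT₁
  have hidx_lt : ∀ s i, 0 ≤ s → s < samplingTime T₁ b i → idx s < i := fun s i hs h =>
    hmono.lt_iff_lt.1 ((hidx s hs).1.trans_lt h)
  have hidx_mono : ∀ s t, 0 ≤ s → s ≤ t → idx s ≤ idx t := fun s t hs hst =>
    Nat.lt_succ_iff.1 (hidx_lt s _ hs (hst.trans_lt (hidx t (hs.trans hst)).2))
  have hidx_eq : ∀ t i, t ∈ Set.Ico (samplingTime T₁ b i) (samplingTime T₁ b (i + 1)) →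
      idx t = i := by
    intro t i ht
    have ht0 : 0 ≤ t := (hnn i).trans ht.1
    refine le_antisymm (Nat.lt_succ_iff.1 (hidx_lt t _ ht0 ht.2)) ?_
    exact Nat.lt_succ_iff.1 (hmono.lt_iff_lt.1 (ht.1.trans_lt (hidx t ht0).2))
  -- The rank counts the holding and sampling instants passed. Before the current holding instant
  -- the first summand is smaller, before the current sampling instant the second, and neither
  -- decreases with time; the `1` separates `[0, ∞)` from the history.
  let N : ℝ → ℕ := fun t => if t < 0 then 0 else ⌊t / T₂⌋₊ + idx t + 1
  have hN0 : ∀ t, t < 0 → N t = 0 := fun t ht => if_pos ht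
  have hN1 : ∀ t, 0 ≤ t → N t = ⌊t / T₂⌋₊ + idx t + 1 := fun t ht => if_neg (not_lt.2 ht)
  -- The unknown is the pair `(u, v)` with `v = φ(z) - w`. Given this pair, `z` and `x` are
  -- explicit; `qf` gives the values of `v` at the sampling instants, and between them `v' = φ(p) v`
  -- yields the exponential in `Φ`.
  let zf : (ℝ → ℝ × ℝ) → ℝ → V := fun f =>
    variationOfConstants F 0 z₀ (fun s => (f (s - δ)).1 • B + (f s).2 • p)
  let xf : (ℝ → ℝ × ℝ) → ℝ → V := fun f t => if t ≤ 0 then x₀ t else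
    variationOfConstants F 0 (x₀ 0) (fun s => (f (s - τ)).1 • B + G' (d s)) t
  let qf : (ℝ → ℝ × ℝ) → ℕ → ℝ := fun f i => if i = 0 then φ z₀ - w₀ else
    φ (zf f (samplingTime T₁ b i)) - φ (xf f (samplingTime T₁ b i - r)) - ξ (samplingTime T₁ b i)
  let Φ : (ℝ → ℝ × ℝ) → ℝ → ℝ × ℝ := fun f t =>
    (if t < 0 then u₀ t else H ⌊t / T₂⌋₊ (zf f (⌊t / T₂⌋₊ * T₂)) (fun s => (f s).1),
      if t < 0 then 0 else
        Real.exp (φ p * (t - samplingTime T₁ b (idx t))) * qf f (idx t))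
  have hzf : ∀ f g t, 0 ≤ t → (∀ s < t, f s = g s) → zf f t = zf g t := by
    intro f g t ht h
    refine variationOfConstants_congr ht fun s hs => ?_
    rw [h s hs.2, h (s - δ) (by linarith [hs.2])]
  have hxf : ∀ f g t, (∀ s < t, f s = g s) → xf f t = xf g t := by
    intro f g t h
    simp only [xf]
    split_ifs with h0
    · rfl
    · refine variationOfConstants_congr (not_le.1 h0).le fun s hs => ?_
      rw [h (s - τ) (by linarith [hs.2])]
  obtain ⟨f, hf⟩ := exists_fixedPoint_of_causal N Φ (by
    intro f g t hfg
    simp only [Φ]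
    rcases lt_or_ge t 0 with ht | ht
    · simp [ht]
    simp only [not_lt.2 ht, if_false]
    have hfl := Nat.floor_le (div_nonneg ht hT₂.le)
    rw [le_div_iff₀ hT₂] at hfl
    have h1 : ∀ s < (⌊t / T₂⌋₊ : ℝ) * T₂, f s = g s := by
      intro s hs
      refine hfg s ?_
      rw [hN1 t ht]
      rcases lt_or_ge s 0 with hs0 | hs0
      · rw [hN0 s hs0]; omega
      · rw [hN1 s hs0]
        have h2 : ⌊s / T₂⌋₊ < ⌊t / T₂⌋₊ := by
          rw [Nat.floor_lt (div_nonneg hs0 hT₂.le), div_lt_iff₀ hT₂]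
          exact hs
        have h3 := hidx_mono s t hs0 (hs.le.trans hfl)
        omega
    have h2 : ∀ s < samplingTime T₁ b (idx t), f s = g s := by
      intro s hs
      refine hfg s ?_
      rw [hN1 t ht]
      rcases lt_or_ge s 0 with hs0 | hs0
      · rw [hN0 s hs0]; omega
      · rw [hN1 s hs0]
        have hst : s ≤ t := hs.le.trans (hidx t ht).1
        have h2 : ⌊s / T₂⌋₊ ≤ ⌊t / T₂⌋₊ := Nat.floor_le_floor (by gcongr)
        have h3 := hidx_lt s _ hs0 hs
        omega
    have e1 : zf f (⌊t / T₂⌋₊ * T₂) = zf g (⌊t / T₂⌋₊ * T₂) :=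
      hzf f g _ (by positivity) h1
    have e2 : qf f (idx t) = qf g (idx t) := by
      simp only [qf]
      rw [hzf f g _ (hnn _) h2, hxf f g _ (fun s hs => h2 s (by linarith))]
    rw [e1, e2, hH _ _ (fun s => (f s).1) (fun s => (g s).1) (fun s hs => by rw [h1 s hs])])
  obtain ⟨u, hu⟩ : ∃ u : ℝ → ℝ, u = fun s => (f s).1 := ⟨_, rfl⟩
  obtain ⟨v, hv⟩ : ∃ v : ℝ → ℝ, v = fun s => (f s).2 := ⟨_, rfl⟩
  obtain ⟨z, hz⟩ : ∃ z : ℝ → V, z = zf f := ⟨_, rfl⟩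
  obtain ⟨x, hx⟩ : ∃ x : ℝ → V, x = xf f := ⟨_, rfl⟩
  obtain ⟨q, hq⟩ : ∃ q : ℕ → ℝ, q = qf f := ⟨_, rfl⟩
  have hu_neg : ∀ t < 0, u t = u₀ t := by
    intro t ht
    simp only [hu]
    rw [hf]
    simp [Φ, ht]
  have hu_hold : ∀ i : ℕ, ∀ t ∈ Set.Ico ((i : ℝ) * T₂) (((i : ℝ) + 1) * T₂),
      u t = H i (z (i * T₂)) u := by
    intro i t ht
    have ht0 : 0 ≤ t := le_trans (by positivity) ht.1
    have hfl : ⌊t / T₂⌋₊ = i := by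
      rw [Nat.floor_eq_iff (div_nonneg ht0 hT₂.le), le_div_iff₀ hT₂, div_lt_iff₀ hT₂]
      exact ht
    have : u t = (Φ f t).1 := by rw [← hf, hu]
    rw [this]
    simp only [Φ, not_lt.2 ht0, if_false, hfl]
    rw [hz, hu]
  have hv_eq : ∀ i : ℕ, ∀ t ∈ Set.Ico (samplingTime T₁ b i) (samplingTime T₁ b (i + 1)),
      v t = Real.exp (φ p * (t - samplingTime T₁ b i)) * q i := by
    intro i t ht
    have ht0 : 0 ≤ t := (hnn i).trans ht.1
    have : v t = (Φ f t).2 := by rw [← hf, hv]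
    rw [this]
    simp only [Φ, not_lt.2 ht0, if_false, hidx_eq t i ht]
    rw [hq]
  have hv_samp : ∀ i : ℕ, v (samplingTime T₁ b i) = q i := by
    intro i
    rw [hv_eq i _ ⟨le_rfl, hmono (Nat.lt_succ_self i)⟩]
    simp
  have hui : ∀ s t : ℝ, -δ ≤ s → -δ ≤ t → IntervalIntegrable u volume s t := fun s t hs ht =>
    intervalIntegrable_of_hold hδ0 hT₂ hu₀ (fun θ hθ => hu_neg θ hθ.2) hu_hold hs ht
  have hvi : ∀ T, 0 ≤ T → IntervalIntegrable v volume 0 T := by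
    have key : ∀ i : ℕ, IntervalIntegrable v volume 0 (samplingTime T₁ b i) := by
      intro i
      induction i with
      | zero => exact IntervalIntegrable.refl
      | succ i ih =>
        refine ih.trans ?_
        have hc : IntervalIntegrable
            (fun t => Real.exp (φ p * (t - samplingTime T₁ b i)) * q i) volume
            (samplingTime T₁ b i) (samplingTime T₁ b (i + 1)) :=
          Continuous.intervalIntegrable (by fun_prop) _ _
        exact hc.congr_Ioo (hmono (Nat.lt_succ_self i)).le
          fun t ht => (hv_eq i t ⟨ht.1.le, ht.2⟩).symm
    intro T hT
    obtain ⟨i, hi⟩ := exists_lt_samplingTime hT₁ hb T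
    refine (key i).mono_set ?_
    rw [Set.uIcc_of_le hT, Set.uIcc_of_le (hnn i)]
    exact Set.Icc_subset_Icc le_rfl hi.le
  have hshift : ∀ a T : ℝ, 0 ≤ a → a ≤ δ → 0 ≤ T →
      IntervalIntegrable (fun s => u (s - a)) volume 0 T := by
    intro a T ha haδ hT
    have := (hui (0 - a) (T - a) (by linarith) (by linarith)).comp_sub_right a
    simpa using this
  have hzode : ∀ T, 0 ≤ T → SolvesODEFrom 0 (Set.Icc 0 T) z
      (fun t => F (z t) + (u (t - δ) • B + v t • p)) := by
    intro T hT
    have hzv : z = variationOfConstants F 0 z₀ (fun s => u (s - δ) • B + v s • p) := by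
      rw [hz, hu, hv]
    rw [hzv]
    exact solvesODEFrom_variationOfConstants F z₀
      ((IntervalIntegrable.smul_vector (hshift δ T hδ0 le_rfl hT) B).add
        (IntervalIntegrable.smul_vector (hvi T hT) p))
  have hx_nonpos : ∀ t ≤ 0, x t = x₀ t := fun t ht => by
    rw [hx]; exact if_pos ht
  have hxv : ∀ t, 0 ≤ t → x t =
      variationOfConstants F 0 (x₀ 0) (fun s => u (s - τ) • B + G' (d s)) t := by
    intro t ht
    rcases ht.eq_or_lt with rfl | ht'
    · rw [variationOfConstants_self, hx_nonpos 0 le_rfl]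
    · rw [hx, hu]
      exact if_neg (not_le.2 ht')
  have hxode : ∀ T, 0 ≤ T → SolvesODEFrom 0 (Set.Icc 0 T) x
      (fun t => F (x t) + (u (t - τ) • B + G' (d t))) := by
    intro T hT
    have h1 := (solvesODEFrom_variationOfConstants F (x₀ 0)
      ((IntervalIntegrable.smul_vector (hshift τ T hτ (by linarith) hT) B).add
        (IntervalIntegrable.clm_apply_continuous (G := fun _ => G') continuous_const (hd T hT)))).congr
      (f' := fun t => F (x t) + (u (t - τ) • B + G' (d t)))
      (fun t ht => by rw [hxv t ht.1.le])
    intro t ht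
    obtain ⟨h2, h3⟩ := h1 t ht
    refine ⟨h2, ?_⟩
    rw [hxv t ht.1, hxv 0 le_rfl]
    exact h3
  have hz0 : z 0 = z₀ := by rw [hz]; exact variationOfConstants_self _ _ _ _
  have hvw : ∀ t, φ (z t) - (φ (z t) - v t) = v t := fun t => sub_sub_cancel _ _
  refine ⟨x, u, z, fun t => φ (z t) - v t, fun θ hθ => hx_nonpos θ hθ.2,
    fun θ hθ => hu_neg θ hθ.2, hz0, ?_, fun t ht => hxode t ht t ⟨ht, le_rfl⟩, ?_, ?_, ?_, hu_hold⟩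
  · have h1 : v 0 = q 0 := hv_samp 0
    have h2 : q 0 = φ z₀ - w₀ := by rw [hq]; exact if_pos rfl
    simp only [h1, h2, hz0]
    ring
  · simp only [hvw]
    exact fun t ht => hzode t ht t ⟨ht, le_rfl⟩
  · intro i t ht
    have ht0 : 0 ≤ t := (hnn i).trans ht.1
    obtain ⟨h1, h2⟩ := ((hzode t ht0).restart ⟨hnn i, ht.1⟩) t ⟨ht.1, le_rfl⟩
    have hφ : IntervalIntegrable (fun s => φ (F (z s) + (u (s - δ) • B + v s • p))) volume
        (samplingTime T₁ b i) t := ⟨φ.integrable_comp h1.1, φ.integrable_comp h1.2⟩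
    have hve : ∀ s ∈ Set.Icc (samplingTime T₁ b i) t,
        v s = Real.exp (φ p * (s - samplingTime T₁ b i)) * q i := fun s hs =>
      hv_eq i s ⟨hs.1, hs.2.trans_lt ht.2⟩
    have hder : ∀ s ∈ Set.uIcc (samplingTime T₁ b i) t, HasDerivAt
        (fun s => Real.exp (φ p * (s - samplingTime T₁ b i)) * q i)
        (φ p * (Real.exp (φ p * (s - samplingTime T₁ b i)) * q i)) s := by
      intro s _
      have h3 : HasDerivAt (fun s => φ p * (s - samplingTime T₁ b i)) (φ p) s := by
        simpa using ((hasDerivAt_id s).sub_const (samplingTime T₁ b i)).const_mul (φ p)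
      exact (h3.exp.mul_const (q i)).congr_deriv (by ring)
    have hFTC := intervalIntegral.integral_eq_sub_of_hasDerivAt hder
      (Continuous.intervalIntegrable (by fun_prop) _ _)
    have hvint : ∫ s in (samplingTime T₁ b i)..t, φ p * v s = v t - v (samplingTime T₁ b i) := by
      rw [hve t ⟨ht.1, le_rfl⟩, hve _ ⟨le_rfl, ht.1⟩, ← hFTC]
      exact intervalIntegral.integral_congr_Ioo' ht.1 fun s hs => by
        rw [hve s ⟨hs.1.le, hs.2.le⟩]
    have hvii : IntervalIntegrable (fun s => φ p * v s) volume (samplingTime T₁ b i) t :=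
      ((hvi _ (hnn i)).symm.trans (hvi t ht0)).const_mul _
    -- As `w = φ(z) - v`, subtracting `v' = φ(p) v` removes the injection term from `φ(z')`.
    have hfun : (fun t => φ (F (z t)) + φ B * u (t - δ)) = fun s =>
        φ (F (z s) + (u (s - δ) • B + v s • p)) - φ p * v s := by
      funext s
      simp only [map_add, map_smul, smul_eq_mul]
      ring
    rw [hfun]
    refine ⟨hφ.sub hvii, ?_⟩
    rw [intervalIntegral.integral_sub hφ hvii, hvint, φ.intervalIntegral_comp_comm h1]
    simp only
    rw [h2, map_add]
    ring
  · intro i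
    have h1 := hv_samp (i + 1)
    have h2 : q (i + 1) = φ (z (samplingTime T₁ b (i + 1))) -
        φ (x (samplingTime T₁ b (i + 1) - r)) - ξ (samplingTime T₁ b (i + 1)) := by
      rw [hq, hz, hx]
      exact if_neg (Nat.succ_ne_zero i)
    simp only [h1, h2]
    ring

end

theorem exists_isClosedLoopSolution {n : ℕ} (A G : Matrix (Fin n) (Fin n) ℝ)
    (B c k p : EuclideanSpace ℝ (Fin n)) {r τ T₁ T₂ : ℝ} (hr : 0 ≤ r) (hτ : 0 ≤ τ)
    (hT₁ : 0 < T₁) (hT₂ : 0 < T₂) (x₀ : ℝ → EuclideanSpace ℝ (Fin n)) {u₀ : ℝ → ℝ}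
    (z₀ : EuclideanSpace ℝ (Fin n)) (w₀ : ℝ) (ξ : ℝ → ℝ) {b : ℝ → ℝ}
    {d : ℝ → EuclideanSpace ℝ (Fin n)} (hu₀ : IsLInftyLoc (Set.Icc (-r - τ) 0) u₀)
    (hb : IsLInftyLoc (Set.Ici 0) b) (hd : IsLInftyLoc (Set.Ici 0) d) :
    ∃ (x : ℝ → EuclideanSpace ℝ (Fin n)) (u : ℝ → ℝ) (z : ℝ → EuclideanSpace ℝ (Fin n))
      (w : ℝ → ℝ), IsClosedLoopSolution A G B c k p r τ T₁ T₂ x₀ u₀ z₀ w₀ ξ b d x u z w := by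
  have e : -r - τ = -(r + τ) := by ring
  obtain ⟨x, u, z, w, h1, h2, h3, h4, h5, h6, h7, h8, h9⟩ := exists_sampledHoldLoop
    (Matrix.toEuclideanCLM (𝕜 := ℝ) A) (Matrix.toEuclideanCLM (𝕜 := ℝ) G) (innerSL ℝ c) B p
    hr hτ rfl hT₁ hT₂
    (fun i ζ u => inner ℝ k (matAct (NormedSpace.exp ((r + τ) • A)) ζ) +
      ∫ s in (-r - τ)..0, inner ℝ k (matAct (NormedSpace.exp ((-s) • A)) B) * u (i * T₂ + s))
    (fun i ζ u u' huu => by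
      congr 1
      refine intervalIntegral.integral_congr_Ioo' (by linarith) fun s hs => ?_
      rw [huu _ (by linarith [hs.2])])
    x₀ u₀ z₀ w₀ ξ b d
    (by
      rw [e] at hu₀
      exact hu₀.intervalIntegrable (by linarith) le_rfl) hb
    (fun T hT => hd.intervalIntegrable hT Set.Icc_subset_Ici_self)
  refine ⟨x, u, z, w, h1, by rwa [e], h3, h4, ?_, ?_, ?_, h8, h9⟩
  · simp only [← add_assoc] at h5
    exact h5
  · simp only [← add_assoc, ← sub_sub] at h6
    exact h6
  · simp only [← sub_sub] at h7
    exact h7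

/-! ### Suprema, the gain, and the theorem -/

theorem one_le_gainM {β ω r τ T₁ T₂ ρ : ℝ} (hβ : 0 < β) (hω : 0 < ω) (hT₁ : 0 < T₁)
    (hT₂ : 0 < T₂) : 1 ≤ gainM 1 β ω r τ T₁ T₂ ρ := by
  refine one_le_pow₀ ?_
  have h0 : 0 < ω * T₁ * Real.exp (-ρ) := by positivity
  have h1 : Real.exp (-ω * T₁ * Real.exp (-ρ)) < 1 := Real.exp_lt_one_iff.2 (by linarith)
  have h2 : 0 < Real.sqrt (1 - Real.exp (-ω * T₁ * Real.exp (-ρ))) :=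
    Real.sqrt_pos.2 (by linarith)
  have h3 : Real.sqrt (1 - Real.exp (-ω * T₁ * Real.exp (-ρ))) ≤ 1 :=
    Real.sqrt_le_one.2 (by linarith [Real.exp_pos (-ω * T₁ * Real.exp (-ρ))])
  rw [one_le_div h2, one_mul]
  exact h3.trans (Real.one_le_exp (by positivity))

theorem norm_le_supNormOn {E : Type*} [NormedAddCommGroup E] {S : Set ℝ} {f : ℝ → E} {C : ℝ}
    (h : ∀ s ∈ S, ‖f s‖ ≤ C) {s : ℝ} (hs : s ∈ S) : ‖f s‖ ≤ supNormOn S f :=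
  le_csSup ⟨C, by rintro _ ⟨t, ht, rfl⟩; exact h t ht⟩ ⟨s, hs, rfl⟩

theorem supNormOn_nonneg {E : Type*} [NormedAddCommGroup E] (S : Set ℝ) (f : ℝ → E) :
    0 ≤ supNormOn S f :=
  Real.sSup_nonneg (by rintro _ ⟨t, _, rfl⟩; exact norm_nonneg _)

/-- The sign of `C` covers the empty `S`, where the supremum is `0`; this happens for the input
history when `r + τ = 0`. -/
theorem supNormOn_le {E : Type*} [NormedAddCommGroup E] {S : Set ℝ} {f : ℝ → E} {C : ℝ}
    (hC : 0 ≤ C) (h : ∀ s ∈ S, ‖f s‖ ≤ C) : supNormOn S f ≤ C :=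
  Real.sSup_le (by rintro _ ⟨t, ht, rfl⟩; exact h t ht) hC

theorem discountedSup_nonneg {E : Type*} [NormedAddCommGroup E] (σ : ℝ) (f : ℝ → E) (t : ℝ) :
    0 ≤ discountedSup σ f t :=
  Real.sSup_nonneg (by rintro _ ⟨s, _, rfl⟩; positivity)

/-- Converts a discounted supremum up to `t` into an envelope `D exp(-σ s)` on `[0, t]`, the form
required by the closed-loop estimate. -/
theorem IsLInftyLoc.norm_le_discountedSup {E : Type*} [NormedAddCommGroup E] {σ : ℝ} (hσ : 0 ≤ σ)
    {f : ℝ → E} (hf : IsLInftyLoc (Set.Ici 0) f) {s t : ℝ} (hs : s ∈ Set.Icc 0 t) :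
    ‖f s‖ ≤ Real.exp (σ * t) * discountedSup σ f t * Real.exp (-σ * s) := by
  obtain ⟨C, hC⟩ := hf.2 (Set.Icc 0 t) Set.Icc_subset_Ici_self isCompact_Icc
  have h1 : Real.exp (-σ * (t - s)) * ‖f s‖ ≤ discountedSup σ f t := by
    refine le_csSup ⟨C, ?_⟩ ⟨s, hs, rfl⟩
    rintro _ ⟨v, hv, rfl⟩
    have h2 : Real.exp (-σ * (t - v)) ≤ 1 :=
      Real.exp_le_one_iff.2 (by nlinarith [hv.2])
    calc Real.exp (-σ * (t - v)) * ‖f v‖ ≤ 1 * ‖f v‖ := by gcongr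
      _ ≤ C := by rw [one_mul]; exact hC v hv
  have h3 : Real.exp (σ * t) * Real.exp (-σ * (t - s)) * Real.exp (-σ * s) = 1 := by
    rw [← Real.exp_add, ← Real.exp_add, Real.exp_eq_one_iff]
    ring
  calc ‖f s‖ = (Real.exp (σ * t) * Real.exp (-σ * (t - s)) * Real.exp (-σ * s)) * ‖f s‖ := by
        rw [h3, one_mul]
    _ = Real.exp (σ * t) * (Real.exp (-σ * (t - s)) * ‖f s‖) * Real.exp (-σ * s) := by ring
    _ ≤ _ := by gcongr

theorem isLInftyLoc_zero {E : Type*} [NormedAddCommGroup E] (I : Set ℝ) :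
    IsLInftyLoc I (fun _ => (0 : E)) :=
  ⟨aestronglyMeasurable_const, fun _ _ _ => ⟨0, fun _ _ => by simp⟩⟩

theorem corollary4p1 {n : ℕ} (A G : Matrix (Fin n) (Fin n) ℝ)
    (B c k p : EuclideanSpace ℝ (Fin n)) (r τ : ℝ) (hr : 0 ≤ r) (hτ : 0 ≤ τ)
    (hk : IsHurwitzMatrix (A + outerProd B k)) (hp : IsHurwitzMatrix (A + outerProd p c)) :
    ∃ T₁max > (0 : ℝ), ∃ T₂max > (0 : ℝ),
      ∀ T₁ : ℝ, 0 < T₁ → T₁ ≤ T₁max → ∀ T₂ : ℝ, 0 < T₂ → T₂ ≤ T₂max →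
      ∃ Θ₁ > (0 : ℝ), ∃ Θ₂ > (0 : ℝ), ∃ Θ₃ > (0 : ℝ), ∃ Θ₄ > (0 : ℝ), ∃ Θ₅ > (0 : ℝ),
      ∃ Θ₆ > (0 : ℝ), ∃ Θ₇ > (0 : ℝ), ∃ σ > (0 : ℝ), ∃ ω > (0 : ℝ), ∃ β > (0 : ℝ),
      ∀ (x₀ : ℝ → EuclideanSpace ℝ (Fin n)) (u₀ : ℝ → ℝ)
        (z₀ : EuclideanSpace ℝ (Fin n)) (w₀ : ℝ)
        (ξ b : ℝ → ℝ) (d : ℝ → EuclideanSpace ℝ (Fin n)),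
        ContinuousOn x₀ (Set.Icc (-r) 0) →
        IsLInftyLoc (Set.Icc (-r - τ) 0) u₀ →
        IsLInftyLoc (Set.Ici 0) ξ →
        IsLInftyLoc (Set.Ici 0) b → (∀ t : ℝ, 0 ≤ t → 0 ≤ b t) →
        IsLInftyLoc (Set.Ici 0) d →
        ∃ (x : ℝ → EuclideanSpace ℝ (Fin n)) (u : ℝ → ℝ)
          (z : ℝ → EuclideanSpace ℝ (Fin n)) (w : ℝ → ℝ),
          -- the solution of the closed loop exists for all times
          IsClosedLoopSolution A G B c k p r τ T₁ T₂ x₀ u₀ z₀ w₀ ξ b d x u z w ∧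
          -- it is the only one
          (∀ (x' : ℝ → EuclideanSpace ℝ (Fin n)) (u' : ℝ → ℝ)
            (z' : ℝ → EuclideanSpace ℝ (Fin n)) (w' : ℝ → ℝ),
            IsClosedLoopSolution A G B c k p r τ T₁ T₂ x₀ u₀ z₀ w₀ ξ b d x' u' z' w' →
            Set.EqOn x' x (Set.Ici (-r)) ∧ Set.EqOn u' u (Set.Ici (-r - τ)) ∧
              Set.EqOn z' z (Set.Ici 0) ∧ Set.EqOn w' w (Set.Ici 0)) ∧
          -- and it satisfies the exponential input-to-state estimate
          ∀ t : ℝ, 0 ≤ t →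
            ‖z t‖ + |w t| + supNormOn (Set.Icc (-r) 0) (historyAt x t) +
                supNormOn (Set.Ico (-r - τ) 0) (historyAt u t) ≤
              Real.exp (-σ * t) *
                  gainM Θ₇ β ω r τ T₁ T₂
                    (sSup (b '' Set.Icc 0 ((holdIndex r T₁ T₂ : ℝ) * T₂ + τ))) *
                  (Θ₁ * ‖z₀‖ + Θ₂ * |w₀| + Θ₃ * supNormOn (Set.Icc (-r) 0) x₀ +
                    Θ₄ * supNormOn (Set.Ico (-r - τ) 0) u₀) +
                gainM Θ₇ β ω r τ T₁ T₂
                    (sSup (b '' Set.Icc 0 ((holdIndex r T₁ T₂ : ℝ) * T₂ + τ))) *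
                  Θ₅ * discountedSup σ ξ t +
                gainM Θ₇ β ω r τ T₁ T₂
                    (sSup (b '' Set.Icc 0 ((holdIndex r T₁ T₂ : ℝ) * T₂ + τ))) *
                  Θ₆ * discountedSup σ d t := by
  obtain ⟨T₁max, hT₁max, T₂max, hT₂max, σ, hσ, C, hC, est⟩ :=
    exists_closedLoop_estimate A G B c k p r τ hr hτ hk hp
  refine ⟨T₁max, hT₁max, T₂max, hT₂max, fun T₁ hT₁ hT₁' T₂ hT₂ hT₂' => ?_⟩
  obtain ⟨Λ, hΛ⟩ : ∃ y : ℝ, y = Real.exp (σ * (r + τ)) := ⟨_, rfl⟩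
  have hΛ0 : 0 < Λ := by rw [hΛ]; exact Real.exp_pos _
  -- `2 * C` is for `z` and `w`, the rest for the two histories: `Λ` pays for looking back by at
  -- most `r + τ`, and the `1` for the part of a window that still lies in the initial data.
  obtain ⟨Θ, hΘ⟩ : ∃ y : ℝ, y = 2 * C + 2 * (Λ * (C + 1)) := ⟨_, rfl⟩
  have hΘ0 : 0 < Θ := by rw [hΘ]; positivity
  refine ⟨Θ, hΘ0, Θ, hΘ0, Θ, hΘ0, Θ, hΘ0, Θ, hΘ0, Θ, hΘ0, 1, one_pos, σ, hσ, 1, one_pos, 1,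
    one_pos, ?_⟩
  intro x₀ u₀ z₀ w₀ ξ b d hx₀ hu₀ hξ hb hb0 hd
  obtain ⟨x, u, z, w, hsol⟩ :=
    exists_isClosedLoopSolution A G B c k p hr hτ hT₁ hT₂ x₀ z₀ w₀ ξ hu₀ hb hd
  refine ⟨x, u, z, w, hsol, ?_, ?_⟩
  · intro x' u' z' w' hsol'
    have hdiff := hsol'.sub hr hτ hT₂ hsol hu₀
    have key : ∀ t, 0 ≤ t → ‖z' t - z t‖ ≤ 0 ∧ |w' t - w t| ≤ 0 ∧ ‖x' t - x t‖ ≤ 0 ∧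
        |u' t - u t| ≤ 0 := by
      intro t ht
      -- The difference has zero data, so `I = D = 0` is admissible and the estimate forces it to
      -- vanish.
      have := est T₁ hT₁ hT₁' T₂ hT₂ hT₂' _ _ _ _ _ _ _ _ _ _ _ (isLInftyLoc_zero _) hb hb0
        (isLInftyLoc_zero _) hdiff t 0 0 le_rfl le_rfl (by simp) (by simp) (by simp) (by simp)
        (by simp) (by simp) t ⟨ht, le_rfl⟩
      simpa using this
    refine ⟨fun t ht => ?_, fun t ht => ?_, fun t ht => ?_, fun t ht => ?_⟩
    · rcases le_or_gt t 0 with h | h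
      · rw [hsol'.x_init t ⟨ht, h⟩, hsol.x_init t ⟨ht, h⟩]
      · exact sub_eq_zero.1 (norm_le_zero_iff.1 (key t h.le).2.2.1)
    · rcases lt_or_ge t 0 with h | h
      · rw [hsol'.u_init t ⟨ht, h⟩, hsol.u_init t ⟨ht, h⟩]
      · exact sub_eq_zero.1 (norm_le_zero_iff.1 (key t h).2.2.2)
    · exact sub_eq_zero.1 (norm_le_zero_iff.1 (key t ht).1)
    · exact sub_eq_zero.1 (norm_le_zero_iff.1 (key t ht).2.1)
  · intro t ht
    obtain ⟨Cx, hCx⟩ := isCompact_Icc.exists_bound_of_continuousOn hx₀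
    obtain ⟨Cu, hCu⟩ := hu₀.2 _ le_rfl isCompact_Icc
    have hx₀s : ∀ θ ∈ Set.Icc (-r) 0, ‖x₀ θ‖ ≤ supNormOn (Set.Icc (-r) 0) x₀ := fun θ hθ =>
      norm_le_supNormOn hCx hθ
    have hu₀s : ∀ θ ∈ Set.Ico (-r - τ) 0, |u₀ θ| ≤ supNormOn (Set.Ico (-r - τ) 0) u₀ :=
      fun θ hθ => norm_le_supNormOn (fun s hs => hCu s ⟨hs.1, hs.2.le⟩) hθ
    have hξs := fun s (hs : s ∈ Set.Icc 0 t) => hξ.norm_le_discountedSup hσ.le hs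
    have hds := fun s (hs : s ∈ Set.Icc 0 t) => hd.norm_le_discountedSup hσ.le hs
    have hX0 := supNormOn_nonneg (Set.Icc (-r) 0) x₀
    have hU0 := supNormOn_nonneg (Set.Ico (-r - τ) 0) u₀
    have hΞ0 := discountedSup_nonneg σ ξ t
    have hΔ0 := discountedSup_nonneg σ d t
    generalize supNormOn (Set.Icc (-r) 0) x₀ = X at *
    generalize supNormOn (Set.Ico (-r - τ) 0) u₀ = U at *
    generalize discountedSup σ ξ t = Ξ at *
    generalize discountedSup σ d t = Δ at *
    obtain ⟨I, hI⟩ : ∃ y : ℝ, y = ‖z₀‖ + |w₀| + X + U := ⟨_, rfl⟩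
    obtain ⟨D, hD⟩ : ∃ y : ℝ, y = Real.exp (σ * t) * Ξ + Real.exp (σ * t) * Δ := ⟨_, rfl⟩
    have hz₀n := norm_nonneg z₀
    have hw₀n := abs_nonneg w₀
    have hI0 : 0 ≤ I := by rw [hI]; positivity
    have hD0 : 0 ≤ D := by rw [hD]; positivity
    have hΞD : Real.exp (σ * t) * Ξ ≤ D := by
      rw [hD]; exact le_add_of_nonneg_right (by positivity)
    have hΔD : Real.exp (σ * t) * Δ ≤ D := by
      rw [hD]; exact le_add_of_nonneg_left (by positivity)
    have hest := est T₁ hT₁ hT₁' T₂ hT₂ hT₂' x₀ u₀ z₀ w₀ ξ b d x u z w hu₀ hb hb0 hd hsol t I D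
      hI0 hD0 (by linarith) (by linarith) (fun θ hθ => (hx₀s θ hθ).trans (by linarith))
      (fun θ hθ => (hu₀s θ hθ).trans (by linarith))
      (fun s hs => (hξs s hs).trans (by gcongr)) (fun s hs => (hds s hs).trans (by gcongr))
    have hexp : ∀ s, t - s ≤ r + τ → Real.exp (-σ * s) ≤ Λ * Real.exp (-σ * t) := by
      intro s h
      rw [hΛ, ← Real.exp_add]
      apply Real.exp_le_exp.2
      nlinarith
    -- If the window reaches back to some `s ≤ 0`, then `t ≤ r + τ` and `Λ exp(-σ t) ≥ 1`, so the
    -- initial bound `I` may carry the weight.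
    have hinit : ∀ s, s ≤ 0 → t - s ≤ r + τ →
        I ≤ Λ * (C + 1) * (I + D) * Real.exp (-σ * t) := by
      intro s hs hst
      have h1 : (1 : ℝ) ≤ Λ * Real.exp (-σ * t) :=
        (Real.one_le_exp (by nlinarith)).trans (hexp s hst)
      calc I ≤ (Λ * Real.exp (-σ * t)) * (1 * I) := by
            rw [one_mul]; exact le_mul_of_one_le_left hI0 h1
        _ ≤ (Λ * Real.exp (-σ * t)) * ((C + 1) * (I + D)) := by
            gcongr <;> linarith
        _ = _ := by ring
    have hlate : ∀ s, t - s ≤ r + τ →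
        C * (I + D) * Real.exp (-σ * s) ≤ Λ * (C + 1) * (I + D) * Real.exp (-σ * t) := by
      intro s hst
      calc C * (I + D) * Real.exp (-σ * s) ≤ (C + 1) * (I + D) * (Λ * Real.exp (-σ * t)) := by
            gcongr
            · linarith
            · exact hexp s hst
        _ = _ := by ring
    have hxsup : supNormOn (Set.Icc (-r) 0) (historyAt x t) ≤
        Λ * (C + 1) * (I + D) * Real.exp (-σ * t) := by
      refine supNormOn_le (by positivity) fun θ hθ => ?_
      simp only [historyAt]
      rcases le_or_gt (t + θ) 0 with h | h
      · have h1 : t + θ ∈ Set.Icc (-r) 0 := ⟨by linarith [hθ.1], h⟩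
        rw [hsol.x_init _ h1]
        exact ((hx₀s _ h1).trans (by linarith)).trans (hinit (t + θ) h (by linarith [hθ.1]))
      · exact (hest (t + θ) ⟨h.le, by linarith [hθ.2]⟩).2.2.1.trans
          (hlate _ (by linarith [hθ.1]))
    have husup : supNormOn (Set.Ico (-r - τ) 0) (historyAt u t) ≤
        Λ * (C + 1) * (I + D) * Real.exp (-σ * t) := by
      refine supNormOn_le (by positivity) fun θ hθ => ?_
      simp only [historyAt]
      rcases lt_or_ge (t + θ) 0 with h | h
      · have h1 : t + θ ∈ Set.Ico (-r - τ) 0 := ⟨by linarith [hθ.1], h⟩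
        rw [hsol.u_init _ h1]
        exact ((hu₀s _ h1).trans (by linarith)).trans (hinit (t + θ) h.le (by linarith [hθ.1]))
      · exact (hest (t + θ) ⟨h, by linarith [hθ.2]⟩).2.2.2.trans
          (hlate _ (by linarith [hθ.1]))
    obtain ⟨hzt, hwt, -, -⟩ := hest t ⟨ht, le_rfl⟩
    have htot : ‖z t‖ + |w t| + supNormOn (Set.Icc (-r) 0) (historyAt x t) +
        supNormOn (Set.Ico (-r - τ) 0) (historyAt u t) ≤
        Θ * (I + D) * Real.exp (-σ * t) := by
      rw [hΘ]
      linarith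
    have hM := one_le_gainM (r := r) (τ := τ)
      (ρ := sSup (b '' Set.Icc 0 ((holdIndex r T₁ T₂ : ℝ) * T₂ + τ))) one_pos one_pos hT₁ hT₂
    generalize gainM 1 1 1 r τ T₁ T₂
      (sSup (b '' Set.Icc 0 ((holdIndex r T₁ T₂ : ℝ) * T₂ + τ))) = g at *
    have hcancel : Real.exp (σ * t) * Real.exp (-σ * t) = 1 := by
      rw [← Real.exp_add]; simp
    have hrew : Θ * (I + D) * Real.exp (-σ * t) =
        Real.exp (-σ * t) * (Θ * I) + Θ * Ξ + Θ * Δ := by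
      calc Θ * (I + D) * Real.exp (-σ * t) = Real.exp (-σ * t) * (Θ * I) +
          Θ * (Ξ + Δ) * (Real.exp (σ * t) * Real.exp (-σ * t)) := by rw [hD]; ring
        _ = _ := by rw [hcancel]; ring
    calc _ ≤ Θ * (I + D) * Real.exp (-σ * t) := htot
      _ ≤ g * (Θ * (I + D) * Real.exp (-σ * t)) := le_mul_of_one_le_left (by positivity) hM
      _ = _ := by rw [hrew, hI]; ring
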